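/- Let $f:(0,+\infty)\to\mathbb R$ be a function, not identically zero, such that 1. there is $\eta>0$ with $f(r)=O(r^{-1-\eta})$ as $r\to+\infty$; 2. there is a (possibly signed) Borel measure $\mu_f$ on $(0,+\infty)$ with $f(r)=\int_0^{+\infty}e^{-rt}\,d\mu_f(t)$ for every $r>0$, the integral being absolutely convergent. (As usual, a signed measure is $\mu_f=\mu^+-\mu^-$ with nonnegative Borel measures $\mu^\pm$, at least one of which is finite; an ordinary Borel measure is the case $\mu^-=0$.) For a lattice $L=\mathbb Zu_1\oplus\mathbb Zu_2$, with $(u_1,u_2)$ a basis of $\mathbb R^2$, put $$E_f[L]:=\sum_{p\in L\setminus\{0\}}f(|p|^2).$$ Let $L_0$ be a lattice of unit area, i.e. $|\det(u_1,u_2)|=1$. For $A>0$ we say that $E_f$ is critical at $\sqrt A\,L_0$ if $L_0$ is a critical point of $L\mapsto E_f[\sqrt A\,L]$ on the space of lattices of unit area, i.e. if $(x,y)\mapsto E_f[\sqrt A\,g_{x,y}L_0]$, where $g_{x,y}=y^{-1/2}\begin{pmatrix}1&x\\0&y\end{pmatrix}$ and $x\in\mathbb R$, $y>0$, is differentiable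 with zero gradient at $(x,y)=(0,1)$. Then there is a nonempty open interval $I\subset(0,+\infty)$ such that $E_f$ is critical at $\sqrt A\,L_0$ for all $A\in I$ if and only if $L_0$ is, up to a linear isometry of $\mathbb R^2$, the square lattice $\mathbb Z^2$ or the triangular lattice $$\Lambda_1=\sqrt{\tfrac{2}{\sqrt3}}\left[\mathbb Z(1,0)\oplus\mathbb Z\left(\tfrac12,\tfrac{\sqrt3}{2}\right)\right].$$ In that case $E_f$ is critical at $\sqrt A\,L_0$ for all $A\in(0,+\infty)$. -/

import Mathlib

open MeasureTheory Set Filter Asymptotics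
open scoped Pointwise

noncomputable section

namespace VolumeStationary

/-- The Euclidean plane. -/
abbrev Plane : Type := EuclideanSpace ℝ (Fin 2)

/-- The energy per point `E_f[L] = ∑_{p ∈ L ∖ {0}} f (|p|²)`. Only the values of `f` on `(0, ∞)`
are used. -/
def energy (f : ℝ → ℝ) (L : Submodule ℤ Plane) : ℝ :=
  ∑' p : {p : Plane // p ∈ L ∧ p ≠ 0}, f (‖(p : Plane)‖ ^ 2)

/-- `f(r) = ∫ e^{-rt} dμ(t)` for all `r > 0`, for some (possibly signed) Borel measure `μ` on
`(0, ∞)`. A signed Borel measure takes values in `(-∞, ∞]` or in `[-∞, ∞)`, that is, it is a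
difference `μpos - μneg` of two (nonnegative) Borel measures at least one of which is finite.
The case `μneg = 0` is that of an ordinary Borel measure. The integral converges absolutely. -/
def IsLaplaceTransform (f : ℝ → ℝ) : Prop :=
  ∃ μpos μneg : Measure ℝ, μpos (Iic 0) = 0 ∧ μneg (Iic 0) = 0 ∧
    (IsFiniteMeasure μpos ∨ IsFiniteMeasure μneg) ∧
    ∀ r : ℝ, 0 < r →
      Integrable (fun t : ℝ => Real.exp (-r * t)) μpos ∧
      Integrable (fun t : ℝ => Real.exp (-r * t)) μneg ∧
      f r = (∫ t, Real.exp (-r * t) ∂μpos) - ∫ t, Real.exp (-r * t) ∂μneg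

/-- The area-preserving linear map with matrix `y^{-1/2} (1 x; 0 y)`, for `y > 0`. It maps `ℤ²` to
the lattice `ℤ y^{-1/2} (1, 0) ⊕ ℤ y^{-1/2} (x, y)`, which is the usual parametrization of
unit-area lattices, up to rotation, by the upper half-plane. -/
def deform (x y : ℝ) : Plane →ₗ[ℝ] Plane :=
  Matrix.toEuclideanLin ((Real.sqrt y)⁻¹ • !![1, x; 0, y])

/-- `∇_L E_f[√A L₀] = 0`: the unit-area lattice `L₀` is a critical point of `L ↦ E_f[√A L]` on the
space of unit-area lattices. Every `g ∈ SL₂(ℝ)` is uniquely a product of a rotation and a map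
`deform x y` with `y > 0`, and `E_f` is invariant under rotations. Hence, in the coordinates
`(x, y)` of the upper half-plane, the unit-area lattices modulo rotation near `L₀` are the
`deform x y '' L₀`, with `L₀` itself at `(x, y) = (0, 1)`. Differentiability is part of the
definition. -/
def IsCriticalAt (f : ℝ → ℝ) (A : ℝ) (L₀ : Submodule ℤ Plane) : Prop :=
  HasFDerivAt
    (fun q : ℝ × ℝ =>
      energy f (Real.sqrt A • L₀.map ((deform q.1 q.2).restrictScalars ℤ)))
    (0 : ℝ × ℝ →L[ℝ] ℝ) (0, 1)

/-- The square lattice `ℤ² = ℤ (1, 0) ⊕ ℤ (0, 1)`. -/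
def squareLattice : Submodule ℤ Plane :=
  Submodule.span ℤ {!₂[(1 : ℝ), 0], !₂[(0 : ℝ), 1]}

/-- The triangular lattice `Λ_A = √(2A/√3) [ℤ (1, 0) ⊕ ℤ (1/2, √3/2)]` of area `A`. -/
def triangularLattice (A : ℝ) : Submodule ℤ Plane :=
  Real.sqrt (2 * A / Real.sqrt 3) •
    Submodule.span ℤ {!₂[(1 : ℝ), 0], !₂[(1 / 2 : ℝ), Real.sqrt 3 / 2]}

/-- Equality of lattices up to a linear isometry of the plane. -/
def SameUpToIsometry (L L' : Submodule ℤ Plane) : Prop :=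
  ∃ R : Plane ≃ₗᵢ[ℝ] Plane,
    L = L'.map ((R.toLinearEquiv : Plane →ₗ[ℝ] Plane).restrictScalars ℤ)

end VolumeStationary

end

/-! Identify the plane with ℂ. To first order, deforming the lattice changes |z|² by Im z² and -Re
z², so the gradient of the energy at √A L₀ is encoded by one complex number M(A) = ∑ f'(A|z|²) z²,
called `momentSum`, and criticality means M(A) = 0 (`isCriticalAt_planeLattice_iff`). If
multiplication by a root of unity u with u² ≠ 1 preserves the lattice, then M = u² M, so M = 0 for
every A. This settles the square and triangular lattices.

For the converse, let μ, ν be the positive and negative parts of the measure and let q be Re z² or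
Im z². Inserting the integral for f' into M(πA) = 0 shows that ∫ t Θ(At) dμ(t) = ∫ t Θ(At) dν(t),
where Θ(t) = ∑ q(z) exp(-πt|z|²). The law Θ(1/t) = t³ Θ(t) keeps Θ bounded near 0, both sides are
holomorphic in A on a sector, and equality on an interval spreads to all A > 0
(`IsModularFamily.realThetaTransform_eq_of_eqOn`). The transform is a multiplicative convolution. If
Θ > 0, integrating over A gives μ and ν the same total mass, which is finite because one of them is;
then the Mellin transform on Re s = 1 separates Θ from the measures, so the Laplace transforms
coincide and f = 0 (`IsModularFamily.integral_exp_eq`).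

It remains to show that for every other lattice one of the two forms has a positive theta series,
and by the transformation law t ≥ 1 is enough. For a reduced basis 1, x + iy with 0 ≤ x ≤ 1/2 and y
> 0, the form Re z² works when y ≥ 1.2 (`thetaRe_pos`) and when x = 0, y > 1 (`thetaRe_zero_pos`);
Im z² works when 0 < x < 1/2 and y ≥ 0.7 (`thetaIm_pos`). On the remaining edge x = 1/2, √3/2 < y <
1.2, exchanging the two basis vectors leads back to the last case (`special_or_integral_exp_eq`).

An analytic preliminary: M(A) needs f' to decay faster than r⁻², while only f is assumed to decay.
Landau interpolation along all derivatives supplies this (`isDecayPair_of_laplace`). -/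

noncomputable section

namespace VolumeStationary

open scoped Topology Real ENNReal

/-! ### Moments of Laplace transforms -/

/-- A measure on `(0, ∞)` whose Laplace transform converges on `(0, ∞)`. -/
structure IsLaplaceMeasure (μ : Measure ℝ) : Prop where
  null_Iic : μ (Iic 0) = 0
  integrable_exp : ∀ r : ℝ, 0 < r → Integrable (fun t : ℝ => Real.exp (-r * t)) μ

namespace IsLaplaceMeasure

variable {μ : Measure ℝ}

lemma ae_pos (h : IsLaplaceMeasure μ) : ∀ᵐ t ∂μ, 0 < t := by
  rw [ae_iff]
  simpa [Iic] using h.null_Iic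

lemma mem_interior (h : IsLaplaceMeasure μ) {r : ℝ} (hr : 0 < r) :
    -r ∈ interior (ProbabilityTheory.integrableExpSet id μ) := by
  rw [_root_.mem_interior]
  refine ⟨Iio 0, fun x hx => ?_, isOpen_Iio, by simpa using hr⟩
  have := h.integrable_exp (-x) (by simpa using hx)
  simpa [ProbabilityTheory.integrableExpSet] using this

lemma integrable_pow_mul_exp (h : IsLaplaceMeasure μ) (k : ℕ) {r : ℝ} (hr : 0 < r) :
    Integrable (fun t : ℝ => t ^ k * Real.exp (-r * t)) μ := by
  simpa using ProbabilityTheory.integrable_pow_mul_exp_of_mem_interior_integrableExpSet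
    (h.mem_interior hr) k

lemma hasDerivAt_moment (h : IsLaplaceMeasure μ) (k : ℕ) {r : ℝ} (hr : 0 < r) :
    HasDerivAt (fun s : ℝ => ∫ t, t ^ k * Real.exp (-s * t) ∂μ)
      (-∫ t, t ^ (k + 1) * Real.exp (-r * t) ∂μ) r := by
  have h1 := ProbabilityTheory.hasDerivAt_integral_pow_mul_exp_real (h.mem_interior hr) k
  have h2 := h1.scomp r (hasDerivAt_neg r)
  simpa [Function.comp_def] using h2

/-- Half of the exponential absorbs the power, through s^k / k! ≤ exp s at s = rt/2. -/
lemma pow_mul_exp_le (k : ℕ) {r t : ℝ} (hr : 0 < r) (ht : 0 < t) :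
    t ^ k * Real.exp (-r * t) ≤ k.factorial * 2 ^ k * (r ^ k)⁻¹ * Real.exp (-(r / 2) * t) := by
  have h1 := Real.pow_div_factorial_le_exp (r * t / 2) (by positivity) k
  have h2 : Real.exp (-r * t) = Real.exp (-(r / 2) * t) * (Real.exp (r * t / 2))⁻¹ := by
    rw [← Real.exp_neg, ← Real.exp_add]; congr 1; ring
  have h3 : t ^ k ≤ k.factorial * 2 ^ k * (r ^ k)⁻¹ * Real.exp (r * t / 2) := by
    have h4 : t ^ k = k.factorial * 2 ^ k * (r ^ k)⁻¹ * ((r * t / 2) ^ k / k.factorial) := by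
      rw [div_pow, mul_pow]
      field_simp
    rw [h4]
    gcongr
  rw [h2]
  calc t ^ k * (Real.exp (-(r / 2) * t) * (Real.exp (r * t / 2))⁻¹)
      ≤ (k.factorial * 2 ^ k * (r ^ k)⁻¹ * Real.exp (r * t / 2)) *
        (Real.exp (-(r / 2) * t) * (Real.exp (r * t / 2))⁻¹) := by gcongr
    _ = _ := by field_simp

lemma moment_nonneg (h : IsLaplaceMeasure μ) (k : ℕ) (r : ℝ) :
    0 ≤ ∫ t, t ^ k * Real.exp (-r * t) ∂μ := by
  refine integral_nonneg_of_ae ?_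
  filter_upwards [h.ae_pos] with t ht
  simp only [Pi.zero_apply]
  positivity

lemma moment_le (h : IsLaplaceMeasure μ) (k : ℕ) {r : ℝ} (hr : 0 < r) :
    ∫ t, t ^ k * Real.exp (-r * t) ∂μ ≤
      k.factorial * 2 ^ k * (r ^ k)⁻¹ * ∫ t, Real.exp (-(r / 2) * t) ∂μ := by
  rw [← integral_const_mul]
  refine integral_mono_ae (h.integrable_pow_mul_exp k hr)
    ((h.integrable_exp _ (half_pos hr)).const_mul _) ?_
  filter_upwards [h.ae_pos] with t ht using pow_mul_exp_le k hr ht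

/-- This is the decay available for each positive measure separately. Anything better for f' comes
from cancellation between the two measures. -/
lemma moment_isBigO (h : IsLaplaceMeasure μ) (k : ℕ) :
    (fun r : ℝ => ∫ t, t ^ k * Real.exp (-r * t) ∂μ) =O[atTop] fun r : ℝ => r ^ (-(k : ℝ)) := by
  refine IsBigO.of_bound (k.factorial * 2 ^ k * ∫ t, Real.exp (-(1 / 2) * t) ∂μ) ?_
  filter_upwards [eventually_ge_atTop 1] with r hr
  have hr0 : 0 < r := by linarith
  rw [Real.norm_of_nonneg (h.moment_nonneg k r), Real.norm_of_nonneg (by positivity),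
    Real.rpow_neg hr0.le, Real.rpow_natCast]
  refine (h.moment_le k hr0).trans ?_
  have : ∫ t, Real.exp (-(r / 2) * t) ∂μ ≤ ∫ t, Real.exp (-(1 / 2) * t) ∂μ := by
    refine integral_mono_ae (h.integrable_exp _ (half_pos hr0))
      (h.integrable_exp _ (by norm_num)) ?_
    filter_upwards [h.ae_pos] with t ht
    apply Real.exp_le_exp.2
    nlinarith
  calc _ ≤ k.factorial * 2 ^ k * (r ^ k)⁻¹ * ∫ t, Real.exp (-(1 / 2) * t) ∂μ := by gcongr
    _ = _ := by ring

end IsLaplaceMeasure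

/-! ### Decay of the derivative by interpolation -/

/-- Landau's interpolation inequality for power decay. -/
lemma isBigO_deriv_of_isBigO {g g₁ g₂ : ℝ → ℝ} {p q : ℝ} (hp : 0 ≤ p) (hq : 0 ≤ q)
    (h1 : ∀ r, 0 < r → HasDerivAt g (g₁ r) r) (h2 : ∀ r, 0 < r → HasDerivAt g₁ (g₂ r) r)
    (hg : g =O[atTop] fun r : ℝ => r ^ (-p)) (hg₂ : g₂ =O[atTop] fun r : ℝ => r ^ (-q)) :
    g₁ =O[atTop] fun r : ℝ => r ^ (-((p + q) / 2)) := by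
  obtain ⟨C, hC, hgC⟩ := hg.exists_pos
  obtain ⟨D, hD, hgD⟩ := hg₂.exists_pos
  obtain ⟨R, hR⟩ := eventually_atTop.1 (hgC.bound.and hgD.bound)
  refine IsBigO.of_bound (2 * C + D) ?_
  filter_upwards [eventually_ge_atTop (max R 1)] with r hr
  have hrR : R ≤ r := le_trans (le_max_left _ _) hr
  have hr0 : 0 < r := lt_of_lt_of_le one_pos (le_trans (le_max_right _ _) hr)
  have anti : ∀ {s e : ℝ}, r ≤ s → 0 ≤ e → s ^ (-e) ≤ r ^ (-e) := fun hs he =>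
    Real.rpow_le_rpow_of_nonpos hr0 hs (by linarith)
  have bg : ∀ s, r ≤ s → |g s| ≤ C * r ^ (-p) := fun s hs => by
    have := (hR s (hrR.trans hs)).1
    rw [Real.norm_eq_abs, Real.norm_of_nonneg (Real.rpow_nonneg (hr0.le.trans hs) _)] at this
    exact this.trans (mul_le_mul_of_nonneg_left (anti hs hp) hC.le)
  have bg₂ : ∀ s, r ≤ s → |g₂ s| ≤ D * r ^ (-q) := fun s hs => by
    have := (hR s (hrR.trans hs)).2
    rw [Real.norm_eq_abs, Real.norm_of_nonneg (Real.rpow_nonneg (hr0.le.trans hs) _)] at this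
    exact this.trans (mul_le_mul_of_nonneg_left (anti hs hq) hD.le)
  -- This step length balances the two errors r^(-p)/h and r^(-q) h. It need not be small, since the
  -- bounds hold on all of [r, ∞).
  set h : ℝ := r ^ ((q - p) / 2) with hh
  have hh0 : 0 < h := Real.rpow_pos_of_pos hr0 _
  obtain ⟨c, hc, hc'⟩ := exists_hasDerivAt_eq_slope g g₁ (a := r) (b := r + h) (by linarith)
    (fun s hs => (h1 s (hr0.trans_le hs.1)).continuousAt.continuousWithinAt)
    (fun s hs => h1 s (hr0.trans hs.1))
  obtain ⟨d, hd, hd'⟩ := exists_hasDerivAt_eq_slope g₁ g₂ (a := r) (b := c) hc.1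
    (fun s hs => (h2 s (hr0.trans_le hs.1)).continuousAt.continuousWithinAt)
    (fun s hs => h2 s (hr0.trans hs.1))
  have e1 : |g₁ c| ≤ 2 * C * r ^ (-p) / h := by
    rw [hc', add_sub_cancel_left, abs_div, abs_of_pos hh0]
    gcongr
    calc |g (r + h) - g r| ≤ |g (r + h)| + |g r| := abs_sub _ _
      _ ≤ C * r ^ (-p) + C * r ^ (-p) := add_le_add (bg _ (by linarith)) (bg _ le_rfl)
      _ = _ := by ring
  have e2 : |g₁ c - g₁ r| ≤ D * r ^ (-q) * h := by
    have : g₁ c - g₁ r = g₂ d * (c - r) := by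
      rw [hd']; field_simp [sub_ne_zero.2 hc.1.ne']
    rw [this, abs_mul]
    gcongr
    · exact bg₂ _ hd.1.le
    · rw [abs_of_pos (by linarith [hc.1])]; linarith [hc.2]
  have e3 : r ^ (-p) / h = r ^ (-((p + q) / 2)) := by
    rw [hh, ← Real.rpow_sub hr0]; congr 1; ring
  have e4 : r ^ (-q) * h = r ^ (-((p + q) / 2)) := by
    rw [hh, ← Real.rpow_add hr0]; congr 1; ring
  rw [Real.norm_eq_abs, Real.norm_of_nonneg (Real.rpow_nonneg hr0.le _)]
  calc |g₁ r| = |g₁ c - (g₁ c - g₁ r)| := by ring_nf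
    _ ≤ |g₁ c| + |g₁ c - g₁ r| := abs_sub _ _
    _ ≤ 2 * C * r ^ (-p) / h + D * r ^ (-q) * h := add_le_add e1 e2
    _ = 2 * C * (r ^ (-p) / h) + D * (r ^ (-q) * h) := by ring
    _ = _ := by rw [e3, e4]; ring

/-- If all derivatives of `g 0` decay as derivatives of a bounded symbol do, then a decay rate of
`g 0` passes to the derivative with arbitrarily small loss. -/
lemma isBigO_deriv_chain (n : ℕ) : ∀ (g : ℕ → ℝ → ℝ) (σ β : ℝ), 0 ≤ σ → 0 ≤ β →
    (∀ k r, 0 < r → HasDerivAt (g k) (g (k + 1) r) r) →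
    (∀ k, g k =O[atTop] fun r : ℝ => r ^ (-(k + σ))) →
    (g 0 =O[atTop] fun r : ℝ => r ^ (-(σ + β))) →
    g 1 =O[atTop] fun r : ℝ => r ^ (-(1 + σ + n / (n + 2) * β)) := by
  induction n with
  | zero =>
    intro g σ β _ _ _ hb _
    simpa using hb 1
  | succ n ih =>
    intro g σ β hσ hβ hd hb h0
    have h1 := ih g σ β hσ hβ hd hb h0
    -- With θ = n/(n+2), the gain θβ for the first derivative becomes a gain θ²β for the second.
    -- Landau then improves the first to (1 + θ²)β/2, at least (n+1)/(n+3) β. Iterating drives the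
    -- factor to 1.
    have h2 := ih (fun k => g (k + 1)) (σ + 1) (n / (n + 2) * β) (by linarith) (by positivity)
      (fun k r hr => hd (k + 1) r hr)
      (fun k => by
        have := hb (k + 1)
        refine this.congr_right fun r => ?_
        push_cast; ring_nf)
      (by
        refine h1.congr_right fun r => ?_
        ring_nf)
    have h3 := isBigO_deriv_of_isBigO (p := σ + β)
      (q := 1 + (σ + 1) + n / (n + 2) * (n / (n + 2) * β)) (by positivity) (by positivity)
      (hd 0) (hd 1) h0 h2
    refine h3.trans ?_
    refine IsBigO.of_bound 1 ?_
    filter_upwards [eventually_ge_atTop 1] with r hr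
    have hr0 : 0 < r := by linarith
    rw [Real.norm_of_nonneg (by positivity), Real.norm_of_nonneg (by positivity), one_mul]
    apply Real.rpow_le_rpow_of_exponent_le hr
    have hn : (0 : ℝ) ≤ n := Nat.cast_nonneg n
    have key : ((n + 1 : ℕ) : ℝ) / ((n + 1 : ℕ) + 2) ≤
        (1 + (n / (n + 2)) * (n / (n + 2) : ℝ)) / 2 := by
      push_cast
      rw [div_mul_div_comm, div_le_div_iff₀ (by positivity) two_pos,
        ← sub_nonneg]
      have : (1 + (n : ℝ) * n / ((n + 2) * (n + 2))) * (n + 1 + 2) - (n + 1) * 2 =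
        4 / (((n : ℝ) + 2) * (n + 2)) := by
        field_simp; ring
      rw [this]; positivity
    have := mul_le_mul_of_nonneg_right key hβ
    linarith

/-! ### Pairs f, f' with summable decay -/

/-- A pair of functions `f`, `f'` on `(0, ∞)` with `f' = df/dr` such that the lattice sums of
`f` and `f'` converge well enough for termwise differentiation. -/
structure IsDecayPair (f f' : ℝ → ℝ) : Prop where
  hasDerivAt : ∀ r, 0 < r → HasDerivAt f (f' r) r
  decay : ∃ η : ℝ, 0 < η ∧ ∀ r₀ : ℝ, 0 < r₀ → ∃ C : ℝ, 0 < C ∧ ∀ r, r₀ ≤ r →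
    |f r| ≤ C * r ^ (-(1 + η)) ∧ |f' r| ≤ C * r ^ (-(2 + η))

lemma exists_bound_of_isBigO {g : ℝ → ℝ} {p r₀ : ℝ} (hr₀ : 0 < r₀)
    (hc : ContinuousOn g (Ioi 0)) (hg : g =O[atTop] fun r : ℝ => r ^ (-p)) :
    ∃ C : ℝ, 0 < C ∧ ∀ r, r₀ ≤ r → |g r| ≤ C * r ^ (-p) := by
  obtain ⟨C, hC, hgC⟩ := hg.exists_pos
  obtain ⟨R, hR⟩ := eventually_atTop.1 hgC.bound
  have hcont : ContinuousOn (fun r => g r / r ^ (-p)) (Icc r₀ R) := by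
    have hsub : Icc r₀ R ⊆ Ioi 0 := fun r hr => hr₀.trans_le hr.1
    refine (hc.mono hsub).div (fun r hr => ?_)
      fun r hr => (Real.rpow_pos_of_pos (hsub hr) _).ne'
    exact (Real.continuousAt_rpow_const _ _ (Or.inl (hsub hr).ne')).continuousWithinAt
  obtain ⟨D, hD⟩ := isCompact_Icc.exists_bound_of_continuousOn hcont
  refine ⟨max C D, lt_max_of_lt_left hC, fun r hr => ?_⟩
  have hr0 : 0 < r := hr₀.trans_le hr
  have hpos := Real.rpow_pos_of_pos hr0 (-p)
  rcases le_total R r with h | h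
  · have := hR r h
    rw [Real.norm_eq_abs, Real.norm_of_nonneg hpos.le] at this
    exact this.trans (by gcongr; exact le_max_left _ _)
  · have := hD r ⟨hr, h⟩
    rw [norm_div, Real.norm_eq_abs, Real.norm_of_nonneg hpos.le, div_le_iff₀ hpos] at this
    exact this.trans (by gcongr; exact le_max_right _ _)

/-- The derivative of the difference of two Laplace transforms. -/
def laplaceDeriv (μ ν : Measure ℝ) (r : ℝ) : ℝ :=
  (∫ t, t * Real.exp (-r * t) ∂ν) - ∫ t, t * Real.exp (-r * t) ∂μ

/-- The k-th derivative of f is O(r⁻ᵏ) by the moment bounds, so the interpolation chain with σ = 0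
and β = 1 + η applies. Half of η is given up to the loss in the chain. -/
lemma isDecayPair_of_laplace {f : ℝ → ℝ} {μ ν : Measure ℝ} (hμ : IsLaplaceMeasure μ)
    (hν : IsLaplaceMeasure ν) {η : ℝ} (hη : 0 < η)
    (hf : ∀ r : ℝ, 0 < r →
      f r = (∫ t, Real.exp (-r * t) ∂μ) - ∫ t, Real.exp (-r * t) ∂ν)
    (hdecay : f =O[atTop] fun r : ℝ => r ^ (-(2 : ℝ) / 2 - η)) :
    IsDecayPair f (laplaceDeriv μ ν) := by
  set g : ℕ → ℝ → ℝ := fun k r => (-1) ^ k *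
    ((∫ t, t ^ k * Real.exp (-r * t) ∂μ) - ∫ t, t ^ k * Real.exp (-r * t) ∂ν) with hg
  have hd : ∀ k r, 0 < r → HasDerivAt (g k) (g (k + 1) r) r := by
    intro k r hr
    have := ((hμ.hasDerivAt_moment k hr).sub (hν.hasDerivAt_moment k hr)).const_mul ((-1) ^ k)
    refine this.congr_deriv ?_
    simp only [hg, pow_succ]; ring
  have hb : ∀ k, g k =O[atTop] fun r : ℝ => r ^ (-((k : ℝ) + 0)) := by
    intro k
    simpa [hg] using ((hμ.moment_isBigO k).sub (hν.moment_isBigO k)).const_mul_left ((-1) ^ k)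
  have hfg : ∀ r, 0 < r → f r = g 0 r := fun r hr => by simp [hg, hf r hr]
  have hfg' : f =ᶠ[atTop] g 0 := by
    filter_upwards [eventually_gt_atTop 0] with r hr using hfg r hr
  have h0 : g 0 =O[atTop] fun r : ℝ => r ^ (-(0 + (1 + η))) := by
    refine (hdecay.congr' hfg' ?_)
    filter_upwards with r
    ring_nf
  have h1' : ∀ r, g 1 r = laplaceDeriv μ ν r := fun r => by simp [hg, laplaceDeriv]
  -- Chosen so that n/(n+2) · (1 + η) ≥ 1 + η/2, which yields f' = O(r^(-2-η/2)).
  obtain ⟨n, hn⟩ : ∃ n : ℕ, 4 * (1 + η) / η ≤ n := exists_nat_ge _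
  have h1 := isBigO_deriv_chain n g 0 (1 + η) le_rfl (by linarith) hd hb h0
  have hexp : 1 + η / 2 ≤ n / (n + 2) * (1 + η) := by
    rw [div_le_iff₀ hη] at hn
    have hn0 : (0 : ℝ) ≤ n := Nat.cast_nonneg n
    rw [div_mul_eq_mul_div, le_div_iff₀ (by positivity)]
    nlinarith
  have ev : ∀ {a b : ℝ}, a ≤ b →
      (fun r : ℝ => r ^ a) =O[atTop] fun r : ℝ => r ^ b := fun {a b} hab => by
    refine IsBigO.of_bound 1 ?_
    filter_upwards [eventually_ge_atTop 1] with r hr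
    have hr0 : 0 < r := by linarith
    rw [Real.norm_of_nonneg (by positivity), Real.norm_of_nonneg (by positivity), one_mul]
    exact Real.rpow_le_rpow_of_exponent_le hr hab
  have hder : ∀ r, 0 < r → HasDerivAt f (laplaceDeriv μ ν r) r := fun r hr => by
    have := hd 0 r hr
    rw [zero_add, h1'] at this
    refine this.congr_of_eventuallyEq ?_
    filter_upwards [lt_mem_nhds hr] with s hs using hfg s hs
  refine ⟨hder, η / 2, by linarith, fun r₀ hr₀ => ?_⟩
  obtain ⟨C, hC, hC'⟩ := exists_bound_of_isBigO (g := f) (p := 1 + η / 2) hr₀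
    (fun r hr => (hder r hr).continuousAt.continuousWithinAt)
    (hdecay.trans (ev (by linarith)))
  obtain ⟨D, hD, hD'⟩ := exists_bound_of_isBigO (g := laplaceDeriv μ ν) (p := 2 + η / 2) hr₀
    (fun r hr => by
      have := (hd 1 r hr).continuousAt
      rw [show g 1 = laplaceDeriv μ ν from funext h1'] at this
      exact this.continuousWithinAt)
    (by
      rw [← show g 1 = laplaceDeriv μ ν from funext h1']
      exact h1.trans (ev (by linarith)))
  refine ⟨max C D, lt_max_of_lt_left hC, fun r hr => ⟨(hC' r hr).trans ?_, (hD' r hr).trans ?_⟩⟩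
  · have := Real.rpow_nonneg (hr₀.le.trans hr) (-(1 + η / 2))
    gcongr; exact le_max_left _ _
  · have := Real.rpow_nonneg (hr₀.le.trans hr) (-(2 + η / 2))
    gcongr; exact le_max_right _ _

lemma isDecayPair_exp {c : ℝ} (hc : 0 < c) :
    IsDecayPair (fun r => Real.exp (-c * r)) (fun r => -c * Real.exp (-c * r)) := by
  have hbig : ∀ p : ℝ, (fun r : ℝ => Real.exp (-c * r)) =O[atTop] fun r : ℝ => r ^ p :=
    fun p => (isLittleO_exp_neg_mul_rpow_atTop hc p).isBigO
  refine ⟨fun r _ => ?_, 1, one_pos, fun r₀ hr₀ => ?_⟩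
  · have := ((hasDerivAt_id r).const_mul (-c)).exp
    refine this.congr_deriv ?_
    simp [mul_comm]
  · obtain ⟨C, hC, hC'⟩ := exists_bound_of_isBigO (g := fun r : ℝ => Real.exp (-c * r))
      (p := 1 + 1) hr₀ (by fun_prop) (hbig _)
    obtain ⟨D, hD, hD'⟩ := exists_bound_of_isBigO (g := fun r : ℝ => -c * Real.exp (-c * r))
      (p := 2 + 1) hr₀ (by fun_prop) ((hbig _).const_mul_left _)
    refine ⟨max C D, lt_max_of_lt_left hC, fun r hr => ⟨(hC' r hr).trans ?_, (hD' r hr).trans ?_⟩⟩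
    · have := Real.rpow_nonneg (hr₀.le.trans hr) (-((1:ℝ) + 1))
      gcongr; exact le_max_left _ _
    · have := Real.rpow_nonneg (hr₀.le.trans hr) (-((2:ℝ) + 1))
      gcongr; exact le_max_right _ _

/-! ### The gradient of a lattice sum under area-preserving deformation -/

/-- The squared norm of `deform x y z`, in complex coordinates. -/
def deformSq (q : ℝ × ℝ) (z : ℂ) : ℝ :=
  ((z.re + q.1 * z.im) ^ 2 + q.2 ^ 2 * z.im ^ 2) / q.2

/-- The differential of `q ↦ deformSq q z`. -/
def deformSqDeriv (q : ℝ × ℝ) (z : ℂ) : ℝ × ℝ →L[ℝ] ℝ :=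
  (2 * (z.re + q.1 * z.im) * z.im / q.2) • ContinuousLinearMap.fst ℝ ℝ ℝ +
    (z.im ^ 2 - (z.re + q.1 * z.im) ^ 2 / q.2 ^ 2) • ContinuousLinearMap.snd ℝ ℝ ℝ

lemma hasFDerivAt_deformSq {q : ℝ × ℝ} (hq : q.2 ≠ 0) (z : ℂ) :
    HasFDerivAt (fun q => deformSq q z) (deformSqDeriv q z) q := by
  have h1 : HasFDerivAt (fun q : ℝ × ℝ => q.1) (ContinuousLinearMap.fst ℝ ℝ ℝ) q := hasFDerivAt_fst
  have h2 : HasFDerivAt (fun q : ℝ × ℝ => q.2) (ContinuousLinearMap.snd ℝ ℝ ℝ) q := hasFDerivAt_snd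
  have h3 := ((((h1.mul_const z.im).const_add z.re).pow 2).fun_add
    ((h2.pow 2).mul_const (z.im ^ 2))).fun_mul ((hasDerivAt_inv hq).comp_hasFDerivAt q h2)
  simp only [deformSq, div_eq_mul_inv]
  refine h3.congr_fderiv ?_
  ext <;> simp [deformSqDeriv] <;> field_simp <;> ring

lemma deformSq_zero_one (z : ℂ) : deformSq (0, 1) z = ‖z‖ ^ 2 := by
  rw [← Complex.normSq_eq_norm_sq, Complex.normSq_apply]
  simp [deformSq]; ring

/-- A family of points of the plane that is as sparse as a lattice without its origin. -/
structure IsSparse {ι : Type*} (z : ι → ℂ) : Prop where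
  bound : ∃ c : ℝ, 0 < c ∧ ∀ i, c ≤ ‖z i‖
  summable : ∀ s : ℝ, 2 < s → Summable fun i => ‖z i‖ ^ (-s)

section Family

variable {ι : Type*} {z : ι → ℂ} {f f' : ℝ → ℝ} {A : ℝ}

lemma IsSparse.summable_of_decay (hz : IsSparse z) (hA : 0 < A) {g : ℝ → ℝ} {p : ℝ} (hp : 1 < p)
    (hg : ∀ r₀ : ℝ, 0 < r₀ → ∃ C : ℝ, ∀ r, r₀ ≤ r → |g r| ≤ C * r ^ (-p)) :
    Summable fun i => g (A * ‖z i‖ ^ 2) := by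
  obtain ⟨c, hc, hcz⟩ := hz.bound
  obtain ⟨C, hC⟩ := hg (A * c ^ 2) (by positivity)
  refine Summable.of_norm_bounded ((hz.summable (2 * p) (by linarith)).mul_left (C * A ^ (-p)))
    fun i => ?_
  have h0 : 0 < ‖z i‖ := hc.trans_le (hcz i)
  rw [Real.norm_eq_abs]
  refine (hC _ (by gcongr; exact hcz i)).trans (le_of_eq ?_)
  rw [Real.mul_rpow hA.le (by positivity), ← Real.rpow_natCast, ← Real.rpow_mul h0.le]
  push_cast; ring_nf

/-- Together with the bound on the derivative below, this makes the differentiated series dominated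
uniformly in a ball around the identity deformation. -/
lemma deformSq_ge {q : ℝ × ℝ} (hq : q ∈ Metric.ball ((0, 1) : ℝ × ℝ) (1 / 4)) (z : ℂ) :
    ‖z‖ ^ 2 / 4 ≤ deformSq q z := by
  obtain ⟨x, y⟩ := q
  rw [Metric.mem_ball, Prod.dist_eq, max_lt_iff, Real.dist_eq, Real.dist_eq, abs_lt, abs_lt] at hq
  obtain ⟨⟨h1, h2⟩, h3, h4⟩ := hq
  simp only at h1 h2 h3 h4
  rw [← Complex.normSq_eq_norm_sq, Complex.normSq_apply, deformSq]
  simp only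
  rw [le_div_iff₀ (by linarith)]
  have e1 : (0 : ℝ) ≤ (z.re + 2 * x * z.im) ^ 2 := sq_nonneg _
  have e2 : x ^ 2 * z.im ^ 2 ≤ (1 / 16) * z.im ^ 2 :=
    mul_le_mul_of_nonneg_right (by nlinarith) (sq_nonneg _)
  have e3 : (9 / 16) * z.im ^ 2 ≤ y ^ 2 * z.im ^ 2 :=
    mul_le_mul_of_nonneg_right (by nlinarith) (sq_nonneg _)
  have e4 : (z.re ^ 2 + z.im ^ 2) * y ≤ (z.re ^ 2 + z.im ^ 2) * (5 / 4) := by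
    gcongr; linarith
  nlinarith [sq_nonneg z.re, sq_nonneg z.im]

lemma norm_deformSqDeriv_le {q : ℝ × ℝ} (hq : q ∈ Metric.ball ((0, 1) : ℝ × ℝ) (1 / 4)) (z : ℂ) :
    ‖deformSqDeriv q z‖ ≤ 8 * ‖z‖ ^ 2 := by
  obtain ⟨x, y⟩ := q
  rw [Metric.mem_ball, Prod.dist_eq, max_lt_iff, Real.dist_eq, Real.dist_eq, abs_lt, abs_lt] at hq
  obtain ⟨⟨h1, h2⟩, h3, h4⟩ := hq
  simp only at h1 h2 h3 h4
  have hre := Complex.abs_re_le_norm z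
  have him := Complex.abs_im_le_norm z
  have hz := norm_nonneg z
  have hx : |x| ≤ 1 / 4 := abs_le.2 ⟨by linarith, by linarith⟩
  have hy : 3 / 4 ≤ y := by linarith
  have e1 : |z.re + x * z.im| ≤ 5 / 4 * ‖z‖ := by
    calc |z.re + x * z.im| ≤ |z.re| + |x * z.im| := abs_add_le _ _
      _ ≤ ‖z‖ + 1 / 4 * ‖z‖ := by rw [abs_mul]; gcongr
      _ = _ := by ring
  have e1' : (z.re + x * z.im) ^ 2 ≤ 25 / 16 * ‖z‖ ^ 2 := by
    rw [← sq_abs]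
    calc |z.re + x * z.im| ^ 2 ≤ (5 / 4 * ‖z‖) ^ 2 := by gcongr
      _ = _ := by ring
  have e2' : z.im ^ 2 ≤ ‖z‖ ^ 2 := by rw [← sq_abs]; gcongr
  have e2 : |2 * (z.re + x * z.im) * z.im / y| ≤ 4 * ‖z‖ ^ 2 := by
    rw [abs_div, abs_mul, abs_mul, abs_two, abs_of_pos (by linarith : (0 : ℝ) < y),
      div_le_iff₀ (by linarith)]
    calc 2 * |z.re + x * z.im| * |z.im| ≤ 2 * (5 / 4 * ‖z‖) * ‖z‖ := by gcongr
      _ ≤ 4 * ‖z‖ ^ 2 * y := by nlinarith [sq_nonneg ‖z‖]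
  have e3 : |z.im ^ 2 - (z.re + x * z.im) ^ 2 / y ^ 2| ≤ 4 * ‖z‖ ^ 2 := by
    have e4 : (z.re + x * z.im) ^ 2 / y ^ 2 ≤ 3 * ‖z‖ ^ 2 := by
      rw [div_le_iff₀ (by positivity)]
      have : (9 : ℝ) / 16 ≤ y ^ 2 := by nlinarith
      nlinarith [sq_nonneg ‖z‖]
    have e5 : 0 ≤ (z.re + x * z.im) ^ 2 / y ^ 2 := by positivity
    rw [abs_le]
    constructor <;> nlinarith [sq_nonneg z.im, sq_nonneg ‖z‖]
  have n1 : ‖ContinuousLinearMap.fst ℝ ℝ ℝ‖ ≤ 1 := ContinuousLinearMap.norm_fst_le _ _ _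
  have n2 : ‖ContinuousLinearMap.snd ℝ ℝ ℝ‖ ≤ 1 := ContinuousLinearMap.norm_snd_le _ _ _
  calc ‖deformSqDeriv (x, y) z‖ ≤ _ := norm_add_le _ _
    _ ≤ 4 * ‖z‖ ^ 2 * 1 + 4 * ‖z‖ ^ 2 * 1 := by
        rw [norm_smul, norm_smul, Real.norm_eq_abs, Real.norm_eq_abs]; gcongr
    _ = _ := by ring

/-- The sum over the family of `f'(A |z|²) z²`. -/
def momentSum (f' : ℝ → ℝ) (A : ℝ) (z : ι → ℂ) : ℂ :=
  ∑' i, (f' (A * ‖z i‖ ^ 2) : ℂ) * z i ^ 2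

lemma summable_momentSum (hf : IsDecayPair f f') (hz : IsSparse z) (hA : 0 < A) :
    Summable fun i => (f' (A * ‖z i‖ ^ 2) : ℂ) * z i ^ 2 := by
  obtain ⟨η, hη, hd⟩ := hf.decay
  have h : Summable fun i => (fun r => f' r * r) (A * ‖z i‖ ^ 2) := by
    refine hz.summable_of_decay (g := fun r => f' r * r) (p := 1 + η) hA (by linarith)
      fun r₀ hr₀ => ?_
    obtain ⟨C, -, hC⟩ := hd r₀ hr₀
    refine ⟨C, fun r hr => ?_⟩
    have hr0 : 0 < r := hr₀.trans_le hr
    rw [abs_mul, abs_of_pos hr0]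
    calc |f' r| * r ≤ C * r ^ (-(2 + η)) * r := by gcongr; exact (hC r hr).2
      _ = C * r ^ (-(1 + η)) := by
        rw [mul_assoc, ← Real.rpow_add_one hr0.ne']; ring_nf
  refine Summable.of_norm_bounded (h.abs.mul_left A⁻¹) fun i => le_of_eq ?_
  rw [norm_mul, Complex.norm_real, norm_pow, abs_mul, abs_of_nonneg
    (by positivity : 0 ≤ A * ‖z i‖ ^ 2), Real.norm_eq_abs]
  field_simp

/-- At (0, 1) the partial derivatives of the deformed squared norm are 2 Re z Im z = Im z² and (Im
z)² - (Re z)² = -Re z². Termwise differentiation is justified by the majorant |z|^(-2-2η), summable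
over a sparse family. -/
lemma hasFDerivAt_tsum_deformSq (hf : IsDecayPair f f') (hz : IsSparse z) (hA : 0 < A) :
    HasFDerivAt (fun q => ∑' i, f (A * deformSq q (z i)))
      ((A * (momentSum f' A z).im) • ContinuousLinearMap.fst ℝ ℝ ℝ -
        (A * (momentSum f' A z).re) • ContinuousLinearMap.snd ℝ ℝ ℝ) (0, 1) := by
  obtain ⟨η, hη, hd⟩ := hf.decay
  obtain ⟨c, hc, hcz⟩ := hz.bound
  obtain ⟨C, hC0, hC⟩ := hd (A * (c ^ 2 / 4)) (by positivity)
  have hmem : ((0, 1) : ℝ × ℝ) ∈ Metric.ball ((0, 1) : ℝ × ℝ) (1 / 4) :=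
    Metric.mem_ball_self (by norm_num)
  have hy : ∀ q ∈ Metric.ball ((0, 1) : ℝ × ℝ) (1 / 4), q.2 ≠ 0 := by
    rintro ⟨x, y⟩ hq
    rw [Metric.mem_ball, Prod.dist_eq, max_lt_iff, Real.dist_eq, Real.dist_eq, abs_lt, abs_lt] at hq
    simp only at hq ⊢
    linarith [hq.2.1]
  have hlow : ∀ i, ∀ q ∈ Metric.ball ((0, 1) : ℝ × ℝ) (1 / 4),
      A * (‖z i‖ ^ 2 / 4) ≤ A * deformSq q (z i) := fun i q hq => by
    gcongr; exact deformSq_ge hq _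
  have hlow' : ∀ i, A * (c ^ 2 / 4) ≤ A * (‖z i‖ ^ 2 / 4) := fun i => by
    gcongr; exact hcz i
  have hsum0 : Summable fun i => f (A * deformSq (0, 1) (z i)) := by
    simp only [deformSq_zero_one]
    refine hz.summable_of_decay (p := 1 + η) hA (by linarith) fun r₀ hr₀ => ?_
    obtain ⟨C, -, hC⟩ := hd r₀ hr₀
    exact ⟨C, fun r hr => (hC r hr).1⟩
  have main := hasFDerivAt_tsum_of_isPreconnected (𝕜 := ℝ)
    (f := fun i q => f (A * deformSq q (z i)))
    (f' := fun i q => f' (A * deformSq q (z i)) • (A • deformSqDeriv q (z i)))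
    (u := fun i => C * (A / 4) ^ (-(2 + η)) * (A * 8) * ‖z i‖ ^ (-(2 + 2 * η)))
    ((hz.summable _ (by linarith)).mul_left _) Metric.isOpen_ball
    (convex_ball ((0, 1) : ℝ × ℝ) (1 / 4)).isPreconnected
    (fun i q hq => ?_) (fun i q hq => ?_) hmem hsum0 hmem
  · refine main.congr_fderiv ?_
    have hs := summable_momentSum hf hz hA
    have hre := Complex.hasSum_re hs.hasSum
    have him := Complex.hasSum_im hs.hasSum
    have h1 := (((him.mul_left A).smul_const (ContinuousLinearMap.fst ℝ ℝ ℝ)).sub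
      ((hre.mul_left A).smul_const (ContinuousLinearMap.snd ℝ ℝ ℝ)))
    rw [momentSum, ← h1.tsum_eq]
    congr 1
    ext i <;>
    simp [deformSq_zero_one, deformSqDeriv, pow_two] <;> ring
  · have h1 := (hasFDerivAt_deformSq (hy q hq) (z i)).const_mul A
    have hpos : 0 < A * deformSq q (z i) := by
      refine lt_of_lt_of_le ?_ ((hlow' i).trans (hlow i q hq))
      positivity
    have h2 := (hf.hasDerivAt _ hpos).comp_hasFDerivAt q h1
    exact h2
  · have h0 : 0 < ‖z i‖ := hc.trans_le (hcz i)
    have hr := (hlow' i).trans (hlow i q hq)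
    rw [norm_smul, norm_smul, Real.norm_eq_abs, Real.norm_of_nonneg hA.le]
    have e1 : |f' (A * deformSq q (z i))| ≤ C * (A * (‖z i‖ ^ 2 / 4)) ^ (-(2 + η)) := by
      refine ((hC _ hr).2).trans ?_
      gcongr ?_ * ?_
      exact Real.rpow_le_rpow_of_nonpos (by positivity) (hlow i q hq) (by linarith)
    calc _ ≤ C * (A * (‖z i‖ ^ 2 / 4)) ^ (-(2 + η)) * (A * (8 * ‖z i‖ ^ 2)) := by
          gcongr; exact norm_deformSqDeriv_le hq _
      _ = _ := by
        rw [show A * (‖z i‖ ^ 2 / 4) = A / 4 * ‖z i‖ ^ 2 by ring,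
          Real.mul_rpow (by positivity) (by positivity), ← Real.rpow_natCast ‖z i‖ 2,
          ← Real.rpow_mul h0.le,
          show C * ((A / 4) ^ (-(2 + η)) * ‖z i‖ ^ (((2 : ℕ) : ℝ) * -(2 + η))) *
            (A * (8 * ‖z i‖ ^ ((2 : ℕ) : ℝ))) = C * (A / 4) ^ (-(2 + η)) * (A * 8) *
            (‖z i‖ ^ (((2 : ℕ) : ℝ) * -(2 + η)) * ‖z i‖ ^ ((2 : ℕ) : ℝ)) by ring,
          ← Real.rpow_add h0]
        congr 2
        push_cast; ring

lemma momentSum_eq_zero_iff_hasFDerivAt (hf : IsDecayPair f f') (hz : IsSparse z) (hA : 0 < A) :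
    HasFDerivAt (fun q => ∑' i, f (A * deformSq q (z i))) (0 : ℝ × ℝ →L[ℝ] ℝ) (0, 1) ↔
      momentSum f' A z = 0 := by
  have h := hasFDerivAt_tsum_deformSq hf hz hA
  constructor
  · intro h0
    have := h.unique h0
    have e1 := congrArg (fun L : ℝ × ℝ →L[ℝ] ℝ => L (1, 0)) this
    have e2 := congrArg (fun L : ℝ × ℝ →L[ℝ] ℝ => L (0, 1)) this
    simp [hA.ne'] at e1 e2
    exact Complex.ext e2 e1
  · intro h0
    simpa [h0] using h

end Family

/-! ### Lattice points in complex coordinates -/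

/-- Nonzero integer vectors. -/
abbrev NonzeroPair : Type := {v : ℤ × ℤ // v ≠ 0}

/-- The point `β (n + m τ)` of the lattice with basis `β, β τ`. -/
def latPt (β τ : ℂ) (v : ℤ × ℤ) : ℂ := β * (v.1 + v.2 * τ)

lemma summable_norm_intPair_rpow {s : ℝ} (hs : 2 < s) :
    Summable fun v : ℤ × ℤ => ‖v‖ ^ (-s) := by
  have h := EisensteinSeries.summable_one_div_norm_rpow hs
  rw [← (finTwoArrowEquiv ℤ).symm.summable_iff] at h
  refine h.congr fun v => ?_
  simp only [Function.comp_apply, finTwoArrowEquiv_symm_apply]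
  congr 1
  rw [Prod.norm_def]
  simp [Pi.norm_def, Finset.univ_fin2, Finset.sup_insert]

lemma exists_le_norm_latPt {β τ : ℂ} (hβ : β ≠ 0) (hτ : τ.im ≠ 0) :
    ∃ c : ℝ, 0 < c ∧ ∀ v : ℤ × ℤ, c * ‖v‖ ≤ ‖latPt β τ v‖ := by
  have hb : 0 < ‖β‖ := norm_pos_iff.2 hβ
  have hy : 0 < |τ.im| := abs_pos.2 hτ
  set M : ℝ := 1 + (1 + ‖τ‖) / |τ.im| with hM
  have hM0 : 0 < M := by positivity
  refine ⟨‖β‖ / M, by positivity, fun v => ?_⟩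
  have h1 : |(v.2 : ℝ)| * |τ.im| ≤ ‖(v.1 + v.2 * τ : ℂ)‖ := by
    have := Complex.abs_im_le_norm (v.1 + v.2 * τ : ℂ)
    simpa [abs_mul] using this
  have h1' : |(v.2 : ℝ)| ≤ ‖(v.1 + v.2 * τ : ℂ)‖ / |τ.im| := by rwa [le_div_iff₀ hy]
  have h2 : |(v.1 : ℝ)| ≤ ‖(v.1 + v.2 * τ : ℂ)‖ + |(v.2 : ℝ)| * ‖τ‖ := by
    have h3 : ((v.1 : ℝ) : ℂ) = (v.1 + v.2 * τ : ℂ) - v.2 * τ := by push_cast; ring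
    have h4 := norm_sub_le (v.1 + v.2 * τ : ℂ) (v.2 * τ)
    rw [← h3, Complex.norm_real, norm_mul] at h4
    simpa using h4
  have hv : ‖v‖ ≤ M * ‖(v.1 + v.2 * τ : ℂ)‖ := by
    set N := ‖(v.1 + v.2 * τ : ℂ)‖
    have hN : 0 ≤ N := norm_nonneg _
    rw [Prod.norm_def, Int.norm_eq_abs, Int.norm_eq_abs]
    have e : M * N = N + N / |τ.im| + N / |τ.im| * ‖τ‖ := by rw [hM]; field_simp; ring
    have e1 : |(v.2 : ℝ)| * ‖τ‖ ≤ N / |τ.im| * ‖τ‖ := by gcongr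
    have e2 : 0 ≤ N / |τ.im| * ‖τ‖ := by positivity
    have e3 : 0 ≤ N / |τ.im| := by positivity
    rw [e]
    exact max_le (by linarith) (by linarith)
  rw [latPt, norm_mul, div_mul_eq_mul_div, mul_div_assoc]
  gcongr
  rw [div_le_iff₀ hM0]
  linarith

lemma one_le_norm_intPair {v : ℤ × ℤ} (hv : v ≠ 0) : 1 ≤ ‖v‖ := by
  rw [Prod.norm_def, Int.norm_eq_abs, Int.norm_eq_abs]
  by_contra h
  rw [not_le, max_lt_iff] at h
  apply hv
  have h1 : |v.1| < 1 := by exact_mod_cast h.1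
  have h2 : |v.2| < 1 := by exact_mod_cast h.2
  exact Prod.ext (Int.abs_lt_one_iff.1 h1) (Int.abs_lt_one_iff.1 h2)

lemma isSparse_latPt {β τ : ℂ} (hβ : β ≠ 0) (hτ : τ.im ≠ 0) :
    IsSparse fun v : NonzeroPair => latPt β τ v := by
  obtain ⟨c, hc, h⟩ := exists_le_norm_latPt hβ hτ
  refine ⟨⟨c, hc, fun v => ?_⟩, fun s hs => ?_⟩
  · refine le_trans ?_ (h v)
    have := one_le_norm_intPair v.2
    nlinarith
  · refine Summable.of_nonneg_of_le (fun v => Real.rpow_nonneg (norm_nonneg _) _) (fun v => ?_)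
      (((summable_norm_intPair_rpow hs).mul_left (c ^ (-s))).subtype _)
    have hv : 0 < ‖(v : ℤ × ℤ)‖ := one_pos.trans_le (one_le_norm_intPair v.2)
    simp only [Function.comp_apply]
    rw [← Real.mul_rpow hc.le hv.le]
    exact Real.rpow_le_rpow_of_nonpos (by positivity) (h v) (by linarith)

/-- The unit-area lattice of the point `x + i y` of the upper half-plane. -/
def unitPt (x y : ℝ) (v : ℤ × ℤ) : ℂ := latPt ((Real.sqrt y)⁻¹ : ℝ) ⟨x, y⟩ v

lemma isSparse_unitPt (x : ℝ) {y : ℝ} (hy : 0 < y) :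
    IsSparse fun v : NonzeroPair => unitPt x y v :=
  isSparse_latPt (by simpa using (Real.sqrt_pos.2 hy).ne') (by simpa using hy.ne')

lemma unitPt_re (x y : ℝ) (v : ℤ × ℤ) :
    (unitPt x y v).re = (Real.sqrt y)⁻¹ * (v.1 + v.2 * x) := by
  simp [unitPt, latPt]

lemma unitPt_im (x y : ℝ) (v : ℤ × ℤ) : (unitPt x y v).im = (Real.sqrt y)⁻¹ * (v.2 * y) := by
  simp [unitPt, latPt]

lemma norm_unitPt_sq (x : ℝ) {y : ℝ} (hy : 0 < y) (v : ℤ × ℤ) :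
    ‖unitPt x y v‖ ^ 2 = (v.1 + v.2 * x) ^ 2 / y + v.2 ^ 2 * y := by
  rw [← Complex.normSq_eq_norm_sq, Complex.normSq_apply, unitPt_re, unitPt_im]
  have : Real.sqrt y * Real.sqrt y = y := Real.mul_self_sqrt hy.le
  have h2 : (Real.sqrt y)⁻¹ * (Real.sqrt y)⁻¹ = y⁻¹ := by rw [← mul_inv, this]
  calc _ = ((Real.sqrt y)⁻¹ * (Real.sqrt y)⁻¹) * ((v.1 + v.2 * x) ^ 2 + (v.2 * y) ^ 2) := by ring
    _ = _ := by rw [h2]; field_simp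

/-- A deformation moves the lattice of x + iy to that of (x + q₁y) + i q₂y, up to rotation.
Derivatives in the upper half-plane can therefore be read off from deformations. -/
lemma deformSq_unitPt (x : ℝ) {y : ℝ} (hy : 0 < y) {q : ℝ × ℝ} (hq : 0 < q.2) (v : ℤ × ℤ) :
    deformSq q (unitPt x y v) = ‖unitPt (x + q.1 * y) (q.2 * y) v‖ ^ 2 := by
  rw [norm_unitPt_sq _ (mul_pos hq hy), deformSq, unitPt_re, unitPt_im]
  have : Real.sqrt y * Real.sqrt y = y := Real.mul_self_sqrt hy.le
  have h2 : (Real.sqrt y)⁻¹ * (Real.sqrt y)⁻¹ = y⁻¹ := by rw [← mul_inv, this]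
  calc _ = ((Real.sqrt y)⁻¹ * (Real.sqrt y)⁻¹) * ((v.1 + v.2 * x + q.1 * (v.2 * y)) ^ 2 +
        q.2 ^ 2 * (v.2 * y) ^ 2) / q.2 := by ring
    _ = _ := by rw [h2]; field_simp; ring

section Family

variable {ι : Type*} {z : ι → ℂ}

lemma IsSparse.summable_pow_mul_exp (hz : IsSparse z) (k : ℕ) {t : ℝ} (ht : 0 < t) :
    Summable fun i => ‖z i‖ ^ (2 * k) * Real.exp (-π * t * ‖z i‖ ^ 2) := by
  have h := hz.summable_of_decay (g := fun r => r ^ k * Real.exp (-(π * t) * r)) (p := 2) one_pos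
    one_lt_two fun r₀ hr₀ => ?_
  · refine h.congr fun i => ?_
    simp only [one_mul, neg_mul, pow_mul]
  · have hO : (fun r => r ^ k * Real.exp (-(π * t) * r)) =O[atTop] fun r : ℝ => r ^ (-2 : ℝ) := by
      have h1 := isLittleO_exp_neg_mul_rpow_atTop (a := π * t) (by positivity) (-2 - k)
      have h2 := (isBigO_refl (fun r : ℝ => r ^ k) atTop).mul h1.isBigO
      refine h2.congr' (by rfl) ?_
      filter_upwards [eventually_gt_atTop 0] with r hr
      rw [← Real.rpow_natCast, ← Real.rpow_add hr]
      ring_nf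
    obtain ⟨C, -, hC⟩ := exists_bound_of_isBigO hr₀ (by fun_prop) hO
    exact ⟨C, hC⟩

end Family

lemma tsum_nonzeroPair {f : ℤ × ℤ → ℝ} (hf : Summable f) :
    ∑' v, f v = f 0 + ∑' v : NonzeroPair, f v := by
  have h := hf.tsum_subtype_add_tsum_subtype_compl {0}
  rw [tsum_singleton] at h
  rw [← h]
  rfl

lemma summable_nonzeroPair {f : ℤ × ℤ → ℝ} (hf : Summable fun v : NonzeroPair => f v) :
    Summable f := by
  refine (Finset.summable_compl_iff {0}).1 ?_
  have e : {v : ℤ × ℤ // v ∉ ({0} : Finset (ℤ × ℤ))} ≃ NonzeroPair :=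
    Equiv.subtypeEquivRight (by simp)
  refine (Equiv.summable_iff (Equiv.subtypeEquivRight (p := fun v : ℤ × ℤ => v ≠ 0)
    (q := fun v => v ∉ ({0} : Finset (ℤ × ℤ))) (by simp))).1 ?_
  exact hf

/-! ### Theta functions of a unit-area lattice and the law t ↦ 1/t -/

/-- The theta function of the lattice of `x + i y`. -/
def latTheta (x y t : ℝ) : ℝ := ∑' v : ℤ × ℤ, Real.exp (-π * t * ‖unitPt x y v‖ ^ 2)

lemma summable_latTheta (x : ℝ) {y t : ℝ} (hy : 0 < y) (ht : 0 < t) :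
    Summable fun v : ℤ × ℤ => Real.exp (-π * t * ‖unitPt x y v‖ ^ 2) := by
  apply summable_nonzeroPair
  simpa using (isSparse_unitPt x hy).summable_pow_mul_exp 0 ht

lemma summable_int_gaussian {t : ℝ} (ht : 0 < t) :
    Summable fun n : ℤ => Real.exp (-π * n ^ 2 * t) := by
  simpa using (HurwitzZeta.hasSum_int_evenKernel 0 ht).summable

/-- The absolutely convergent double series of `latTheta` after Poisson summation in one variable. -/
lemma latTheta_eq (x : ℝ) {y t : ℝ} (hy : 0 < y) (ht : 0 < t) :
    (latTheta x y t : ℂ) = ((y / t) ^ (1 / 2 : ℝ) : ℝ) * ∑' v : ℤ × ℤ,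
      Complex.exp (2 * π * Complex.I * (v.1 * v.2 * x : ℝ)) *
        ((Real.exp (-π * v.1 ^ 2 * (y / t)) * Real.exp (-π * v.2 ^ 2 * (y * t)) : ℝ) : ℂ) := by
  have hs := summable_latTheta x hy ht
  have hyt : 0 < y / t := div_pos hy ht
  have hty : 0 < t / y := div_pos ht hy
  have hB : Summable fun v : ℤ × ℤ => Complex.exp (2 * π * Complex.I * (v.1 * v.2 * x : ℝ)) *
        ((Real.exp (-π * v.1 ^ 2 * (y / t)) * Real.exp (-π * v.2 ^ 2 * (y * t)) : ℝ) : ℂ) := by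
    refine Summable.of_norm_bounded ((summable_int_gaussian hyt).mul_of_nonneg
      (summable_int_gaussian (mul_pos hy ht)) (fun _ => (Real.exp_pos _).le)
      (fun _ => (Real.exp_pos _).le)) fun v => le_of_eq ?_
    rw [norm_mul, Complex.norm_real, Real.norm_of_nonneg (by positivity),
      show (2 * π * Complex.I * (v.1 * v.2 * x : ℝ) : ℂ) = ((2 * π * (v.1 * v.2 * x) : ℝ) : ℂ) *
        Complex.I by push_cast; ring, Complex.norm_exp_ofReal_mul_I, one_mul]
  have h1 : HasSum (fun m : ℤ => Real.exp (-π * m ^ 2 * (y * t)) *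
      HurwitzZeta.evenKernel ((m * x : ℝ) : UnitAddCircle) (t / y)) (latTheta x y t) := by
    refine ((Equiv.prodComm ℤ ℤ).hasSum_iff.2 hs.hasSum).prod_fiberwise fun m => ?_
    · refine ((HurwitzZeta.hasSum_int_evenKernel (m * x) hty).mul_left
        (Real.exp (-π * m ^ 2 * (y * t)))).congr_fun fun n => ?_
      simp only [Function.comp_apply, Equiv.prodComm_apply, Prod.swap_prod_mk]
      rw [← Real.exp_add, norm_unitPt_sq x hy]
      congr 1
      simp only
      field_simp
      ring
  have h2 := ((Equiv.prodComm ℤ ℤ).hasSum_iff.2 hB.hasSum).prod_fiberwise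
    (g := fun m : ℤ => HurwitzZeta.cosKernel ((m * x : ℝ) : UnitAddCircle) (y / t) *
      (Real.exp (-π * m ^ 2 * (y * t)) : ℂ)) fun m => by
      refine ((HurwitzZeta.hasSum_int_cosKernel (m * x) hyt).mul_right
        (Real.exp (-π * m ^ 2 * (y * t)) : ℂ)).congr_fun fun n => ?_
      simp only [Function.comp_apply, Equiv.prodComm_apply, Prod.swap_prod_mk]
      push_cast
      rw [mul_assoc (Complex.exp _)]
      congr 2
      ring
  have h3 := (Complex.hasSum_ofReal.2 h1).unique ((h2.mul_left
    (((y / t) ^ (1 / 2 : ℝ) : ℝ) : ℂ)).congr_fun fun m => ?_)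
  · exact h3
  · rw [HurwitzZeta.evenKernel_functional_equation, one_div_div, ← one_div_div y t,
      Real.div_rpow one_pos.le hyt.le, Real.one_rpow, one_div_one_div]
    push_cast
    ring

/-- After Poisson summation in the first variable alone, replacing t by 1/t merely swaps the two
Gaussian factors, and the phase exp(2πi nmx) is symmetric in n and m. Only the prefactor (y/t)^(1/2)
changes, by the factor t. -/
lemma latTheta_inv (x : ℝ) {y t : ℝ} (hy : 0 < y) (ht : 0 < t) :
    latTheta x y t⁻¹ = t * latTheta x y t := by
  have h1 := latTheta_eq x hy ht
  have h2 := latTheta_eq x hy (inv_pos.2 ht)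
  rw [← (Equiv.prodComm ℤ ℤ).tsum_eq] at h2
  have h3 : (latTheta x y t⁻¹ : ℂ) = t * latTheta x y t := by
    rw [h1, h2, ← mul_assoc]
    congr 1
    · norm_cast
      have : y / t⁻¹ = t ^ (2 : ℝ) * (y / t) := by
        rw [Real.rpow_two]; field_simp
      rw [this, Real.mul_rpow (by positivity) (by positivity), ← Real.rpow_mul ht.le]
      norm_num
    · refine tsum_congr fun v => ?_
      simp only [Equiv.prodComm_apply, Prod.fst_swap, Prod.snd_swap]
      rw [mul_comm (v.2 : ℝ) (v.1 : ℝ), mul_comm (Real.exp (-π * v.2 ^ 2 * (y / t⁻¹))),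
        div_inv_eq_mul, ← div_eq_mul_inv]
  exact_mod_cast h3

/-- The theta series with quadratic harmonic coefficients. -/
def harmonicTheta {ι : Type*} (z : ι → ℂ) (t : ℝ) : ℂ :=
  momentSum (fun r => Real.exp (-π * t * r)) 1 z

lemma momentSum_const_mul {ι : Type*} (z : ι → ℂ) (f : ℝ → ℝ) (c A : ℝ) :
    momentSum (fun r => c * f r) A z = c * momentSum f A z := by
  simp only [momentSum]
  rw [← tsum_mul_left]
  refine tsum_congr fun i => ?_
  push_cast; ring

/-- The transformation law, obtained by differentiating that of `latTheta` with respect to the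
lattice. -/
lemma harmonicTheta_inv (x : ℝ) {y t : ℝ} (hy : 0 < y) (ht : 0 < t) :
    harmonicTheta (fun v : NonzeroPair => unitPt x y v) t⁻¹ =
      t ^ 3 * harmonicTheta (fun v : NonzeroPair => unitPt x y v) t := by
  have key : ∀ s : ℝ, 0 < s → HasFDerivAt
      (fun q : ℝ × ℝ => latTheta (x + q.1 * y) (q.2 * y) s)
      ((-(π * s) * (harmonicTheta (fun v : NonzeroPair => unitPt x y v) s).im) •
        ContinuousLinearMap.fst ℝ ℝ ℝ -
        (-(π * s) * (harmonicTheta (fun v : NonzeroPair => unitPt x y v) s).re) •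
        ContinuousLinearMap.snd ℝ ℝ ℝ) (0, 1) := by
    intro s hs
    have h := hasFDerivAt_tsum_deformSq (isDecayPair_exp (c := π * s) (by positivity))
      (isSparse_unitPt x hy) one_pos
    rw [momentSum_const_mul, Complex.re_ofReal_mul, Complex.im_ofReal_mul,
      one_mul, one_mul] at h
    simp only [← neg_mul] at h ⊢
    -- The origin contributes the constant 1 to `latTheta`.
    have h' := h.const_add (1 : ℝ)
    refine h'.congr_of_eventuallyEq ?_
    have hpos : ∀ᶠ q : ℝ × ℝ in 𝓝 (0, 1), 0 < q.2 :=
      continuousAt_snd.eventually (lt_mem_nhds (by norm_num))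
    filter_upwards [hpos] with q hq
    rw [latTheta, tsum_nonzeroPair (summable_latTheta _ (mul_pos hq hy) hs)]
    congr 1
    · simp [unitPt, latPt]
    · refine tsum_congr fun v => ?_
      rw [one_mul, deformSq_unitPt x hy hq]
  have h1 := key t⁻¹ (inv_pos.2 ht)
  have h2 := (key t ht).const_mul t
  have h3 : HasFDerivAt (fun q : ℝ × ℝ => t * latTheta (x + q.1 * y) (q.2 * y) t) _ (0, 1) :=
    h1.congr_of_eventuallyEq (by
      have hpos : ∀ᶠ q : ℝ × ℝ in 𝓝 (0, 1), 0 < q.2 :=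
        continuousAt_snd.eventually (lt_mem_nhds (by norm_num))
      filter_upwards [hpos] with q hq
      exact (latTheta_inv _ (mul_pos hq hy) ht).symm)
  -- Differentiation brings down -π/t on one side and -πt on the other. Combined with the factor t
  -- from `latTheta_inv`, this gives weight 3.
  have h4 := h3.unique h2
  have e1 := congrArg (fun L : ℝ × ℝ →L[ℝ] ℝ => L (1, 0)) h4
  have e2 := congrArg (fun L : ℝ × ℝ →L[ℝ] ℝ => L (0, 1)) h4
  simp at e1 e2
  rw [← Complex.ofReal_pow]
  have hπ := Real.pi_ne_zero
  field_simp at e1 e2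
  rw [one_div] at e1 e2
  refine Complex.ext ?_ ?_
  · rw [Complex.re_ofReal_mul]; linarith
  · rw [Complex.im_ofReal_mul]; linarith

/-! ### Holomorphy and decay of modular theta series -/

/-- The theta series `∑ qᵢ exp (-π w |zᵢ|²)`. -/
def quadTheta {ι : Type*} (q : ι → ℝ) (z : ι → ℂ) (w : ℂ) : ℂ :=
  ∑' i, (q i : ℂ) * Complex.exp (-π * w * (‖z i‖ ^ 2 : ℝ))

/-- The theta series `∑ qᵢ exp (-π t |zᵢ|²)` for real `t`. -/
def realTheta {ι : Type*} (q : ι → ℝ) (z : ι → ℂ) (t : ℝ) : ℝ :=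
  ∑' i, q i * Real.exp (-π * t * ‖z i‖ ^ 2)

lemma quadTheta_ofReal {ι : Type*} (q : ι → ℝ) (z : ι → ℂ) (t : ℝ) :
    quadTheta q z t = realTheta q z t := by
  rw [quadTheta, realTheta, Complex.ofReal_tsum]
  refine tsum_congr fun i => ?_
  push_cast; rfl

/-- A sparse family with quadratically bounded coefficients whose theta series has the
transformation behaviour of a unimodular lattice. -/
structure IsModularFamily {ι : Type*} (q : ι → ℝ) (z : ι → ℂ) : Prop where
  sparse : IsSparse z
  coeff : ∃ K : ℝ, ∀ i, |q i| ≤ K * ‖z i‖ ^ 2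
  inv : ∀ t : ℝ, 0 < t → realTheta q z t⁻¹ = t ^ 3 * realTheta q z t

/-- The sector `|arg w| < π / 4`. -/
def sector : Set ℂ := {w : ℂ | |w.im| < w.re}

lemma isOpen_sector : IsOpen sector :=
  isOpen_lt (continuous_abs.comp Complex.continuous_im) Complex.continuous_re

lemma convex_sector : Convex ℝ sector := by
  intro a ha b hb s t hs ht hst
  simp only [sector, mem_ofPred_eq] at *
  simp only [Complex.add_im, Complex.smul_im, Complex.add_re, Complex.smul_re, smul_eq_mul]
  calc |s * a.im + t * b.im| ≤ |s * a.im| + |t * b.im| := abs_add_le _ _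
    _ = s * |a.im| + t * |b.im| := by rw [abs_mul, abs_mul, abs_of_nonneg hs, abs_of_nonneg ht]
    _ < s * a.re + t * b.re := by
      rcases hs.eq_or_lt with rfl | hs'
      · simp only [zero_add] at hst; subst hst; simpa using hb
      · nlinarith

lemma re_pos_of_mem_sector {w : ℂ} (hw : w ∈ sector) : 0 < w.re :=
  (abs_nonneg _).trans_lt hw

lemma mul_ofReal_mem_sector {w : ℂ} (hw : w ∈ sector) {t : ℝ} (ht : 0 < t) :
    w * t ∈ sector := by
  simp only [sector, mem_ofPred_eq] at *
  simp only [Complex.mul_im, Complex.ofReal_re, Complex.ofReal_im, mul_zero, zero_add,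
    Complex.mul_re, sub_zero, abs_mul, abs_of_pos ht]
  nlinarith

lemma ofReal_mem_sector {t : ℝ} (ht : 0 < t) : (t : ℂ) ∈ sector := by
  simpa [sector] using ht

section Family

variable {ι : Type*} {q : ι → ℝ} {z : ι → ℂ}

lemma IsSparse.summable_coeff_mul_exp (hz : IsSparse z) {K : ℝ}
    (hq : ∀ i, |q i| ≤ K * ‖z i‖ ^ 2) {t : ℝ} (ht : 0 < t) :
    Summable fun i => |q i| * Real.exp (-π * t * ‖z i‖ ^ 2) := by
  refine Summable.of_nonneg_of_le (fun i => by positivity) (fun i => ?_)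
    ((hz.summable_pow_mul_exp 1 ht).mul_left K)
  rw [mul_one, ← mul_assoc]
  gcongr; exact hq i

namespace IsModularFamily

lemma summable_term_real (h : IsModularFamily q z) {t : ℝ} (ht : 0 < t) :
    Summable fun i => q i * Real.exp (-π * t * ‖z i‖ ^ 2) := by
  obtain ⟨K, hK⟩ := h.coeff
  refine (h.sparse.summable_coeff_mul_exp hK ht).of_norm_bounded fun i => ?_
  rw [norm_mul, Real.norm_eq_abs, Real.norm_of_nonneg (Real.exp_pos _).le]

lemma norm_term (w : ℂ) (i : ι) :
    ‖(q i : ℂ) * Complex.exp (-π * w * (‖z i‖ ^ 2 : ℝ))‖ =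
      |q i| * Real.exp (-π * w.re * ‖z i‖ ^ 2) := by
  rw [norm_mul, Complex.norm_real, Complex.norm_exp, Real.norm_eq_abs]
  congr 2
  rw [Complex.re_mul_ofReal]
  simp

lemma differentiableOn (h : IsModularFamily q z) :
    DifferentiableOn ℂ (quadTheta q z) {w | 0 < w.re} := by
  intro w hw
  obtain ⟨K, hK⟩ := h.coeff
  have hopen : IsOpen {u : ℂ | w.re / 2 < u.re} := isOpen_lt continuous_const Complex.continuous_re
  have hw' : 0 < w.re := hw
  have hd := Complex.differentiableOn_tsum_of_summable_norm (U := {u : ℂ | w.re / 2 < u.re})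
    (F := fun i w => (q i : ℂ) * Complex.exp (-π * w * (‖z i‖ ^ 2 : ℝ)))
    (h.sparse.summable_coeff_mul_exp hK (half_pos hw')) (fun i => by fun_prop) hopen
    (fun i u hu => by
      rw [norm_term]
      have hu' : w.re / 2 < u.re := hu
      refine mul_le_mul_of_nonneg_left (Real.exp_le_exp.2 ?_) (abs_nonneg _)
      have : w.re / 2 * ‖z i‖ ^ 2 ≤ u.re * ‖z i‖ ^ 2 := by gcongr
      nlinarith [Real.pi_pos])
  exact (hd.differentiableAt (hopen.mem_nhds (by simp only [mem_ofPred_eq]; linarith))).differentiableWithinAt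

lemma isOpen_re_pos : IsOpen {w : ℂ | 0 < w.re} := isOpen_lt continuous_const Complex.continuous_re

lemma exists_bound_of_re_ge (h : IsModularFamily q z) :
    ∃ c C : ℝ, 0 < c ∧ 0 ≤ C ∧ ∀ w : ℂ, 1 / 2 ≤ w.re →
      ‖quadTheta q z w‖ ≤ C * Real.exp (-c * w.re) := by
  obtain ⟨K, hK⟩ := h.coeff
  obtain ⟨c, hc, hcz⟩ := h.sparse.bound
  have hs := h.sparse.summable_coeff_mul_exp hK (t := 1 / 4) (by norm_num)
  have hπ := Real.pi_pos
  refine ⟨π * c ^ 2 / 2, ∑' i, |q i| * Real.exp (-π * (1 / 4) * ‖z i‖ ^ 2), by positivity,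
    tsum_nonneg fun i => by positivity, fun w hw => ?_⟩
  rw [quadTheta, ← tsum_mul_right]
  refine tsum_of_norm_bounded (hs.mul_right _).hasSum fun i => ?_
  rw [norm_term, mul_assoc |q i|, ← Real.exp_add]
  gcongr
  have h1 : c ^ 2 ≤ ‖z i‖ ^ 2 := by gcongr; exact hcz i
  have h2 : (1 / 4) * ‖z i‖ ^ 2 ≤ w.re / 2 * ‖z i‖ ^ 2 :=
    mul_le_mul_of_nonneg_right (by linarith) (sq_nonneg _)
  have h3 : w.re / 2 * c ^ 2 ≤ w.re / 2 * ‖z i‖ ^ 2 := mul_le_mul_of_nonneg_left h1 (by linarith)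
  nlinarith

/-- Both sides are holomorphic on the right half-plane and agree on the positive axis. -/
lemma inv_complex (h : IsModularFamily q z) {w : ℂ} (hw : 0 < w.re) :
    quadTheta q z w⁻¹ = w ^ 3 * quadTheta q z w := by
  have hinv : ∀ u : ℂ, 0 < u.re → 0 < (u⁻¹).re := fun u hu => by
    rw [Complex.inv_re]
    have : u ≠ 0 := fun h0 => by simp [h0] at hu
    have := Complex.normSq_pos.2 this
    positivity
  have hne : ∀ u ∈ {w : ℂ | 0 < w.re}, u ≠ 0 := fun u hu h0 => by simp [h0] at hu
  have hD := h.differentiableOn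
  have h1 : DifferentiableOn ℂ (fun u => quadTheta q z u⁻¹) {w | 0 < w.re} :=
    hD.comp (fun u hu => (differentiableAt_inv (hne u hu)).differentiableWithinAt) hinv
  have h2 : DifferentiableOn ℂ (fun u => u ^ 3 * quadTheta q z u) {w | 0 < w.re} :=
    ((differentiable_id.pow 3).differentiableOn).mul hD
  have hpre : IsPreconnected {w : ℂ | 0 < w.re} := (convex_halfSpace_re_gt 0).isPreconnected
  refine (h1.analyticOnNhd isOpen_re_pos).eqOn_of_preconnected_of_frequently_eq
    (h2.analyticOnNhd isOpen_re_pos) hpre (z₀ := 1) (by simp) ?_ hw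
  have hlim : Tendsto (fun t : ℝ => (t : ℂ)) (𝓝[>] 1) (𝓝[≠] 1) := by
    refine tendsto_nhdsWithin_of_tendsto_nhds_of_eventually_within _ ?_ ?_
    · exact (Complex.continuous_ofReal.tendsto' 1 1 (by simp)).mono_left nhdsWithin_le_nhds
    · filter_upwards [self_mem_nhdsWithin] with t ht
      have : (1 : ℝ) < t := ht
      simpa using (by exact_mod_cast this.ne' : (t : ℂ) ≠ 1)
  refine hlim.frequently (Eventually.frequently ?_)
  filter_upwards [self_mem_nhdsWithin] with t ht
  have ht0 : (0 : ℝ) < t := lt_trans one_pos ht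
  rw [← Complex.ofReal_inv, quadTheta_ofReal, quadTheta_ofReal, h.inv t ht0]
  push_cast; rfl

/-- For Re w ≥ 1/2 the series itself decays. For small Re w the law under inversion moves the point
to Re(1/w) ≥ 1/(2 Re w), and exp(-c Re(1/w)) beats the factor |w|⁻³. This uses that |w| and Re w are
comparable in the sector. -/
lemma exists_bound_sector (h : IsModularFamily q z) :
    ∃ c C : ℝ, 0 < c ∧ 0 ≤ C ∧ ∀ w ∈ sector, ‖quadTheta q z w‖ ≤ C * Real.exp (-c * w.re) := by
  obtain ⟨c, C, hc, hC, hb⟩ := h.exists_bound_of_re_ge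
  refine ⟨c, max C (C * (6 * (2 / c) ^ 3) * Real.exp (c / 2)), hc, le_max_of_le_left hC,
    fun w hw => ?_⟩
  have hu := re_pos_of_mem_sector hw
  rcases le_or_gt (1 / 2) w.re with h1 | h1
  · exact (hb w h1).trans (by gcongr; exact le_max_left _ _)
  · have hw0 : w ≠ 0 := fun h0 => by simp [h0] at hu
    have hn : w.re ≤ ‖w‖ := (le_abs_self _).trans (Complex.abs_re_le_norm w)
    -- In the sector |w|² ≤ 2 (Re w)².
    have hinv : (2 * w.re)⁻¹ ≤ (w⁻¹).re := by
      rw [Complex.inv_re, le_div_iff₀ (Complex.normSq_pos.2 hw0), Complex.normSq_apply,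
        inv_mul_le_iff₀ (by positivity)]
      have h2 : |w.im| < w.re := hw
      have h3 : w.im * w.im ≤ w.re * w.re := by
        rw [← abs_mul_abs_self w.im]
        exact mul_self_le_mul_self (abs_nonneg _) h2.le
      nlinarith
    have hge : 1 / 2 ≤ (w⁻¹).re := by
      refine le_trans ?_ hinv
      rw [le_inv_comm₀ (by norm_num) (by positivity)]
      linarith
    have e1 : ‖quadTheta q z w‖ * ‖w‖ ^ 3 ≤ C * Real.exp (-c * (w⁻¹).re) := by
      have := hb _ hge
      rw [h.inv_complex hu, norm_mul, norm_pow] at this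
      linarith
    have e2 : Real.exp (-c * (w⁻¹).re) ≤ 6 * (2 / c) ^ 3 * w.re ^ 3 := by
      have h4 := Real.pow_div_factorial_le_exp (c / 2 * w.re⁻¹) (by positivity) 3
      have h5 : Real.exp (-c * (w⁻¹).re) ≤ (Real.exp (c / 2 * w.re⁻¹))⁻¹ := by
        rw [← Real.exp_neg]
        apply Real.exp_le_exp.2
        rw [mul_inv] at hinv
        nlinarith
      refine h5.trans ?_
      rw [inv_le_comm₀ (Real.exp_pos _) (by positivity)]
      refine le_trans (le_of_eq ?_) h4
      simp only [Nat.factorial]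
      push_cast
      field_simp
    have e3 : ‖quadTheta q z w‖ ≤ C * (6 * (2 / c) ^ 3) := by
      have h6 : w.re ^ 3 ≤ ‖w‖ ^ 3 := by gcongr
      have h7 : ‖quadTheta q z w‖ * w.re ^ 3 ≤ C * (6 * (2 / c) ^ 3) * w.re ^ 3 := by
        calc _ ≤ ‖quadTheta q z w‖ * ‖w‖ ^ 3 := by gcongr
          _ ≤ C * Real.exp (-c * (w⁻¹).re) := e1
          _ ≤ C * (6 * (2 / c) ^ 3 * w.re ^ 3) := by gcongr
          _ = _ := by ring
      exact le_of_mul_le_mul_right h7 (by positivity)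
    refine e3.trans ?_
    calc C * (6 * (2 / c) ^ 3)
        ≤ C * (6 * (2 / c) ^ 3) * (Real.exp (c / 2) * Real.exp (-c * w.re)) := by
          rw [← Real.exp_add]
          refine le_mul_of_one_le_right (by positivity) (Real.one_le_exp ?_)
          nlinarith
      _ = C * (6 * (2 / c) ^ 3) * Real.exp (c / 2) * Real.exp (-c * w.re) := by ring
      _ ≤ _ := by gcongr; exact le_max_right _ _

lemma exists_bound_real (h : IsModularFamily q z) :
    ∃ c C : ℝ, 0 < c ∧ 0 ≤ C ∧ ∀ t, 0 < t → |realTheta q z t| ≤ C * Real.exp (-c * t) := by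
  obtain ⟨c, C, hc, hC, hb⟩ := h.exists_bound_sector
  refine ⟨c, C, hc, hC, fun t ht => ?_⟩
  simpa [quadTheta_ofReal] using hb t (ofReal_mem_sector ht)

lemma continuousOn_realTheta (h : IsModularFamily q z) : ContinuousOn (realTheta q z) (Ioi 0) := by
  have h1 : ContinuousOn (fun t : ℝ => (quadTheta q z t).re) (Ioi 0) :=
    Complex.continuous_re.comp_continuousOn
      (h.differentiableOn.continuousOn.comp Complex.continuous_ofReal.continuousOn
        fun t ht => by simpa using ht)
  simpa [quadTheta_ofReal] using h1

end IsModularFamily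

/-! ### Theta transforms of measures and analytic continuation in A -/

/-- The convolution of the theta series with a measure. -/
def thetaTransform (q : ι → ℝ) (z : ι → ℂ) (μ : Measure ℝ) (A : ℂ) : ℂ :=
  ∫ t : ℝ, t * quadTheta q z (A * t) ∂μ

/-- The convolution of the theta series with a measure at a real parameter. -/
def realThetaTransform (q : ι → ℝ) (z : ι → ℂ) (μ : Measure ℝ) (A : ℝ) : ℝ :=
  ∫ t : ℝ, t * realTheta q z (A * t) ∂μ

lemma thetaTransform_ofReal (μ : Measure ℝ) (A : ℝ) :
    thetaTransform q z μ A = realThetaTransform q z μ A := by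
  rw [thetaTransform, realThetaTransform, ← integral_complex_ofReal]
  congr 1
  ext t
  rw [← Complex.ofReal_mul, quadTheta_ofReal, Complex.ofReal_mul]

variable {μ ν : Measure ℝ}

lemma IsLaplaceMeasure.restrict_eq (hμ : IsLaplaceMeasure μ) : μ.restrict (Ioi 0) = μ :=
  Measure.restrict_eq_self_of_ae_mem hμ.ae_pos

lemma IsLaplaceMeasure.aestronglyMeasurable {E : Type*} [NormedAddCommGroup E]
    (hμ : IsLaplaceMeasure μ) {g : ℝ → E} (hg : ContinuousOn g (Ioi 0)) :
    AEStronglyMeasurable g μ := by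
  rw [← hμ.restrict_eq]
  exact hg.aestronglyMeasurable measurableSet_Ioi

end Family

section Family

variable {ι : Type*} {q : ι → ℝ} {z : ι → ℂ} {μ ν : Measure ℝ}

namespace IsModularFamily

lemma integrable_majorant (hμ : IsLaplaceMeasure μ) {r : ℝ} (hr : 0 < r) (C : ℝ) :
    Integrable (fun t : ℝ => C * (t * Real.exp (-r * t))) μ := by
  simpa using (hμ.integrable_pow_mul_exp 1 hr).const_mul C

/-- Differentiation under the integral. The exponential bound on the sector passes to the derivative
by Cauchy's estimate, and t exp(-rt) is integrable for a Laplace measure. -/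
lemma differentiableOn_thetaTransform (h : IsModularFamily q z) (hμ : IsLaplaceMeasure μ) :
    DifferentiableOn ℂ (thetaTransform q z μ) sector := by
  obtain ⟨c, C, hc, hC, hb⟩ := h.exists_bound_sector
  intro A₀ hA₀
  obtain ⟨r, hr, hball⟩ := Metric.isOpen_iff.1 isOpen_sector A₀ hA₀
  have hcont : ∀ A ∈ sector, ContinuousOn (fun t : ℝ => quadTheta q z (A * t)) (Ioi 0) :=
    fun A hA => h.differentiableOn.continuousOn.comp (by fun_prop)
      fun t ht => re_pos_of_mem_sector (mul_ofReal_mem_sector hA ht)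
  have hmeas : ∀ A ∈ sector, AEStronglyMeasurable (fun t : ℝ => t * quadTheta q z (A * t)) μ :=
    fun A hA => hμ.aestronglyMeasurable
      (Complex.continuous_ofReal.continuousOn.mul (hcont A hA))
  have hdiff : ∀ A ∈ sector, ∀ t : ℝ, 0 < t →
      HasDerivAt (fun A => quadTheta q z (A * t)) (deriv (quadTheta q z) (A * t) * t) A := by
    intro A hA t ht
    have h1 : DifferentiableAt ℂ (quadTheta q z) (A * t) :=
      h.differentiableOn.differentiableAt
        (isOpen_re_pos.mem_nhds (re_pos_of_mem_sector (mul_ofReal_mem_sector hA ht)))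
    exact h1.hasDerivAt.comp A (by simpa using (hasDerivAt_id A).mul_const (t : ℂ))
  -- Cauchy circles of radius r' around points of the disc of radius r' stay in the closed disc of
  -- radius 2r', which lies inside the sector.
  set r' := r / 3 with hr'
  have hr'0 : 0 < r' := by positivity
  have hpos : 0 < A₀.re - 2 * r' := by
    have hmem : A₀ - ((2 * r' : ℝ) : ℂ) ∈ Metric.ball A₀ r := by
      rw [mem_ball_iff_norm, sub_sub_cancel_left, norm_neg, Complex.norm_real,
        Real.norm_of_nonneg (by positivity), hr']
      linarith
    simpa using re_pos_of_mem_sector (hball hmem)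
  have hre' : ∀ A ∈ Metric.closedBall A₀ (2 * r'), A₀.re - 2 * r' ≤ A.re := fun A hA => by
    have h1 := (Complex.abs_re_le_norm (A - A₀)).trans (mem_closedBall_iff_norm.1 hA)
    rw [Complex.sub_re, abs_le] at h1
    linarith [h1.1]
  have hcb : Metric.closedBall A₀ (2 * r') ⊆ sector :=
    (Metric.closedBall_subset_ball (by rw [hr']; linarith)).trans hball
  have hsub : Metric.ball A₀ r' ⊆ sector :=
    (Metric.ball_subset_ball (by rw [hr']; linarith)).trans hball
  have hbd : ∀ A ∈ Metric.closedBall A₀ (2 * r'), ∀ t : ℝ, 0 < t →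
      ‖quadTheta q z (A * t)‖ ≤ C * Real.exp (-(c * (A₀.re - 2 * r')) * t) := by
    intro A hA t ht
    refine (hb _ (mul_ofReal_mem_sector (hcb hA) ht)).trans ?_
    refine mul_le_mul_of_nonneg_left (Real.exp_le_exp.2 ?_) hC
    rw [Complex.re_mul_ofReal]
    have := mul_le_mul_of_nonneg_right (hre' A hA) ht.le
    nlinarith
  have key := (hasDerivAt_integral_of_dominated_loc_of_deriv_le (𝕜 := ℂ) (μ := μ)
    (F := fun A (t : ℝ) => t * quadTheta q z (A * t))
    (F' := fun A (t : ℝ) => t * (deriv (quadTheta q z) (A * t) * t)) (x₀ := A₀)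
    (bound := fun t => C / r' * (t * Real.exp (-(c * (A₀.re - 2 * r')) * t)))
    (Metric.ball_mem_nhds A₀ hr'0) ?_ ?_ ?_ ?_
    (integrable_majorant hμ (by positivity) _) ?_).2
  · exact key.differentiableAt.differentiableWithinAt
  · filter_upwards [Metric.ball_mem_nhds A₀ hr'0] with A hA using hmeas A (hsub hA)
  · refine (integrable_majorant hμ (r := c * (A₀.re - 2 * r')) (by positivity) C).mono'
      (hmeas _ hA₀) ?_
    filter_upwards [hμ.ae_pos] with t ht
    rw [norm_mul, Complex.norm_real, Real.norm_of_nonneg ht.le]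
    have := hbd A₀ (Metric.mem_closedBall_self (by positivity)) t ht
    calc _ ≤ t * (C * Real.exp (-(c * (A₀.re - 2 * r')) * t)) := by gcongr
      _ = _ := by ring
  · refine hμ.aestronglyMeasurable (Complex.continuous_ofReal.continuousOn.mul
      (ContinuousOn.mul ?_ Complex.continuous_ofReal.continuousOn))
    exact (h.differentiableOn.deriv isOpen_re_pos).continuousOn.comp (by fun_prop)
      fun t ht => re_pos_of_mem_sector (mul_ofReal_mem_sector hA₀ ht)
  · filter_upwards [hμ.ae_pos] with t ht A hA
    have h1 : ‖deriv (fun A => quadTheta q z (A * t)) A‖ ≤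
        C * Real.exp (-(c * (A₀.re - 2 * r')) * t) / r' := by
      have hcl : Metric.closedBall A r' ⊆ Metric.closedBall A₀ (2 * r') := by
        refine Metric.closedBall_subset_closedBall' ?_
        have := (Metric.mem_ball.1 hA).le
        linarith
      refine Complex.norm_deriv_le_of_forall_mem_sphere_norm_le hr'0 ?_ fun B hB =>
        hbd B (hcl (Metric.sphere_subset_closedBall hB)) t ht
      refine DifferentiableOn.diffContOnCl_ball (U := sector) (fun B hB => ?_) (hcl.trans hcb)
      exact (hdiff B hB t ht).differentiableAt.differentiableWithinAt
    rw [(hdiff A (hsub hA) t ht).deriv] at h1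
    rw [norm_mul, Complex.norm_real, Real.norm_of_nonneg ht.le]
    calc _ ≤ t * (C * Real.exp (-(c * (A₀.re - 2 * r')) * t) / r') := by gcongr
      _ = _ := by ring
  · filter_upwards [hμ.ae_pos] with t ht A hA
    exact (hdiff A (hsub hA) t ht).const_mul (t : ℂ)

/-- Two theta transforms that agree on an interval agree everywhere. -/
lemma realThetaTransform_eq_of_eqOn (h : IsModularFamily q z) (hμ : IsLaplaceMeasure μ)
    (hν : IsLaplaceMeasure ν) {I : Set ℝ} (hI : IsOpen I) (hne : I.Nonempty) (hpos : I ⊆ Ioi 0)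
    (heq : ∀ A ∈ I, realThetaTransform q z μ A = realThetaTransform q z ν A) {A : ℝ} (hA : 0 < A) :
    realThetaTransform q z μ A = realThetaTransform q z ν A := by
  obtain ⟨a, ha⟩ := hne
  have h1 := (h.differentiableOn_thetaTransform hμ).analyticOnNhd isOpen_sector
  have h2 := (h.differentiableOn_thetaTransform hν).analyticOnNhd isOpen_sector
  have := h1.eqOn_of_preconnected_of_frequently_eq h2 convex_sector.isPreconnected
    (ofReal_mem_sector (hpos ha)) ?_ (ofReal_mem_sector hA)
  · simpa [thetaTransform_ofReal] using this
  · have hlim : Tendsto (fun t : ℝ => (t : ℂ)) (𝓝[>] a) (𝓝[≠] (a : ℂ)) := by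
      refine tendsto_nhdsWithin_of_tendsto_nhds_of_eventually_within _ ?_ ?_
      · exact (Complex.continuous_ofReal.tendsto a).mono_left nhdsWithin_le_nhds
      · filter_upwards [self_mem_nhdsWithin] with t ht
        have : a < t := ht
        simpa using this.ne'
    refine hlim.frequently (Eventually.frequently ?_)
    filter_upwards [mem_nhdsWithin_of_mem_nhds (hI.mem_nhds ha)] with t ht
    rw [thetaTransform_ofReal, thetaTransform_ofReal, heq t ht]

lemma aestronglyMeasurable_realTheta (h : IsModularFamily q z) (hμ : IsLaplaceMeasure μ) {A ε : ℝ}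
    (hA : 0 < A) (hε : 0 ≤ ε) :
    AEStronglyMeasurable (fun t => t * realTheta q z (A * t + ε)) μ := by
  refine hμ.aestronglyMeasurable (continuousOn_id.mul
    (h.continuousOn_realTheta.comp (by fun_prop) fun t ht => ?_))
  have : 0 < t := ht
  simp only [mem_Ioi]; positivity

/-- Gaussian summation of the series that defines `realThetaTransform`. -/
lemma tendsto_regularized [Countable ι] (h : IsModularFamily q z) (hμ : IsLaplaceMeasure μ)
    {A : ℝ} (hA : 0 < A) :
    Tendsto (fun ε => ∑' i, q i * Real.exp (-π * ε * ‖z i‖ ^ 2) *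
      ∫ t, t * Real.exp (-(π * A * ‖z i‖ ^ 2) * t) ∂μ) (𝓝[>] 0)
      (𝓝 (realThetaTransform q z μ A)) := by
  obtain ⟨c, C, hc, hC, hb⟩ := h.exists_bound_real
  obtain ⟨d, hd, hdz⟩ := h.sparse.bound
  obtain ⟨K, hK⟩ := h.coeff
  have hπ := Real.pi_pos
  have hzpos : ∀ i, 0 < ‖z i‖ := fun i => hd.trans_le (hdz i)
  have hint : ∀ i, Integrable (fun t => t * Real.exp (-(π * A * ‖z i‖ ^ 2) * t)) μ := fun i => by
    have := hzpos i
    simpa using hμ.integrable_pow_mul_exp 1 (r := π * A * ‖z i‖ ^ 2) (by positivity)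
  -- The Gaussian factor exp(-πε|z|²) shifts the argument of Θ from At to At + ε. The bound on Θ
  -- down to 0 gives a majorant independent of ε.
  have hdct : Tendsto (fun ε => ∫ t, t * realTheta q z (A * t + ε) ∂μ) (𝓝[>] 0)
      (𝓝 (realThetaTransform q z μ A)) := by
    refine tendsto_integral_filter_of_dominated_convergence
      (fun t => C * (t * Real.exp (-(c * A) * t))) ?_ ?_
      (integrable_majorant hμ (by positivity) C) ?_
    · filter_upwards [self_mem_nhdsWithin] with ε hε using
        h.aestronglyMeasurable_realTheta hμ hA (le_of_lt hε)
    · filter_upwards [self_mem_nhdsWithin] with ε hε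
      have hε' : 0 < ε := hε
      filter_upwards [hμ.ae_pos] with t ht
      rw [norm_mul, Real.norm_of_nonneg ht.le, Real.norm_eq_abs]
      calc t * |realTheta q z (A * t + ε)| ≤ t * (C * Real.exp (-c * (A * t + ε))) := by
            gcongr; exact hb _ (by positivity)
        _ ≤ t * (C * Real.exp (-(c * A) * t)) := by
            refine mul_le_mul_of_nonneg_left (mul_le_mul_of_nonneg_left
              (Real.exp_le_exp.2 ?_) hC) ht.le
            nlinarith
        _ = _ := by ring
    · filter_upwards [hμ.ae_pos] with t ht
      have hAt : 0 < A * t := by positivity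
      have h1 : ContinuousAt (realTheta q z) (A * t) :=
        h.continuousOn_realTheta.continuousAt (Ioi_mem_nhds hAt)
      have h2 : Tendsto (fun ε => A * t + ε) (𝓝[>] 0) (𝓝 (A * t)) :=
        (tendsto_id.const_add (A * t)).mono_left nhdsWithin_le_nhds |>.trans (by simp)
      exact (h1.tendsto.comp h2).const_mul t
  refine hdct.congr' ?_
  filter_upwards [self_mem_nhdsWithin] with ε hε
  have hε' : 0 < ε := hε
  -- For ε > 0 the Gaussian factor makes the double series absolutely convergent, so sum and
  -- integral may be exchanged.
  have hsum := hasSum_integral_of_summable_integral_norm (μ := μ)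
    (F := fun i t => q i * Real.exp (-π * ε * ‖z i‖ ^ 2) *
      (t * Real.exp (-(π * A * ‖z i‖ ^ 2) * t))) (fun i => (hint i).const_mul _) ?_
  · rw [← integral_congr_ae (μ := μ) (f := fun t => ∑' i, q i * Real.exp (-π * ε * ‖z i‖ ^ 2) *
      (t * Real.exp (-(π * A * ‖z i‖ ^ 2) * t)))]
    · rw [← hsum.tsum_eq]
      refine tsum_congr fun i => ?_
      rw [integral_const_mul]
    · filter_upwards [hμ.ae_pos] with t ht
      rw [realTheta, ← tsum_mul_left]
      refine tsum_congr fun i => ?_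
      rw [show q i * Real.exp (-π * ε * ‖z i‖ ^ 2) * (t * Real.exp (-(π * A * ‖z i‖ ^ 2) * t)) =
        t * (q i * (Real.exp (-π * ε * ‖z i‖ ^ 2) * Real.exp (-(π * A * ‖z i‖ ^ 2) * t))) by ring,
        ← Real.exp_add]
      congr 3
      ring_nf
  · refine Summable.of_nonneg_of_le (fun i => integral_nonneg fun t => norm_nonneg _) (fun i => ?_)
      ((h.sparse.summable_coeff_mul_exp hK hε').mul_right
        (∫ t, t * Real.exp (-(π * A * d ^ 2) * t) ∂μ))
    have hint' : Integrable (fun t => t * Real.exp (-(π * A * d ^ 2) * t)) μ := by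
      simpa using hμ.integrable_pow_mul_exp 1 (r := π * A * d ^ 2) (by positivity)
    rw [← integral_const_mul]
    refine integral_mono_ae ((hint i).const_mul _).norm (hint'.const_mul _) ?_
    filter_upwards [hμ.ae_pos] with t ht
    rw [norm_mul, norm_mul, Real.norm_eq_abs, Real.norm_of_nonneg (Real.exp_pos _).le,
      Real.norm_of_nonneg (by positivity)]
    have : d ^ 2 ≤ ‖z i‖ ^ 2 := by gcongr; exact hdz i
    gcongr

/-- If the sum `∑ qᵢ f'(π A |zᵢ|²)` vanishes, then the theta transforms of the two measures
agree at `A`. -/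
lemma realThetaTransform_eq [Countable ι] (h : IsModularFamily q z) (hμ : IsLaplaceMeasure μ)
    (hν : IsLaplaceMeasure ν) {A : ℝ} (hA : 0 < A)
    (hsum : Summable fun i => q i * laplaceDeriv μ ν (π * A * ‖z i‖ ^ 2))
    (h0 : ∑' i, q i * laplaceDeriv μ ν (π * A * ‖z i‖ ^ 2) = 0) :
    realThetaTransform q z μ A = realThetaTransform q z ν A := by
  have hπ := Real.pi_pos
  obtain ⟨K, hK⟩ := h.coeff
  obtain ⟨d, hd, hdz⟩ := h.sparse.bound
  have summ : ∀ {κ : Measure ℝ}, IsLaplaceMeasure κ → ∀ ε, 0 < ε → Summable fun i =>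
      q i * Real.exp (-π * ε * ‖z i‖ ^ 2) * ∫ t, t * Real.exp (-(π * A * ‖z i‖ ^ 2) * t) ∂κ := by
    intro κ hκ ε hε
    refine ((h.sparse.summable_coeff_mul_exp hK hε).mul_right
      (∫ t, t * Real.exp (-(π * A * d ^ 2) * t) ∂κ)).of_norm_bounded fun i => ?_
    have hz : 0 < ‖z i‖ := hd.trans_le (hdz i)
    rw [norm_mul, norm_mul, Real.norm_eq_abs, Real.norm_of_nonneg (Real.exp_pos _).le]
    have e1 : 0 ≤ ∫ t, t * Real.exp (-(π * A * ‖z i‖ ^ 2) * t) ∂κ := by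
      simpa using hκ.moment_nonneg 1 (π * A * ‖z i‖ ^ 2)
    rw [Real.norm_of_nonneg e1]
    gcongr ?_ * ?_
    refine integral_mono_ae
      (by simpa using hκ.integrable_pow_mul_exp 1 (r := π * A * ‖z i‖ ^ 2) (by positivity))
      (by simpa using hκ.integrable_pow_mul_exp 1 (r := π * A * d ^ 2) (by positivity)) ?_
    filter_upwards [hκ.ae_pos] with t ht
    have : d ^ 2 ≤ ‖z i‖ ^ 2 := by gcongr; exact hdz i
    gcongr
  -- The sums for μ and ν separately need not converge without regularization; only their difference
  -- is known to be summable. Hence the difference is taken before ε tends to 0.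
  have h1 := (h.tendsto_regularized hν hA).sub (h.tendsto_regularized hμ hA)
  have h2 : Tendsto (fun ε => ∑' i, Real.exp (-π * ε * ‖z i‖ ^ 2) *
      (q i * laplaceDeriv μ ν (π * A * ‖z i‖ ^ 2))) (𝓝[>] 0)
      (𝓝 (∑' i, q i * laplaceDeriv μ ν (π * A * ‖z i‖ ^ 2))) := by
    refine tendsto_tsum_of_dominated_convergence hsum.norm (fun i => ?_) ?_
    · have : Tendsto (fun ε => Real.exp (-π * ε * ‖z i‖ ^ 2)) (𝓝 0) (𝓝 1) := by
        have hc : Continuous fun ε => Real.exp (-π * ε * ‖z i‖ ^ 2) := by fun_prop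
        exact hc.tendsto' 0 1 (by simp)
      simpa using (this.mono_left nhdsWithin_le_nhds).mul_const
        (q i * laplaceDeriv μ ν (π * A * ‖z i‖ ^ 2))
    · filter_upwards [self_mem_nhdsWithin] with ε hε i
      have hε' : 0 < ε := hε
      rw [norm_mul, Real.norm_of_nonneg (Real.exp_pos _).le]
      refine mul_le_of_le_one_left (norm_nonneg _) (Real.exp_le_one_iff.2 ?_)
      have : 0 ≤ π * ε * ‖z i‖ ^ 2 := by positivity
      linarith
  have h3 : (fun ε => ∑' i, Real.exp (-π * ε * ‖z i‖ ^ 2) *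
      (q i * laplaceDeriv μ ν (π * A * ‖z i‖ ^ 2))) =ᶠ[𝓝[>] 0] fun ε =>
      (∑' i, q i * Real.exp (-π * ε * ‖z i‖ ^ 2) *
        ∫ t, t * Real.exp (-(π * A * ‖z i‖ ^ 2) * t) ∂ν) -
      ∑' i, q i * Real.exp (-π * ε * ‖z i‖ ^ 2) *
        ∫ t, t * Real.exp (-(π * A * ‖z i‖ ^ 2) * t) ∂μ := by
    filter_upwards [self_mem_nhdsWithin] with ε hε
    rw [← (summ hν ε hε).tsum_sub (summ hμ ε hε)]
    refine tsum_congr fun i => ?_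
    rw [laplaceDeriv]
    ring
  have := tendsto_nhds_unique h2 (h1.congr' h3.symm)
  rw [h0] at this
  linarith

end IsModularFamily

end Family

/-- Needed for Tonelli's theorem: exp(-t) is bounded below on every half-line to the left. -/
lemma IsLaplaceMeasure.isLocallyFinite {μ : Measure ℝ} (hμ : IsLaplaceMeasure μ) :
    IsLocallyFiniteMeasure μ := by
  refine ⟨fun x => ⟨Iio (x + 1), Iio_mem_nhds (by linarith), ?_⟩⟩
  have h := (hμ.integrable_exp 1 one_pos).measure_norm_ge_lt_top (Real.exp_pos (-(x + 1)))
  refine (measure_mono fun t ht => ?_).trans_lt h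
  have ht' : t < x + 1 := ht
  simp only [Real.norm_eq_abs, Real.abs_exp, mem_ofPred_eq]
  exact Real.exp_le_exp.2 (by linarith)

/-! ### Recovering a measure from its theta transform -/

section Family

variable {ι : Type*} {q : ι → ℝ} {z : ι → ℂ} {μ ν : Measure ℝ}

/-- The theta series, extended by zero to the negative half-line. -/
def posTheta (q : ι → ℝ) (z : ι → ℂ) : ℝ → ℝ := (Ioi 0).indicator (realTheta q z)

lemma posTheta_of_pos {t : ℝ} (ht : 0 < t) : posTheta q z t = realTheta q z t :=
  indicator_of_mem (mem_Ioi.2 ht) _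

namespace IsModularFamily

lemma measurable_posTheta (h : IsModularFamily q z) : Measurable (posTheta q z) := by
  refine measurable_of_restrict_of_restrict_compl (s := Ioi 0) measurableSet_Ioi ?_ ?_
  · convert (continuousOn_iff_continuous_domRestrict.1 h.continuousOn_realTheta).measurable using 1
    ext t
    exact indicator_of_mem t.2 _
  · convert measurable_const (a := (0 : ℝ)) using 1
    ext t
    exact indicator_of_notMem t.2 _

lemma integrableOn_realTheta (h : IsModularFamily q z) : IntegrableOn (realTheta q z) (Ioi 0) := by
  obtain ⟨c, C, hc, hC, hb⟩ := h.exists_bound_real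
  refine ((integrableOn_exp_mul_Ioi (neg_lt_zero.2 hc) 0).const_mul C).mono'
    (h.continuousOn_realTheta.aestronglyMeasurable measurableSet_Ioi) ?_
  filter_upwards [ae_restrict_mem measurableSet_Ioi] with t ht using hb t ht

lemma integral_realTheta_pos (h : IsModularFamily q z)
    (hpos : ∀ t, 0 < t → 0 ≤ realTheta q z t) (hne : ∃ t, 0 < t ∧ realTheta q z t ≠ 0) :
    0 < ∫ t in Ioi 0, realTheta q z t := by
  obtain ⟨t₀, ht₀, hne⟩ := hne
  rw [setIntegral_pos_iff_support_of_nonneg_ae ?_ h.integrableOn_realTheta]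
  · have hopen : IsOpen (Ioi 0 ∩ realTheta q z ⁻¹' {0}ᶜ) :=
      h.continuousOn_realTheta.isOpen_inter_preimage isOpen_Ioi isOpen_compl_singleton
    refine (hopen.measure_pos volume ⟨t₀, ht₀, hne⟩).trans_le (measure_mono fun t ht => ?_)
    exact ⟨ht.2, ht.1⟩
  · filter_upwards [ae_restrict_mem measurableSet_Ioi] with t ht using hpos t ht

lemma integrable_thetaTransform (h : IsModularFamily q z) (hμ : IsLaplaceMeasure μ) {A : ℝ}
    (hA : 0 < A) : Integrable (fun t => t * realTheta q z (A * t)) μ := by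
  obtain ⟨c, C, hc, hC, hb⟩ := h.exists_bound_real
  have hmeas := h.aestronglyMeasurable_realTheta hμ hA le_rfl
  simp only [add_zero] at hmeas
  refine (integrable_majorant hμ (r := c * A) (by positivity) C).mono' hmeas ?_
  filter_upwards [hμ.ae_pos] with t ht
  rw [norm_mul, Real.norm_of_nonneg ht.le, Real.norm_eq_abs]
  calc t * |realTheta q z (A * t)| ≤ t * (C * Real.exp (-c * (A * t))) := by
        gcongr; exact hb _ (by positivity)
    _ = _ := by ring_nf

lemma integral_scaled (t : ℝ) (ht : 0 < t) :
    ∫ A in Ioi 0, t * realTheta q z (A * t) = ∫ u in Ioi 0, realTheta q z u := by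
  have := integral_comp_mul_right_Ioi (realTheta q z) 0 ht
  rw [zero_mul] at this
  rw [integral_const_mul, this, smul_eq_mul, mul_inv_cancel_left₀ ht.ne']

lemma integrableOn_scaled (h : IsModularFamily q z) {t : ℝ} (ht : 0 < t) :
    IntegrableOn (fun A => t * realTheta q z (A * t)) (Ioi 0) := by
  refine Integrable.const_mul ?_ t
  have := (integrableOn_Ioi_comp_mul_right_iff (realTheta q z) 0 ht).2
  rw [zero_mul] at this
  exact this h.integrableOn_realTheta

lemma measurable_kernel (h : IsModularFamily q z) :
    Measurable fun p : ℝ × ℝ => p.2 * posTheta q z (p.1 * p.2) :=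
  measurable_snd.mul (h.measurable_posTheta.comp (measurable_fst.mul measurable_snd))

/-- The total mass of a measure, from its theta transform. -/
lemma lintegral_realThetaTransform (h : IsModularFamily q z) (hμ : IsLaplaceMeasure μ)
    (hpos : ∀ t, 0 < t → 0 ≤ realTheta q z t) :
    ∫⁻ A in Ioi 0, ENNReal.ofReal (realThetaTransform q z μ A) =
      ENNReal.ofReal (∫ u in Ioi 0, realTheta q z u) * μ univ := by
  have := hμ.isLocallyFinite
  have e1 : ∫⁻ A in Ioi 0, ENNReal.ofReal (realThetaTransform q z μ A) =
      ∫⁻ A in Ioi 0, ∫⁻ t, ENNReal.ofReal (t * posTheta q z (A * t)) ∂μ := by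
    refine setLIntegral_congr_fun measurableSet_Ioi fun A hA => ?_
    have hA' : 0 < A := hA
    simp only [realThetaTransform]
    rw [ofReal_integral_eq_lintegral_ofReal (h.integrable_thetaTransform hμ hA')]
    · refine lintegral_congr_ae ?_
      filter_upwards [hμ.ae_pos] with t ht
      rw [posTheta_of_pos (by positivity)]
    · filter_upwards [hμ.ae_pos] with t ht
      exact mul_nonneg ht.le (hpos _ (by positivity))
  rw [e1, lintegral_lintegral_swap (h.measurable_kernel.ennreal_ofReal.aemeasurable),
    ← lintegral_const]
  refine lintegral_congr_ae ?_
  filter_upwards [hμ.ae_pos] with t ht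
  rw [← integral_scaled t ht, ofReal_integral_eq_lintegral_ofReal (h.integrableOn_scaled ht)]
  · refine setLIntegral_congr_fun measurableSet_Ioi fun A hA => ?_
    have hA' : 0 < A := hA
    rw [posTheta_of_pos (by positivity)]
  · filter_upwards [ae_restrict_mem measurableSet_Ioi] with A hA
    have hA' : 0 < A := hA
    exact mul_nonneg ht.le (hpos _ (by positivity))

/-- The Mellin transform of a theta transform on the line `Re s = 1`. -/
lemma mellin_realThetaTransform (h : IsModularFamily q z) (hμ : IsLaplaceMeasure μ)
    [IsFiniteMeasure μ] (hpos : ∀ t, 0 < t → 0 ≤ realTheta q z t) (ξ : ℝ) :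
    mellin (fun A => (realThetaTransform q z μ A : ℂ)) (1 + ξ * Complex.I) =
      mellin (fun u => (realTheta q z u : ℂ)) (1 + ξ * Complex.I) *
        ∫ t : ℝ, (t : ℂ) ^ (-(ξ * Complex.I)) ∂μ := by
  have hnorm : ∀ A : ℝ, 0 < A → ‖(A : ℂ) ^ (ξ * Complex.I)‖ = 1 := fun A hA => by
    rw [Complex.norm_cpow_eq_rpow_re_of_pos hA]; simp
  have hmeasA : Measurable fun A : ℝ => (A : ℂ) ^ (ξ * Complex.I) :=
    Complex.measurable_ofReal.pow_const _
  set F : ℝ → ℝ → ℂ := fun A t => (A : ℂ) ^ (ξ * Complex.I) *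
    ((t * posTheta q z (A * t) : ℝ) : ℂ) with hF
  have hFm : Measurable (Function.uncurry F) :=
    (hmeasA.comp measurable_fst).mul (Complex.measurable_ofReal.comp h.measurable_kernel)
  have hFeq : ∀ A t : ℝ, 0 < A → 0 < t → F A t =
      (A : ℂ) ^ (ξ * Complex.I) * ((t * realTheta q z (A * t) : ℝ) : ℂ) := fun A t hA ht => by
    rw [hF]; simp only; rw [posTheta_of_pos (by positivity)]
  have hFnorm : ∀ A t : ℝ, 0 < A → 0 < t → ‖F A t‖ = t * realTheta q z (A * t) :=
    fun A t hA ht => by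
      rw [hFeq A t hA ht, norm_mul, hnorm A hA, one_mul, Complex.norm_real,
        Real.norm_of_nonneg (mul_nonneg ht.le (hpos _ (by positivity)))]
  -- For fixed t the norm integrates over A to ∫ Θ, independently of t. Finiteness of μ then makes
  -- the double integral converge.
  have hFint : Integrable (Function.uncurry F) ((volume.restrict (Ioi 0)).prod μ) := by
    rw [integrable_prod_iff' hFm.aestronglyMeasurable]
    constructor
    · filter_upwards [hμ.ae_pos] with t ht
      refine (h.integrableOn_scaled ht).mono' ?_ ?_
      · exact (hFm.comp measurable_prodMk_right).aestronglyMeasurable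
      · filter_upwards [ae_restrict_mem measurableSet_Ioi] with A hA
        exact (hFnorm A t hA ht).le
    · refine (integrable_const (∫ u in Ioi 0, realTheta q z u)).congr ?_
      filter_upwards [hμ.ae_pos] with t ht
      rw [← integral_scaled t ht]
      refine setIntegral_congr_fun measurableSet_Ioi fun A hA => ?_
      exact (hFnorm A t hA ht).symm
  have e1 : mellin (fun A => (realThetaTransform q z μ A : ℂ)) (1 + ξ * Complex.I) =
      ∫ A in Ioi 0, ∫ t, F A t ∂μ := by
    rw [mellin]
    refine setIntegral_congr_fun measurableSet_Ioi fun A hA => ?_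
    have hA' : 0 < A := hA
    simp only [realThetaTransform, smul_eq_mul, add_sub_cancel_left]
    rw [← integral_complex_ofReal, ← integral_const_mul]
    refine integral_congr_ae ?_
    filter_upwards [hμ.ae_pos] with t ht
    rw [hFeq A t hA' ht]
  rw [e1, integral_integral_swap hFint, ← integral_const_mul]
  refine integral_congr_ae ?_
  filter_upwards [hμ.ae_pos] with t ht
  have h2 := mellin_comp_mul_right (fun u => (realTheta q z u : ℂ)) (1 + ξ * Complex.I) ht
  have ht' : (t : ℂ) ≠ 0 := by exact_mod_cast ht.ne'
  calc ∫ A in Ioi 0, F A t = t * mellin (fun A => (realTheta q z (A * t) : ℂ))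
        (1 + ξ * Complex.I) := by
        rw [mellin, ← integral_const_mul]
        refine setIntegral_congr_fun measurableSet_Ioi fun A hA => ?_
        rw [hFeq A t hA ht, add_sub_cancel_left, smul_eq_mul]
        push_cast
        ring
    _ = _ := by
      rw [h2, smul_eq_mul, neg_add, Complex.cpow_add _ _ ht', Complex.cpow_neg_one]
      field_simp

/-- Boundedness at 0 and exponential decay at infinity give convergence for all Re s > 0. The point
s = 1, where the value is ∫ Θ, lies in the interior. -/
lemma analyticOnNhd_mellin (h : IsModularFamily q z) :
    AnalyticOnNhd ℂ (mellin fun u => (realTheta q z u : ℂ)) {s : ℂ | 0 < s.re} := by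
  obtain ⟨c, C, hc, hC, hb⟩ := h.exists_bound_real
  refine DifferentiableOn.analyticOnNhd (fun s hs => ?_) isOpen_re_pos
  refine (mellin_differentiableAt_of_isBigO_rpow_exp (b := 0) hc ?_ ?_ ?_ hs).differentiableWithinAt
  · exact (Complex.continuous_ofReal.comp_continuousOn h.continuousOn_realTheta).locallyIntegrableOn
      measurableSet_Ioi
  · refine IsBigO.of_bound C ?_
    filter_upwards [eventually_gt_atTop 0] with t ht
    simpa using hb t ht
  · refine IsBigO.of_bound C ?_
    filter_upwards [self_mem_nhdsWithin] with t ht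
    have ht' : 0 < t := ht
    have : Real.exp (-c * t) ≤ 1 := Real.exp_le_one_iff.2 (by nlinarith)
    simpa using (hb t ht').trans (mul_le_mul_of_nonneg_left this hC)

/-- If the theta series is nonnegative, then a Laplace measure is determined by its theta
transform, up to the addition of an infinite measure. -/
lemma integral_exp_eq (h : IsModularFamily q z)
    (hpos : ∀ t, 0 < t → 0 ≤ realTheta q z t) (hne : ∃ t, 0 < t ∧ realTheta q z t ≠ 0)
    (hμ : IsLaplaceMeasure μ) (hν : IsLaplaceMeasure ν)
    (hfin : IsFiniteMeasure μ ∨ IsFiniteMeasure ν)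
    (heq : ∀ A, 0 < A → realThetaTransform q z μ A = realThetaTransform q z ν A) (r : ℝ) :
    ∫ t, Real.exp (-r * t) ∂μ = ∫ t, Real.exp (-r * t) ∂ν := by
  have hI := h.integral_realTheta_pos hpos hne
  -- The integral over A of the transform is ∫ Θ times the total mass, with values in [0, ∞]. The
  -- positive finite factor cancels, so finiteness of one measure passes to the other.
  have hmass : μ univ = ν univ := by
    have e : ∫⁻ A in Ioi 0, ENNReal.ofReal (realThetaTransform q z μ A) =
        ∫⁻ A in Ioi 0, ENNReal.ofReal (realThetaTransform q z ν A) :=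
      setLIntegral_congr_fun measurableSet_Ioi fun A hA => by simp only [heq A hA]
    rw [h.lintegral_realThetaTransform hμ hpos, h.lintegral_realThetaTransform hν hpos] at e
    exact (ENNReal.mul_right_inj (ENNReal.ofReal_pos.2 hI).ne' ENNReal.ofReal_ne_top).1 e
  have hμf : IsFiniteMeasure μ := by
    rcases hfin with h1 | h1
    · exact h1
    · exact ⟨hmass ▸ measure_lt_top ν univ⟩
  have hνf : IsFiniteMeasure ν := ⟨hmass ▸ measure_lt_top μ univ⟩
  have hchar : ∀ {κ : Measure ℝ}, IsLaplaceMeasure κ → ∀ ξ : ℝ,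
      ∫ t : ℝ, (t : ℂ) ^ (-(ξ * Complex.I)) ∂κ = charFun (κ.map Real.log) (-ξ) := by
    intro κ hκ ξ
    rw [charFun_apply_real, integral_map Real.measurable_log.aemeasurable
      (by fun_prop)]
    refine integral_congr_ae ?_
    filter_upwards [hκ.ae_pos] with t ht
    rw [Complex.cpow_def_of_ne_zero (by exact_mod_cast ht.ne'), Complex.ofReal_log ht.le]
    congr 1
    push_cast; ring
  have hmap : μ.map Real.log = ν.map Real.log := by
    have := Measure.isFiniteMeasure_map μ Real.log
    have := Measure.isFiniteMeasure_map ν Real.log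
    refine Measure.ext_of_charFun (funext fun ξ₀ => ?_)
    by_contra hcon
    have hcont : Continuous fun ξ => charFun (μ.map Real.log) ξ - charFun (ν.map Real.log) ξ :=
      continuous_charFun.sub continuous_charFun
    have hev : ∀ᶠ ξ in 𝓝 ξ₀, charFun (μ.map Real.log) ξ - charFun (ν.map Real.log) ξ ≠ 0 :=
      hcont.continuousAt.eventually_ne (sub_ne_zero.2 hcon)
    -- If the characteristic functions of the logarithms differ at ξ₀, they differ nearby, so the
    -- Mellin transform of Θ must vanish on a segment, hence identically. This contradicts its
    -- positive value ∫ Θ at s = 1.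
    have hzero : ∀ᶠ ξ in 𝓝 ξ₀,
        mellin (fun u => (realTheta q z u : ℂ)) (1 + (-ξ : ℝ) * Complex.I) = 0 := by
      filter_upwards [hev] with ξ hξ
      have e1 := h.mellin_realThetaTransform hμ hpos (-ξ)
      have e2 := h.mellin_realThetaTransform hν hpos (-ξ)
      have e3 : mellin (fun A => (realThetaTransform q z μ A : ℂ)) (1 + (-ξ : ℝ) * Complex.I) =
          mellin (fun A => (realThetaTransform q z ν A : ℂ)) (1 + (-ξ : ℝ) * Complex.I) :=
        setIntegral_congr_fun measurableSet_Ioi fun A hA => by simp only [heq A hA]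
      rw [e3, e2, hchar hμ, hchar hν, neg_neg] at e1
      have e4 : mellin (fun u => (realTheta q z u : ℂ)) (1 + (-ξ : ℝ) * Complex.I) *
          (charFun (μ.map Real.log) ξ - charFun (ν.map Real.log) ξ) = 0 := by
        rw [mul_sub, e1, sub_self]
      exact (mul_eq_zero.1 e4).resolve_right hξ
    have hvanish := h.analyticOnNhd_mellin.eqOn_zero_of_preconnected_of_frequently_eq_zero
      (convex_halfSpace_re_gt 0).isPreconnected (z₀ := 1 + (-ξ₀ : ℝ) * Complex.I) (by simp) ?_
      (show (1 : ℂ) ∈ {s : ℂ | 0 < s.re} by simp)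
    · simp only [mellin, sub_self, Complex.cpow_zero, one_smul, Pi.zero_apply] at hvanish
      rw [integral_complex_ofReal] at hvanish
      exact hI.ne' (by exact_mod_cast hvanish)
    · have hlim : Tendsto (fun ξ : ℝ => (1 : ℂ) + (-ξ : ℝ) * Complex.I) (𝓝[>] ξ₀)
          (𝓝[≠] (1 + (-ξ₀ : ℝ) * Complex.I)) := by
        refine tendsto_nhdsWithin_of_tendsto_nhds_of_eventually_within _ ?_ ?_
        · have hc : Continuous fun ξ : ℝ => (1 : ℂ) + (-ξ : ℝ) * Complex.I := by fun_prop
          exact (hc.tendsto ξ₀).mono_left nhdsWithin_le_nhds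
        · filter_upwards [self_mem_nhdsWithin] with ξ hξ
          have hξ' : ξ₀ < ξ := hξ
          simp [hξ'.ne']
      refine hlim.frequently (Eventually.frequently ?_)
      exact hzero.filter_mono nhdsWithin_le_nhds
  have hlap : ∀ {κ : Measure ℝ}, IsLaplaceMeasure κ →
      ∫ t, Real.exp (-r * t) ∂κ = ∫ x, Real.exp (-r * Real.exp x) ∂(κ.map Real.log) := by
    intro κ hκ
    rw [integral_map Real.measurable_log.aemeasurable (by fun_prop)]
    refine integral_congr_ae ?_
    filter_upwards [hκ.ae_pos] with t ht
    rw [Real.exp_log ht]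
  rw [hlap hμ, hlap hν, hmap]

end IsModularFamily

end Family

/-! ### The theta series of Re z² and Im z² -/

section Family

variable {ι : Type*} {z : ι → ℂ}

lemma abs_re_sq_le (w : ℂ) : |(w ^ 2).re| ≤ 1 * ‖w‖ ^ 2 := by
  rw [one_mul, ← norm_pow]; exact Complex.abs_re_le_norm _

lemma abs_im_sq_le (w : ℂ) : |(w ^ 2).im| ≤ 1 * ‖w‖ ^ 2 := by
  rw [one_mul, ← norm_pow]; exact Complex.abs_im_le_norm _

lemma IsSparse.hasSum_harmonicTheta (hz : IsSparse z) {t : ℝ} (ht : 0 < t) :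
    HasSum (fun i => (Real.exp (-π * t * ‖z i‖ ^ 2) : ℂ) * z i ^ 2) (harmonicTheta z t) := by
  have hs : Summable fun i => (Real.exp (-π * t * ‖z i‖ ^ 2) : ℂ) * z i ^ 2 := by
    refine (hz.summable_pow_mul_exp 1 ht).of_norm_bounded fun i => le_of_eq ?_
    rw [norm_mul, norm_pow, Complex.norm_real, Real.norm_of_nonneg (Real.exp_pos _).le, mul_one,
      mul_comm]
  have := hs.hasSum
  rw [harmonicTheta, momentSum]
  simpa using this

lemma IsSparse.realTheta_re (hz : IsSparse z) {t : ℝ} (ht : 0 < t) :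
    realTheta (fun i => (z i ^ 2).re) z t = (harmonicTheta z t).re := by
  rw [← (Complex.hasSum_re (hz.hasSum_harmonicTheta ht)).tsum_eq, realTheta]
  refine tsum_congr fun i => ?_
  rw [Complex.re_ofReal_mul, mul_comm]

lemma IsSparse.realTheta_im (hz : IsSparse z) {t : ℝ} (ht : 0 < t) :
    realTheta (fun i => (z i ^ 2).im) z t = (harmonicTheta z t).im := by
  rw [← (Complex.hasSum_im (hz.hasSum_harmonicTheta ht)).tsum_eq, realTheta]
  refine tsum_congr fun i => ?_
  rw [Complex.im_ofReal_mul, mul_comm]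

end Family

/-- The theta series of the form `Re z²`. -/
def thetaRe (x y t : ℝ) : ℝ :=
  realTheta (fun v : NonzeroPair => (unitPt x y v ^ 2).re) (fun v : NonzeroPair => unitPt x y v) t

/-- The theta series of the form `Im z²`. -/
def thetaIm (x y t : ℝ) : ℝ :=
  realTheta (fun v : NonzeroPair => (unitPt x y v ^ 2).im) (fun v : NonzeroPair => unitPt x y v) t

lemma thetaRe_inv (x : ℝ) {y t : ℝ} (hy : 0 < y) (ht : 0 < t) :
    thetaRe x y t⁻¹ = t ^ 3 * thetaRe x y t := by
  have hz := isSparse_unitPt x hy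
  rw [thetaRe, thetaRe, hz.realTheta_re ht, hz.realTheta_re (inv_pos.2 ht),
    harmonicTheta_inv x hy ht, ← Complex.ofReal_pow, Complex.re_ofReal_mul]

lemma thetaIm_inv (x : ℝ) {y t : ℝ} (hy : 0 < y) (ht : 0 < t) :
    thetaIm x y t⁻¹ = t ^ 3 * thetaIm x y t := by
  have hz := isSparse_unitPt x hy
  rw [thetaIm, thetaIm, hz.realTheta_im ht, hz.realTheta_im (inv_pos.2 ht),
    harmonicTheta_inv x hy ht, ← Complex.ofReal_pow, Complex.im_ofReal_mul]

lemma isModularFamily_re (x : ℝ) {y : ℝ} (hy : 0 < y) :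
    IsModularFamily (fun v : NonzeroPair => (unitPt x y v ^ 2).re)
      (fun v : NonzeroPair => unitPt x y v) :=
  ⟨isSparse_unitPt x hy, ⟨1, fun _ => abs_re_sq_le _⟩, fun _ ht => thetaRe_inv x hy ht⟩

lemma isModularFamily_im (x : ℝ) {y : ℝ} (hy : 0 < y) :
    IsModularFamily (fun v : NonzeroPair => (unitPt x y v ^ 2).im)
      (fun v : NonzeroPair => unitPt x y v) :=
  ⟨isSparse_unitPt x hy, ⟨1, fun _ => abs_im_sq_le _⟩, fun _ ht => thetaIm_inv x hy ht⟩

lemma unitPt_sq_re (x : ℝ) {y : ℝ} (hy : 0 < y) (v : ℤ × ℤ) :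
    (unitPt x y v ^ 2).re = (v.1 + v.2 * x) ^ 2 / y - v.2 ^ 2 * y := by
  have h2 : (Real.sqrt y)⁻¹ * (Real.sqrt y)⁻¹ = y⁻¹ := by
    rw [← mul_inv, Real.mul_self_sqrt hy.le]
  rw [pow_two, Complex.mul_re, unitPt_re, unitPt_im]
  calc _ = ((Real.sqrt y)⁻¹ * (Real.sqrt y)⁻¹) * ((v.1 + v.2 * x) ^ 2 - (v.2 * y) ^ 2) := by ring
    _ = _ := by rw [h2]; field_simp

lemma unitPt_sq_im (x : ℝ) {y : ℝ} (hy : 0 < y) (v : ℤ × ℤ) :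
    (unitPt x y v ^ 2).im = 2 * v.2 * (v.1 + v.2 * x) := by
  have h2 : (Real.sqrt y)⁻¹ * (Real.sqrt y)⁻¹ = y⁻¹ := by
    rw [← mul_inv, Real.mul_self_sqrt hy.le]
  rw [pow_two, Complex.mul_im, unitPt_re, unitPt_im]
  calc _ = ((Real.sqrt y)⁻¹ * (Real.sqrt y)⁻¹) * (2 * (v.2 * y) * (v.1 + v.2 * x)) := by ring
    _ = _ := by rw [h2]; field_simp

/-- The Gaussian weight of a lattice point, factored. -/
lemma exp_unitPt (x : ℝ) {y t : ℝ} (hy : 0 < y) (v : ℤ × ℤ) :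
    Real.exp (-π * t * ‖unitPt x y v‖ ^ 2) =
      Real.exp (-π * (v.1 + v.2 * x) ^ 2 * (t / y)) * Real.exp (-π * v.2 ^ 2 * (t * y)) := by
  rw [← Real.exp_add, norm_unitPt_sq x hy]
  congr 1
  field_simp
  ring

lemma hasSum_thetaIm (x : ℝ) {y t : ℝ} (hy : 0 < y) (ht : 0 < t) :
    HasSum (fun v : ℤ × ℤ => 2 * v.2 * (v.1 + v.2 * x) *
      (Real.exp (-π * (v.1 + v.2 * x) ^ 2 * (t / y)) * Real.exp (-π * v.2 ^ 2 * (t * y))))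
      (thetaIm x y t) := by
  have h := (isModularFamily_im x hy).summable_term_real ht
  have h2 : Summable fun v : ℤ × ℤ => (unitPt x y v ^ 2).im *
    Real.exp (-π * t * ‖unitPt x y v‖ ^ 2) := summable_nonzeroPair h
  have h3 := tsum_nonzeroPair h2
  have h4 := h2.hasSum
  rw [h3, unitPt_sq_im x hy] at h4
  simp only [unitPt_sq_im x hy, exp_unitPt x hy] at h4
  simp only [thetaIm, realTheta, unitPt_sq_im x hy, exp_unitPt x hy]
  simpa using h4

lemma summable_thetaRe_pos (x : ℝ) {y t : ℝ} (hy : 0 < y) (ht : 0 < t) :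
    Summable (fun v : ℤ × ℤ => (v.1 + v.2 * x) ^ 2 / y *
      (Real.exp (-π * (v.1 + v.2 * x) ^ 2 * (t / y)) * Real.exp (-π * v.2 ^ 2 * (t * y)))) ∧
    Summable (fun v : ℤ × ℤ => v.2 ^ 2 * y *
      (Real.exp (-π * (v.1 + v.2 * x) ^ 2 * (t / y)) * Real.exp (-π * v.2 ^ 2 * (t * y)))) := by
  have h : Summable fun v : ℤ × ℤ => ‖unitPt x y v‖ ^ (2 * 1) *
      Real.exp (-π * t * ‖unitPt x y v‖ ^ 2) :=
    summable_nonzeroPair ((isSparse_unitPt x hy).summable_pow_mul_exp 1 ht)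
  simp only [mul_one, exp_unitPt x hy] at h
  simp only [norm_unitPt_sq x hy] at h
  constructor
  · refine Summable.of_nonneg_of_le (fun v => by positivity) (fun v => ?_) h
    gcongr
    have : 0 ≤ (v.2 : ℝ) ^ 2 * y := by positivity
    linarith
  · refine Summable.of_nonneg_of_le (fun v => by positivity) (fun v => ?_) h
    gcongr
    have : 0 ≤ ((v.1 : ℝ) + v.2 * x) ^ 2 / y := by positivity
    linarith

lemma thetaRe_eq (x : ℝ) {y t : ℝ} (hy : 0 < y) (ht : 0 < t) :
    thetaRe x y t = (∑' v : ℤ × ℤ, (v.1 + v.2 * x) ^ 2 / y *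
      (Real.exp (-π * (v.1 + v.2 * x) ^ 2 * (t / y)) * Real.exp (-π * v.2 ^ 2 * (t * y)))) -
      ∑' v : ℤ × ℤ, v.2 ^ 2 * y *
      (Real.exp (-π * (v.1 + v.2 * x) ^ 2 * (t / y)) * Real.exp (-π * v.2 ^ 2 * (t * y))) := by
  obtain ⟨h1, h2⟩ := summable_thetaRe_pos x hy ht
  rw [← h1.tsum_sub h2, tsum_nonzeroPair (h1.sub h2)]
  simp only [thetaRe, realTheta, unitPt_sq_re x hy, exp_unitPt x hy, sub_mul]
  simp

/-! ### One-dimensional theta functions and rectangular lattices -/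

/-- The one-dimensional theta function. -/
def gaussSum (v : ℝ) : ℝ := ∑' n : ℤ, Real.exp (-π * n ^ 2 * v)

/-- The one-dimensional theta series `∑ π v n² exp (-π n² v)`. -/
def gaussMoment (v : ℝ) : ℝ := ∑' n : ℤ, π * v * n ^ 2 * Real.exp (-π * n ^ 2 * v)

/-- The logarithmic derivative of `gaussSum`, up to sign. -/
def gaussRatio (v : ℝ) : ℝ := gaussMoment v / gaussSum v

lemma gaussSum_eq_evenKernel {v : ℝ} (hv : 0 < v) : gaussSum v = HurwitzZeta.evenKernel 0 v := by
  have := (HurwitzZeta.hasSum_int_evenKernel 0 hv).tsum_eq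
  simpa [gaussSum] using this

lemma summable_gaussMoment {v : ℝ} (hv : 0 < v) :
    Summable fun n : ℤ => π * v * n ^ 2 * Real.exp (-π * n ^ 2 * v) := by
  have h := (summable_int_gaussian (half_pos hv)).mul_left 2
  refine Summable.of_nonneg_of_le (fun n => by positivity) (fun n => ?_) h
  have e : Real.exp (-π * n ^ 2 * v) =
      Real.exp (-π * n ^ 2 * (v / 2)) * Real.exp (-(π * n ^ 2 * v / 2)) := by
    rw [← Real.exp_add]; congr 1; ring
  have h1 := Real.add_one_le_exp (π * n ^ 2 * v / 2)
  have h2 : π * n ^ 2 * v / 2 * Real.exp (-(π * n ^ 2 * v / 2)) ≤ 1 := by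
    rw [Real.exp_neg, ← div_eq_mul_inv, div_le_one (Real.exp_pos _)]
    linarith
  rw [e]
  calc _ = 2 * Real.exp (-π * n ^ 2 * (v / 2)) *
        (π * n ^ 2 * v / 2 * Real.exp (-(π * n ^ 2 * v / 2))) := by ring
    _ ≤ 2 * Real.exp (-π * n ^ 2 * (v / 2)) * 1 := by gcongr
    _ = _ := by ring

lemma one_le_gaussSum {v : ℝ} (hv : 0 < v) : 1 ≤ gaussSum v := by
  have := (summable_int_gaussian hv).le_tsum 0 (fun n _ => (Real.exp_pos _).le)
  simpa [gaussSum] using this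

/-- On the Poisson dual side a shift only multiplies positive terms by phases, so the unshifted sum
is the largest. -/
lemma evenKernel_le_gaussSum (a : ℝ) {v : ℝ} (hv : 0 < v) :
    HurwitzZeta.evenKernel a v ≤ gaussSum v := by
  rw [gaussSum_eq_evenKernel hv, HurwitzZeta.evenKernel_functional_equation,
    HurwitzZeta.evenKernel_functional_equation 0]
  gcongr
  have hv' : 0 < 1 / v := by positivity
  have h0 := HurwitzZeta.hasSum_int_cosKernel 0 hv'
  have ha := HurwitzZeta.hasSum_int_cosKernel a hv'
  have h0' := Complex.hasSum_re h0
  have ha' := Complex.hasSum_re ha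
  simp only [Complex.ofReal_re] at h0' ha'
  have e0 : ((0 : ℝ) : UnitAddCircle) = 0 := rfl
  rw [e0] at h0'
  refine hasSum_le (fun n => ?_) ha' h0'
  rw [Complex.re_mul_ofReal, Complex.re_mul_ofReal]
  refine mul_le_mul_of_nonneg_right ?_ (Real.exp_pos _).le
  have h1 : (2 * π * Complex.I * a * n : ℂ) = ((2 * π * a * n : ℝ) : ℂ) * Complex.I := by
    push_cast; ring
  rw [h1]
  refine (Complex.re_le_norm _).trans ?_
  rw [Complex.norm_exp_ofReal_mul_I]
  simp

/-- The tail of the series `∑ k² exp (-π k² X)`. -/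
lemma sum_sq_tail {X : ℝ} (hX : 1 / 4 ≤ X) :
    Summable (fun j : ℕ => ((j : ℝ) + 2) ^ 2 * Real.exp (-π * ((j : ℝ) + 2) ^ 2 * X)) ∧
    ∑' j : ℕ, ((j : ℝ) + 2) ^ 2 * Real.exp (-π * ((j : ℝ) + 2) ^ 2 * X) ≤
      9 / 2 * Real.exp (-4 * π * X) := by
  have hπ : 3 < π := Real.pi_gt_three
  have h15 : Real.exp (-(15 / 4)) ≤ 4 / 81 := by
    rw [Real.exp_neg, inv_le_comm₀ (Real.exp_pos _) (by norm_num)]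
    have h1 : (2.7 : ℝ) ≤ Real.exp 1 := by linarith [Real.exp_one_gt_d9]
    have h2 := Real.sum_le_exp_of_nonneg (x := 15 / 4) (by norm_num) 5
    simp only [Finset.sum_range_succ, Finset.sum_range_zero, Nat.factorial] at h2
    norm_num at h2
    linarith
  have hr : Real.exp (-5 * π * X) ≤ 4 / 81 := by
    refine le_trans (Real.exp_le_exp.2 ?_) h15
    nlinarith
  have hgeom := hasSum_geometric_of_lt_one (r := 1 / 9) (by norm_num) (by norm_num)
  have hmaj := hgeom.mul_left (4 * Real.exp (-4 * π * X))
  have hle : ∀ j : ℕ, ((j : ℝ) + 2) ^ 2 * Real.exp (-π * ((j : ℝ) + 2) ^ 2 * X) ≤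
      4 * Real.exp (-4 * π * X) * (1 / 9) ^ j := by
    intro j
    -- Bernoulli: 1 + j/2 ≤ (3/2)^j. With (j+2)² ≥ 4 + 5j and exp(-5πX) ≤ 4/81, the tail is
    -- dominated by a geometric series of ratio 9/4 · 4/81 = 1/9, and 4 · 9/8 = 9/2.
    have h1 : ((j : ℝ) + 2) ^ 2 ≤ 4 * (9 / 4) ^ j := by
      have hb := one_add_mul_le_pow (a := (1 / 2 : ℝ)) (by norm_num) j
      calc ((j : ℝ) + 2) ^ 2 = 4 * (1 + j * (1 / 2)) ^ 2 := by ring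
        _ ≤ 4 * ((1 + 1 / 2) ^ j) ^ 2 := by gcongr
        _ = _ := by rw [← pow_mul, mul_comm j 2, pow_mul]; norm_num
    have h2 : Real.exp (-π * ((j : ℝ) + 2) ^ 2 * X) ≤
        Real.exp (-4 * π * X) * Real.exp (-5 * π * X) ^ j := by
      rw [← Real.exp_nat_mul, ← Real.exp_add]
      apply Real.exp_le_exp.2
      have hj : (j : ℝ) ≤ (j : ℝ) ^ 2 := by
        exact_mod_cast Nat.le_self_pow two_ne_zero j
      have : 0 ≤ π * X := by positivity
      nlinarith
    calc _ ≤ 4 * (9 / 4) ^ j * (Real.exp (-4 * π * X) * Real.exp (-5 * π * X) ^ j) := by gcongr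
      _ ≤ 4 * (9 / 4) ^ j * (Real.exp (-4 * π * X) * (4 / 81) ^ j) := by gcongr
      _ = 4 * Real.exp (-4 * π * X) * ((9 / 4) ^ j * (4 / 81) ^ j) := by ring
      _ = _ := by rw [← mul_pow]; norm_num
  have hs := Summable.of_nonneg_of_le (fun j => by positivity) hle hmaj.summable
  refine ⟨hs, (hs.tsum_le_tsum hle hmaj.summable).trans (le_of_eq ?_)⟩
  rw [hmaj.tsum_eq]
  norm_num
  ring

lemma exp_neg_pi_le : Real.exp (-π) ≤ 1 / 20 := by
  have h : Real.exp (-π) ≤ Real.exp (-3) := Real.exp_le_exp.2 (by linarith [Real.pi_gt_three])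
  refine h.trans ?_
  rw [Real.exp_neg, inv_le_comm₀ (Real.exp_pos _) (by norm_num)]
  have h1 : Real.exp 3 = Real.exp 1 ^ 3 := by rw [← Real.exp_nat_mul]; norm_num
  have h2 : (2.718 : ℝ) ^ 3 ≤ Real.exp 1 ^ 3 := by
    gcongr; linarith [Real.exp_one_gt_d9]
  rw [h1]
  norm_num at h2 ⊢
  linarith

/-- The leading terms of the Gaussian moment. -/
lemma gaussMoment_le {v : ℝ} (hv : 1 ≤ v) : gaussMoment v ≤ 2.1 * (π * v * Real.exp (-π * v)) := by
  have hv0 : 0 < v := by linarith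
  have hπ : 3 < π := Real.pi_gt_three
  obtain ⟨hs, ht⟩ := sum_sq_tail (X := v) (by linarith)
  have h1 := (summable_gaussMoment hv0).hasSum.nat_add_neg
  have h2 := h1.summable.sum_add_tsum_nat_add 2
  rw [h1.tsum_eq] at h2
  simp only [Finset.sum_range_succ, Finset.sum_range_zero] at h2
  have h3 : ∑' j : ℕ, (π * v * (((j + 2 : ℕ) : ℤ) : ℝ) ^ 2 *
      Real.exp (-π * (((j + 2 : ℕ) : ℤ) : ℝ) ^ 2 * v) + π * v * ((-((j + 2 : ℕ) : ℤ) : ℤ) : ℝ) ^ 2 *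
      Real.exp (-π * ((-((j + 2 : ℕ) : ℤ) : ℤ) : ℝ) ^ 2 * v)) =
      2 * (π * v) * ∑' j : ℕ, ((j : ℝ) + 2) ^ 2 * Real.exp (-π * ((j : ℝ) + 2) ^ 2 * v) := by
    rw [← tsum_mul_left]
    refine tsum_congr fun j => ?_
    push_cast
    rw [neg_sq]
    ring
  rw [h3] at h2
  simp at h2
  have h4 : Real.exp (-4 * π * v) ≤ Real.exp (-π * v) * (1 / 8000) := by
    have e : Real.exp (-4 * π * v) = Real.exp (-π * v) * Real.exp (-π * v) ^ 3 := by
      rw [← Real.exp_nat_mul, ← Real.exp_add]; congr 1; push_cast; ring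
    have e2 : Real.exp (-π * v) ≤ 1 / 20 :=
      (Real.exp_le_exp.2 (by nlinarith)).trans exp_neg_pi_le
    rw [e]
    gcongr
    calc Real.exp (-π * v) ^ 3 ≤ (1 / 20) ^ 3 := by gcongr
      _ = _ := by norm_num
  have hpos : 0 < π * v := by positivity
  have h5 := mul_le_mul_of_nonneg_left (ht.trans (mul_le_mul_of_nonneg_left h4 (by norm_num)))
    hpos.le
  have h6 := Real.exp_pos (-π * v)
  rw [gaussMoment]
  simp only [neg_mul] at h2 h5 h6 ⊢
  nlinarith [mul_pos hpos h6]

lemma gaussMoment_lt_one {v : ℝ} (hv : 1 ≤ v) : gaussMoment v < 1 := by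
  refine (gaussMoment_le hv).trans_lt ?_
  set u := π * v with hu
  have hu3 : 3 ≤ u := by nlinarith [Real.pi_gt_three]
  have h1 := Real.quadratic_le_exp_of_nonneg (x := u) (by linarith)
  have h2 : u * Real.exp (-π * v) = u / Real.exp u := by
    rw [neg_mul, Real.exp_neg, div_eq_mul_inv]
  rw [h2, ← mul_div_assoc, div_lt_one (Real.exp_pos _)]
  nlinarith

/-- The function (u - 1) exp(-u) decreases for u ≥ 2, and every nonzero n has u = πvn² ≥ 3. Summing
over n compares the drop of the theta sum with that of its moment. -/
lemma gaussSum_sub_le {v w : ℝ} (hv : 1 ≤ v) (hvw : v ≤ w) :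
    gaussSum v - gaussSum w ≤ gaussMoment v - gaussMoment w := by
  have hv0 : 0 < v := by linarith
  have hw0 : 0 < w := by linarith
  rw [gaussSum, gaussSum, gaussMoment, gaussMoment,
    ← (summable_int_gaussian hv0).tsum_sub (summable_int_gaussian hw0),
    ← (summable_gaussMoment hv0).tsum_sub (summable_gaussMoment hw0)]
  refine ((summable_int_gaussian hv0).sub (summable_int_gaussian hw0)).tsum_le_tsum (fun n => ?_)
    ((summable_gaussMoment hv0).sub (summable_gaussMoment hw0))
  rcases eq_or_ne n 0 with rfl | hn
  · simp
  have hn1 : (1 : ℝ) ≤ (n : ℝ) ^ 2 := by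
    have : (1 : ℤ) ≤ n ^ 2 := by
      have := sq_nonneg n
      have h0 : n ^ 2 ≠ 0 := pow_ne_zero 2 hn
      omega
    exact_mod_cast this
  set u := π * v * n ^ 2 with hu
  set d := π * (w - v) * n ^ 2 with hd
  have hu3 : 3 ≤ u := by
    have h1 : 3 ≤ π * v := by nlinarith [Real.pi_gt_three]
    nlinarith
  have hd0 : 0 ≤ d := by
    have : 0 ≤ w - v := by linarith
    positivity
  have e1 : -π * (n : ℝ) ^ 2 * v = -u := by rw [hu]; ring
  have e2 : -π * (n : ℝ) ^ 2 * w = -u + -d := by rw [hu, hd]; ring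
  have e3 : π * w * (n : ℝ) ^ 2 = u + d := by rw [hu, hd]; ring
  rw [e1, e2, e3, Real.exp_add]
  have h1 : Real.exp (-d) * (u + d - 1) ≤ u - 1 := by
    rw [Real.exp_neg, inv_mul_le_iff₀ (Real.exp_pos _)]
    have := Real.add_one_le_exp d
    nlinarith
  have h2 := mul_le_mul_of_nonneg_left h1 (Real.exp_pos (-u)).le
  linarith

lemma gaussSum_lt {v w : ℝ} (hv : 0 < v) (hvw : v < w) : gaussSum w < gaussSum v := by
  have hw : 0 < w := hv.trans hvw
  refine (summable_int_gaussian hw).tsum_lt_tsum (i := 1) (fun n => ?_) ?_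
    (summable_int_gaussian hv)
  · apply Real.exp_le_exp.2
    have : 0 ≤ π * (n : ℝ) ^ 2 := by positivity
    nlinarith
  · apply Real.exp_lt_exp.2
    have := Real.pi_pos
    push_cast
    nlinarith

/-- With S the sum and M the moment, M(w) < 1 ≤ S(w) gives M(w)(S(v) - S(w)) < (S(v) - S(w)) S(w) ≤
(M(v) - M(w)) S(w), which rearranges to the claim. -/
lemma gaussRatio_lt {v w : ℝ} (hv : 1 ≤ v) (hvw : v < w) : gaussRatio w < gaussRatio v := by
  have hv0 : 0 < v := by linarith
  have hw0 : 0 < w := by linarith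
  have h1 := gaussSum_sub_le hv hvw.le
  have h2 := gaussSum_lt hv0 hvw
  have h3 := gaussMoment_lt_one (hv.trans hvw.le)
  have h4 := one_le_gaussSum hw0
  rw [gaussRatio, gaussRatio, div_lt_div_iff₀ (by linarith) (by linarith)]
  have h5 : (gaussSum v - gaussSum w) * gaussSum w ≤
      (gaussMoment v - gaussMoment w) * gaussSum w :=
    mul_le_mul_of_nonneg_right h1 (by linarith)
  nlinarith

/-- For a rectangular lattice the double series factors. -/
lemma thetaRe_zero {y t : ℝ} (hy : 0 < y) (ht : 0 < t) :
    thetaRe 0 y t = (gaussMoment (t / y) * gaussSum (t * y) -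
      gaussMoment (t * y) * gaussSum (t / y)) / (π * t) := by
  have hv : 0 < t / y := by positivity
  have hw : 0 < t * y := by positivity
  have hπ := Real.pi_pos
  have n1 := fun n : ℤ => (Real.exp_pos (-π * n ^ 2 * (t / y))).le
  rw [thetaRe_eq 0 hy ht]
  have p1 : gaussMoment (t / y) * gaussSum (t * y) = ∑' v : ℤ × ℤ, (π * (t / y) * v.1 ^ 2 *
      Real.exp (-π * v.1 ^ 2 * (t / y))) * Real.exp (-π * v.2 ^ 2 * (t * y)) :=
    tsum_mul_tsum_of_summable_norm (summable_gaussMoment hv).norm (summable_int_gaussian hw).norm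
  have p2 : gaussSum (t / y) * gaussMoment (t * y) = ∑' v : ℤ × ℤ,
      Real.exp (-π * v.1 ^ 2 * (t / y)) * (π * (t * y) * v.2 ^ 2 *
      Real.exp (-π * v.2 ^ 2 * (t * y))) :=
    tsum_mul_tsum_of_summable_norm (summable_int_gaussian hv).norm (summable_gaussMoment hw).norm
  rw [mul_comm (gaussMoment (t * y)), p1, p2, sub_div, ← tsum_div_const, ← tsum_div_const]
  congr 1
  · refine tsum_congr fun v => ?_
    simp only [mul_zero, add_zero]
    field_simp
  · refine tsum_congr fun v => ?_
    simp only [mul_zero, add_zero]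
    field_simp

lemma thetaRe_zero' {y t : ℝ} (hy : 0 < y) (ht : 0 < t) :
    thetaRe 0 y t = gaussSum (t / y) * gaussSum (t * y) *
      (gaussRatio (t / y) - gaussRatio (t * y)) / (π * t) := by
  have h1 := one_le_gaussSum (v := t / y) (by positivity)
  have h2 := one_le_gaussSum (v := t * y) (by positivity)
  have h1' : gaussSum (t / y) ≠ 0 := by linarith
  have h2' : gaussSum (t * y) ≠ 0 := by linarith
  rw [thetaRe_zero hy ht, gaussRatio, gaussRatio]
  congr 1
  field_simp

lemma gaussSum_inv {v : ℝ} (hv : 0 < v) : gaussSum v⁻¹ = Real.sqrt v * gaussSum v := by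
  rw [gaussSum_eq_evenKernel hv, gaussSum_eq_evenKernel (inv_pos.2 hv),
    HurwitzZeta.evenKernel_functional_equation 0 v⁻¹, ← HurwitzZeta.evenKernel_eq_cosKernel_of_zero,
    ← Real.sqrt_eq_rpow, Real.sqrt_inv]
  simp

/-- Read off from the weight 3 law for the rectangular lattice with y = 1/√v, between t = √v and
1/√v. One of the two arguments t/y, ty equals 1 on each side. -/
lemma gaussRatio_inv {v : ℝ} (hv : 0 < v) :
    gaussRatio v⁻¹ = 2 * gaussRatio 1 - gaussRatio v := by
  have hs : 0 < Real.sqrt v := Real.sqrt_pos.2 hv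
  have hss : Real.sqrt v * Real.sqrt v = v := Real.mul_self_sqrt hv.le
  have h := thetaRe_inv 0 (inv_pos.2 hs) hs
  rw [thetaRe_zero' (inv_pos.2 hs) hs, thetaRe_zero' (inv_pos.2 hs) (inv_pos.2 hs)] at h
  have e1 : (Real.sqrt v)⁻¹ / (Real.sqrt v)⁻¹ = 1 := div_self (inv_ne_zero hs.ne')
  have e2 : (Real.sqrt v)⁻¹ * (Real.sqrt v)⁻¹ = v⁻¹ := by rw [← mul_inv, hss]
  have e3 : Real.sqrt v / (Real.sqrt v)⁻¹ = v := by rw [div_inv_eq_mul, hss]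
  have e4 : Real.sqrt v * (Real.sqrt v)⁻¹ = 1 := mul_inv_cancel₀ hs.ne'
  rw [e1, e2, e3, e4, gaussSum_inv hv] at h
  have hπ := Real.pi_pos
  have g1 := one_le_gaussSum one_pos
  have g2 := one_le_gaussSum hv
  have g1' : gaussSum 1 ≠ 0 := by linarith
  have g2' : gaussSum v ≠ 0 := by linarith
  field_simp at h
  rw [one_div] at h
  linarith

lemma gaussRatio_one_lt {v : ℝ} (hv : 0 < v) (hv1 : v < 1) : gaussRatio 1 < gaussRatio v := by
  have h1 := gaussRatio_inv (inv_pos.2 hv)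
  rw [inv_inv] at h1
  have h2 := gaussRatio_lt le_rfl (one_lt_inv₀ hv |>.2 hv1)
  linarith

/-- Rectangular lattices. -/
lemma thetaRe_zero_pos {y t : ℝ} (hy : 1 < y) (ht : 1 ≤ t) : 0 < thetaRe 0 y t := by
  have hy0 : 0 < y := by linarith
  have ht0 : 0 < t := by linarith
  rw [thetaRe_zero' hy0 ht0]
  have g1 := one_le_gaussSum (v := t / y) (by positivity)
  have g2 := one_le_gaussSum (v := t * y) (by positivity)
  have hW : 1 < t * y := by nlinarith
  have hvW : t / y < t * y := by
    rw [div_lt_iff₀ hy0]; nlinarith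
  have key : gaussRatio (t * y) < gaussRatio (t / y) := by
    -- Monotonicity is only known on [1, ∞). If t/y < 1, the value at 1 separates the two ratios by
    -- the reflection law.
    rcases le_or_gt 1 (t / y) with h | h
    · exact gaussRatio_lt h hvW
    · exact (gaussRatio_lt le_rfl hW).trans (gaussRatio_one_lt (by positivity) h)
  have : 0 < gaussRatio (t / y) - gaussRatio (t * y) := by linarith
  have := Real.pi_pos
  positivity

/-! ### Positivity for Re z² when y ≥ 1.2 -/

lemma gaussSum_le {v : ℝ} (hv : 1 ≤ v) : gaussSum v ≤ 1.15 := by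
  have hv0 : 0 < v := by linarith
  have h1 : gaussSum v ≤ gaussSum 1 := by
    rcases hv.eq_or_lt with rfl | h
    · rfl
    · exact (gaussSum_lt one_pos h).le
  refine h1.trans ?_
  have hs := summable_int_gaussian one_pos
  have hm := summable_gaussMoment one_pos
  have h2 : gaussSum 1 = 1 + ∑' n : ℤ, if n = 0 then 0 else Real.exp (-π * n ^ 2 * 1) := by
    rw [gaussSum, hs.tsum_eq_add_tsum_ite 0]; simp
  have h3 : ∑' n : ℤ, (if n = 0 then 0 else Real.exp (-π * n ^ 2 * 1)) ≤
      ∑' n : ℤ, π⁻¹ * (π * 1 * n ^ 2 * Real.exp (-π * n ^ 2 * 1)) := by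
    have hle : ∀ n : ℤ, (if n = 0 then 0 else Real.exp (-π * n ^ 2 * 1)) ≤
        π⁻¹ * (π * 1 * n ^ 2 * Real.exp (-π * n ^ 2 * 1)) := by
      intro n
      split_ifs with hn
      · positivity
      · have hn1 : (1 : ℝ) ≤ (n : ℝ) ^ 2 := by
          have : (1 : ℤ) ≤ n ^ 2 := by
            have := sq_nonneg n
            have h0 : n ^ 2 ≠ 0 := pow_ne_zero 2 hn
            omega
          exact_mod_cast this
        have := Real.pi_pos
        have e : π⁻¹ * (π * 1 * (n : ℝ) ^ 2 * Real.exp (-π * n ^ 2 * 1)) =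
          (n : ℝ) ^ 2 * Real.exp (-π * n ^ 2 * 1) := by field_simp
        rw [e]
        exact le_mul_of_one_le_left (Real.exp_pos _).le hn1
    refine Summable.tsum_le_tsum hle ?_ (hm.mul_left _)
    refine Summable.of_nonneg_of_le (fun n => ?_) hle (hm.mul_left _)
    split_ifs <;> positivity
  rw [tsum_mul_left] at h3
  have h4 := gaussMoment_le le_rfl
  rw [gaussMoment] at h4
  have h5 := exp_neg_pi_le
  have h6 : π⁻¹ * ∑' n : ℤ, π * 1 * (n : ℝ) ^ 2 * Real.exp (-π * n ^ 2 * 1) ≤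
      2.1 * Real.exp (-π) := by
    rw [inv_mul_le_iff₀ Real.pi_pos]
    refine h4.trans (le_of_eq ?_)
    rw [mul_one, mul_one]; ring
  rw [h2]
  linarith

lemma gaussMoment_pos {v : ℝ} (hv : 0 < v) : 0 < gaussMoment v := by
  refine (summable_gaussMoment hv).tsum_pos (fun n => by positivity) 1 ?_
  have := Real.pi_pos
  push_cast
  positivity

/-- The factor 1.15 bounds the theta sum on [1, ∞), and the moments are compared term by term: 1.15
w < v exp(πn²(w - v)) because the exponential is at least 1 + 3(w - v). -/
lemma gaussMoment_mul_gaussSum_lt {v w : ℝ} (hv : 1 ≤ v) (hw : 1.1 * v ≤ w) :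
    gaussMoment w * gaussSum v < gaussMoment v := by
  have hv0 : 0 < v := by linarith
  have hw0 : 0 < w := by linarith
  have h1 := gaussSum_le hv
  have hM := gaussMoment_pos hw0
  have hπ := Real.pi_gt_three
  have key : 1.15 * gaussMoment w < gaussMoment v := by
    rw [gaussMoment, gaussMoment, ← tsum_mul_left]
    have hterm : ∀ n : ℤ, n ≠ 0 → 1.15 * (π * w * (n : ℝ) ^ 2 * Real.exp (-π * n ^ 2 * w)) <
        π * v * (n : ℝ) ^ 2 * Real.exp (-π * n ^ 2 * v) := by
      intro n hn
      have hn1 : (1 : ℝ) ≤ (n : ℝ) ^ 2 := by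
        have : (1 : ℤ) ≤ n ^ 2 := by
          have := sq_nonneg n
          have h0 : n ^ 2 ≠ 0 := pow_ne_zero 2 hn
          omega
        exact_mod_cast this
      have e : Real.exp (-π * n ^ 2 * v) =
          Real.exp (-π * n ^ 2 * w) * Real.exp (π * n ^ 2 * (w - v)) := by
        rw [← Real.exp_add]; congr 1; ring
      rw [e]
      have h2 := Real.add_one_le_exp (π * n ^ 2 * (w - v))
      have h3 : 3 * (w - v) ≤ π * (n : ℝ) ^ 2 * (w - v) := by
        have h31 : 3 ≤ π * (n : ℝ) ^ 2 := by nlinarith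
        exact mul_le_mul_of_nonneg_right h31 (by linarith)
      have h4 : 1.15 * w < v * Real.exp (π * n ^ 2 * (w - v)) := by
        have h5 : v * (3 * (w - v) + 1) ≤ v * Real.exp (π * n ^ 2 * (w - v)) := by
          gcongr; linarith
        refine lt_of_lt_of_le ?_ h5
        nlinarith
      have h6 : 0 < π * (n : ℝ) ^ 2 * Real.exp (-π * n ^ 2 * w) := by positivity
      nlinarith [mul_lt_mul_of_pos_left h4 h6]
    refine ((summable_gaussMoment hw0).mul_left _).tsum_lt_tsum (i := 1) (fun n => ?_)
      (hterm 1 one_ne_zero) (summable_gaussMoment hv0)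
    rcases eq_or_ne n 0 with rfl | hn
    · simp
    · exact (hterm n hn).le
  nlinarith

lemma gaussMoment_lt_gaussRatio {v w : ℝ} (hv : 0 < v) (hw1 : 1.1 ≤ w) (hw : 1.1 * v ≤ w) :
    gaussMoment w < gaussRatio v := by
  have main : ∀ v : ℝ, 1 ≤ v → 1.1 * v ≤ w → gaussMoment w < gaussRatio v := fun v hv hw => by
    have := one_le_gaussSum (v := v) (by linarith)
    rw [gaussRatio, lt_div_iff₀ (by linarith)]
    exact gaussMoment_mul_gaussSum_lt hv hw
  rcases le_or_gt 1 v with h | h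
  · exact main v h hw
  · exact (main 1 le_rfl (by linarith)).trans (gaussRatio_one_lt hv h)

/-- Lattices with one short vector. -/
lemma thetaRe_pos (x : ℝ) {y t : ℝ} (hy : 1.2 ≤ y) (ht : 1 ≤ t) : 0 < thetaRe x y t := by
  have hy0 : 0 < y := by linarith
  have ht0 : 0 < t := by linarith
  have hv : 0 < t / y := by positivity
  have hw : 0 < t * y := by positivity
  have hπ := Real.pi_pos
  obtain ⟨h1, h2⟩ := summable_thetaRe_pos x hy0 ht0
  -- Of the positive part only the row m = 0 is kept.
  have hpos : gaussMoment (t / y) / (π * t) ≤ ∑' v : ℤ × ℤ, (v.1 + v.2 * x) ^ 2 / y *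
      (Real.exp (-π * (v.1 + v.2 * x) ^ 2 * (t / y)) * Real.exp (-π * v.2 ^ 2 * (t * y))) := by
    have hinj : Function.Injective fun n : ℤ => ((n, 0) : ℤ × ℤ) := fun a b hab => by
      simpa using hab
    have h3 := tsum_comp_le_tsum_of_inj h1 (fun v => by positivity) hinj
    refine le_trans (le_of_eq ?_) h3
    rw [gaussMoment, ← tsum_div_const]
    refine tsum_congr fun n => ?_
    simp
    field_simp
  -- In row m the shifted Gaussian sum is at most the centred one, which removes the dependence on
  -- x.
  have hneg : ∑' v : ℤ × ℤ, v.2 ^ 2 * y *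
      (Real.exp (-π * (v.1 + v.2 * x) ^ 2 * (t / y)) * Real.exp (-π * v.2 ^ 2 * (t * y))) ≤
      gaussMoment (t * y) * gaussSum (t / y) / (π * t) := by
    have h4 := ((Equiv.prodComm ℤ ℤ).hasSum_iff.2 h2.hasSum).prod_fiberwise
      (g := fun m : ℤ => m ^ 2 * y * Real.exp (-π * m ^ 2 * (t * y)) *
        HurwitzZeta.evenKernel ((m * x : ℝ) : UnitAddCircle) (t / y)) fun m => by
      refine ((HurwitzZeta.hasSum_int_evenKernel (m * x) hv).mul_left
        (m ^ 2 * y * Real.exp (-π * m ^ 2 * (t * y)))).congr_fun fun n => ?_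
      simp only [Function.comp_apply, Equiv.prodComm_apply, Prod.swap_prod_mk]
      ring
    have h5 := ((summable_gaussMoment hw).hasSum.mul_right (gaussSum (t / y))).div_const (π * t)
    refine hasSum_le (fun m => ?_) h4 h5
    have h6 := evenKernel_le_gaussSum (m * x) hv
    calc _ ≤ (m : ℝ) ^ 2 * y * Real.exp (-π * m ^ 2 * (t * y)) * gaussSum (t / y) := by gcongr
      _ = _ := by field_simp
  rw [thetaRe_eq x hy0 ht0]
  have hg := one_le_gaussSum hv
  have key : gaussMoment (t * y) < gaussRatio (t / y) := by
    refine gaussMoment_lt_gaussRatio hv (by nlinarith) ?_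
    rw [mul_div_assoc', div_le_iff₀ hy0]
    nlinarith [mul_le_mul_of_nonneg_left hy hy0.le]
  rw [gaussRatio, lt_div_iff₀ (by linarith)] at key
  have : gaussMoment (t * y) * gaussSum (t / y) / (π * t) < gaussMoment (t / y) / (π * t) := by
    gcongr
  linarith

/-! ### Positivity for Im z² when 0 < x < 1/2 -/

lemma abs_sin_natCast_mul_le (n : ℕ) (θ : ℝ) : |Real.sin (n * θ)| ≤ n * |Real.sin θ| := by
  induction n with
  | zero => simp
  | succ k ih =>
    have e : ((k + 1 : ℕ) : ℝ) * θ = k * θ + θ := by push_cast; ring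
    rw [e, Real.sin_add]
    refine (abs_add_le _ _).trans ?_
    rw [abs_mul, abs_mul]
    have h1 := Real.abs_cos_le_one (k * θ)
    have h2 := Real.abs_cos_le_one θ
    push_cast
    nlinarith [abs_nonneg (Real.sin (k * θ)), abs_nonneg (Real.sin θ)]

/-- The theta series of `Im z²`, summed over the rows of the lattice. -/
lemma hasSum_thetaIm_rows (x : ℝ) {y t : ℝ} (hy : 0 < y) (ht : 0 < t) :
    HasSum (fun m : ℕ => 4 * m * Real.exp (-π * m ^ 2 * (t * y)) *
      HurwitzZeta.oddKernel ((m * x : ℝ) : UnitAddCircle) (t / y)) (thetaIm x y t) := by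
  have hv : 0 < t / y := by positivity
  have h := hasSum_thetaIm x hy ht
  rw [← (Equiv.prodComm ℤ ℤ).hasSum_iff] at h
  have h2 := h.prod_fiberwise (g := fun m : ℤ => 2 * m * Real.exp (-π * m ^ 2 * (t * y)) *
      HurwitzZeta.oddKernel ((m * x : ℝ) : UnitAddCircle) (t / y)) (fun m => by
    have := (HurwitzZeta.hasSum_int_oddKernel (m * x) hv).mul_left
      (2 * m * Real.exp (-π * m ^ 2 * (t * y)))
    refine this.congr_fun ?_
    intro n
    simp
    ring)
  have h3 := h2.nat_add_neg
  simp only [Int.cast_zero, mul_zero, zero_mul, add_zero] at h3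
  refine h3.congr_fun ?_
  intro m
  have e : (((-(m : ℤ) : ℤ) : ℝ) * x : ℝ) = -((m : ℝ) * x) := by push_cast; ring
  rw [e, QuotientAddGroup.mk_neg, HurwitzZeta.oddKernel_neg]
  push_cast
  rw [neg_sq]
  ring

/-- The row m = 1 dominates. Measuring every row by |sin 2πmx| ≤ m sin 2πx puts all of them on the
scale of sin 2πx, so the estimate survives as x tends to 0 or 1/2, where the theta series vanishes.
-/
lemma thetaIm_pos_of_bounds {x y t κ L : ℝ} (hx : 0 < x) (hx2 : x < 1 / 2) (hy : 0 < y) (ht : 0 < t)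
    (hW : 1 / 4 ≤ t * y)
    (hlow : κ * Real.sin (2 * π * x) ≤ HurwitzZeta.oddKernel (x : UnitAddCircle) (t / y))
    (hup : ∀ a : ℝ, |HurwitzZeta.oddKernel (a : UnitAddCircle) (t / y)| ≤
      L * |Real.sin (2 * π * a)|)
    (h : L * (9 / 2 * Real.exp (-4 * π * (t * y))) < κ * Real.exp (-π * (t * y))) :
    0 < thetaIm x y t := by
  have hs : 0 < Real.sin (2 * π * x) := by
    apply Real.sin_pos_of_pos_of_lt_pi <;> nlinarith [Real.pi_pos]
  have hL : 0 ≤ L := by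
    have := (abs_nonneg _).trans (hup x)
    rw [abs_of_pos hs] at this
    exact nonneg_of_mul_nonneg_left this hs
  obtain ⟨hS, hT⟩ := sum_sq_tail hW
  have h1 := hasSum_thetaIm_rows x hy ht
  have h2 := h1.summable.sum_add_tsum_nat_add 2
  rw [h1.tsum_eq] at h2
  simp only [Finset.sum_range_succ, Finset.sum_range_zero] at h2
  have h3 : -(4 * (L * Real.sin (2 * π * x)) * ∑' j : ℕ, ((j : ℝ) + 2) ^ 2 *
      Real.exp (-π * ((j : ℝ) + 2) ^ 2 * (t * y))) ≤
      ∑' j : ℕ, 4 * ((j + 2 : ℕ) : ℝ) * Real.exp (-π * ((j + 2 : ℕ) : ℝ) ^ 2 * (t * y)) *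
      HurwitzZeta.oddKernel ((((j + 2 : ℕ) : ℝ) * x : ℝ) : UnitAddCircle) (t / y) := by
    rw [← tsum_mul_left, ← tsum_neg]
    refine (hS.mul_left _).neg.tsum_le_tsum (fun j => ?_) ((summable_nat_add_iff 2).2 h1.summable)
    set m : ℕ := j + 2 with hm
    have e : (j : ℝ) + 2 = m := by rw [hm]; push_cast; ring
    rw [e]
    have b1 := (neg_abs_le _).trans' (neg_le_neg (hup (m * x)))
    have b2 := abs_sin_natCast_mul_le m (2 * π * x)
    rw [abs_of_pos hs] at b2
    have e2 : 2 * π * (m * x) = m * (2 * π * x) := by ring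
    rw [e2] at b1
    have b3 : -(L * (m * Real.sin (2 * π * x))) ≤
        HurwitzZeta.oddKernel ((m * x : ℝ) : UnitAddCircle) (t / y) :=
      le_trans (neg_le_neg (mul_le_mul_of_nonneg_left b2 hL)) b1
    have b4 := mul_le_mul_of_nonneg_left b3
      (show 0 ≤ 4 * (m : ℝ) * Real.exp (-π * (m : ℝ) ^ 2 * (t * y)) by positivity)
    refine le_trans (le_of_eq ?_) b4
    ring
  have h4 := mul_le_mul_of_nonneg_left hT (show 0 ≤ 4 * (L * Real.sin (2 * π * x)) by positivity)
  have h5 := mul_le_mul_of_nonneg_left hlow (Real.exp_pos (-π * (t * y))).le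
  have h6 := mul_lt_mul_of_pos_right h hs
  simp only [Nat.cast_zero, Nat.cast_one, mul_zero, zero_mul, zero_add, mul_one, one_pow, one_mul]
    at h2
  linarith

lemma hasSum_sinKernel_abs_le {X Q : ℝ} (hX : 0 < X)
    (hQ : HasSum (fun n : ℕ => (n : ℝ) ^ 2 * Real.exp (-π * n ^ 2 * X)) Q) (a : ℝ) :
    |HurwitzZeta.sinKernel (a : UnitAddCircle) X| ≤ 2 * Q * |Real.sin (2 * π * a)| := by
  have h := HurwitzZeta.hasSum_nat_sinKernel a hX
  have h2 := hQ.mul_left (2 * |Real.sin (2 * π * a)|)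
  have h3 := tsum_of_norm_bounded h2 (f := fun n : ℕ => 2 * n * Real.sin (2 * π * a * n) *
    Real.exp (-π * n ^ 2 * X)) (fun n => by
      rw [norm_mul, norm_mul, Real.norm_of_nonneg (Real.exp_pos _).le, Real.norm_eq_abs,
        Real.norm_eq_abs, abs_of_nonneg (by positivity : (0 : ℝ) ≤ 2 * n), mul_comm (2 * π * a)]
      have := abs_sin_natCast_mul_le n (2 * π * a)
      calc _ ≤ 2 * n * (n * |Real.sin (2 * π * a)|) * Real.exp (-π * n ^ 2 * X) := by gcongr
        _ = _ := by ring)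
  rw [h.tsum_eq, Real.norm_eq_abs] at h3
  linarith

lemma sum_sq_exp_le {X : ℝ} (hX : 1 / 4 ≤ X) :
    ∃ Q, HasSum (fun n : ℕ => (n : ℝ) ^ 2 * Real.exp (-π * n ^ 2 * X)) Q ∧
      Q ≤ Real.exp (-π * X) + 9 / 2 * Real.exp (-4 * π * X) := by
  obtain ⟨hS, hT⟩ := sum_sq_tail hX
  have h : Summable fun n : ℕ => (n : ℝ) ^ 2 * Real.exp (-π * n ^ 2 * X) := by
    rw [← summable_nat_add_iff 2]
    simpa using hS
  refine ⟨_, h.hasSum, ?_⟩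
  rw [← h.sum_add_tsum_nat_add 2]
  simp only [Finset.sum_range_succ, Finset.sum_range_zero]
  push_cast
  norm_num at hT ⊢
  linarith

/-- On the dual side exp(-u) ≤ 2/u² turns the series of n² exp(-πn²/v) into a multiple of ζ(2),
bounded by v²/3. The prefactor v^(-3/2) is at most 1/v. -/
lemma abs_oddKernel_le {v : ℝ} (hv : 1 ≤ v) (a : ℝ) :
    |HurwitzZeta.oddKernel (a : UnitAddCircle) v| ≤ v * |Real.sin (2 * π * a)| := by
  have hv0 : 0 < v := by linarith
  have hz := hasSum_zeta_two.mul_left (2 * v ^ 2 / π ^ 2)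
  have hle : ∀ n : ℕ, (n : ℝ) ^ 2 * Real.exp (-π * n ^ 2 * (1 / v)) ≤
      2 * v ^ 2 / π ^ 2 * (1 / (n : ℝ) ^ 2) := by
    intro n
    rcases Nat.eq_zero_or_pos n with rfl | hn
    · simp
    have hn' : (0 : ℝ) < n := by exact_mod_cast hn
    have hπ := Real.pi_pos
    set u := π * (n : ℝ) ^ 2 * (1 / v) with hu
    have hu0 : 0 < u := by positivity
    have e : -π * (n : ℝ) ^ 2 * (1 / v) = -u := by rw [hu]; ring
    have hq := Real.quadratic_le_exp_of_nonneg hu0.le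
    have h1 : Real.exp (-u) ≤ 2 / u ^ 2 := by
      rw [Real.exp_neg, inv_le_comm₀ (Real.exp_pos _) (by positivity), inv_div]
      linarith
    rw [e]
    calc _ ≤ (n : ℝ) ^ 2 * (2 / u ^ 2) := by gcongr
      _ = _ := by rw [hu]; field_simp
  have hs := Summable.of_nonneg_of_le (fun n => by positivity) hle hz.summable
  have hQ : ∑' n : ℕ, (n : ℝ) ^ 2 * Real.exp (-π * n ^ 2 * (1 / v)) ≤ v ^ 2 / 3 := by
    refine (hs.tsum_le_tsum hle hz.summable).trans (le_of_eq ?_)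
    rw [hz.tsum_eq]
    have hπ := Real.pi_pos
    field_simp
    norm_num
  have hb := hasSum_sinKernel_abs_le (by positivity) hs.hasSum a
  have hr : v ≤ v ^ (3 / 2 : ℝ) := by
    conv_lhs => rw [← Real.rpow_one v]
    exact Real.rpow_le_rpow_of_exponent_le hv (by norm_num)
  have hr0 : 0 < v ^ (3 / 2 : ℝ) := by positivity
  rw [HurwitzZeta.oddKernel_functional_equation, abs_mul, abs_of_pos (by positivity)]
  calc _ ≤ 1 / v * (2 * (v ^ 2 / 3) * |Real.sin (2 * π * a)|) := by
        gcongr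
        refine hb.trans ?_
        gcongr
    _ = 2 / 3 * (v * |Real.sin (2 * π * a)|) := by field_simp
    _ ≤ _ := by
        have : 0 ≤ v * |Real.sin (2 * π * a)| := by positivity
        linarith

/-- All terms of the sine series but the first are replaced by their worst case; Q includes the
first term, whence the coefficient 2 before the exponential. -/
lemma sinKernel_ge {X Q x : ℝ} (hX : 0 < X) (hx : 0 ≤ Real.sin (2 * π * x))
    (hQ : HasSum (fun n : ℕ => (n : ℝ) ^ 2 * Real.exp (-π * n ^ 2 * X)) Q) :
    2 * (2 * Real.exp (-π * X) - Q) * Real.sin (2 * π * x) ≤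
      HurwitzZeta.sinKernel (x : UnitAddCircle) X := by
  have h := HurwitzZeta.hasSum_nat_sinKernel x hX
  have h2 := (hQ.mul_left (2 * Real.sin (2 * π * x)))
  have h3 := h.add h2
  have h4 := le_hasSum h3 1 (fun n _ => by
    have := abs_sin_natCast_mul_le n (2 * π * x)
    rw [abs_of_nonneg hx] at this
    have h5 := (neg_abs_le _).trans' (neg_le_neg this)
    rw [mul_comm (n : ℝ) (2 * π * x)] at h5
    have h6 := mul_le_mul_of_nonneg_left h5
      (show 0 ≤ 2 * (n : ℝ) * Real.exp (-π * n ^ 2 * X) by positivity)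
    linarith)
  simp only [Nat.cast_one, mul_one, one_pow, one_mul] at h4
  linarith

/-- Positivity of the theta series of `Im z²`, when the odd kernel is not too concentrated. -/
lemma thetaIm_pos_of_le {x y t : ℝ} (hx : 0 < x) (hx2 : x < 1 / 2) (hy : 0 < y) (ht : 0 < t)
    (hW : 2 / 3 ≤ t * y) (hv4 : t / y ≤ 4) : 0 < thetaIm x y t := by
  have hπ := Real.pi_gt_three
  set v := t / y with hvdef
  have hv : 0 < v := by positivity
  have hX : 1 / 4 ≤ 1 / v := by
    rw [div_le_div_iff₀ (by norm_num) hv]; linarith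
  have hX0 : 0 < 1 / v := by positivity
  obtain ⟨Q, hQ, hQle⟩ := sum_sq_exp_le hX
  -- Since 1/v ≥ 1/4, exp(-3π/v) ≤ exp(-9/4). The value 1/9 makes the tail at most half of the first
  -- term, so Q ≤ 3c/2.
  have h9 : Real.exp (-(9 / 4)) ≤ 1 / 9 := by
    rw [Real.exp_neg, inv_le_comm₀ (Real.exp_pos _) (by norm_num)]
    have h2 := Real.sum_le_exp_of_nonneg (x := 9 / 4) (by norm_num) 6
    simp only [Finset.sum_range_succ, Finset.sum_range_zero, Nat.factorial] at h2
    norm_num at h2 ⊢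
    linarith
  have hT : Real.exp (-4 * π * (1 / v)) ≤ Real.exp (-π * (1 / v)) * (1 / 9) := by
    have e : -4 * π * (1 / v) = -π * (1 / v) + -3 * π * (1 / v) := by ring
    rw [e, Real.exp_add]
    gcongr
    exact (Real.exp_le_exp.2 (by nlinarith)).trans h9
  set c := Real.exp (-π * (1 / v)) with hc
  have hc0 : 0 < c := Real.exp_pos _
  have hQ2 : Q ≤ 3 / 2 * c := by linarith
  have hr : 0 < 1 / v ^ (3 / 2 : ℝ) := by positivity
  set r := 1 / v ^ (3 / 2 : ℝ)
  have hs : 0 < Real.sin (2 * π * x) := by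
    apply Real.sin_pos_of_pos_of_lt_pi <;> nlinarith [Real.pi_pos]
  -- From Q ≤ 3c/2, the lower constant is 2(2c - Q) ≥ c and the upper one 2Q ≤ 3c, both times the
  -- factor r of the functional equation.
  refine thetaIm_pos_of_bounds (κ := r * c) (L := r * (3 * c)) hx hx2 hy ht (by linarith)
    ?_ (fun a => ?_) ?_
  · rw [← hvdef, HurwitzZeta.oddKernel_functional_equation, mul_assoc]
    refine mul_le_mul_of_nonneg_left ?_ hr.le
    refine le_trans ?_ (sinKernel_ge hX0 hs.le hQ)
    gcongr
    linarith
  · rw [← hvdef, HurwitzZeta.oddKernel_functional_equation, abs_mul, abs_of_pos hr, mul_assoc]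
    refine mul_le_mul_of_nonneg_left ?_ hr.le
    refine (hasSum_sinKernel_abs_le hX0 hQ a).trans ?_
    refine mul_le_mul_of_nonneg_right ?_ (abs_nonneg _)
    linarith
  · have e : Real.exp (-4 * π * (t * y)) = Real.exp (-π * (t * y)) *
        Real.exp (-3 * π * (t * y)) := by
      rw [← Real.exp_add]; congr 1; ring
    have h1 : Real.exp (-3 * π * (t * y)) ≤ 1 / 20 * (1 / 20) := by
      have : Real.exp (-3 * π * (t * y)) ≤ Real.exp (-π) * Real.exp (-π) := by
        rw [← Real.exp_add]
        apply Real.exp_le_exp.2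
        nlinarith
      refine this.trans ?_
      gcongr <;> exact exp_neg_pi_le
    have h2 := Real.exp_pos (-π * (t * y))
    have h3 := mul_le_mul_of_nonneg_left h1 h2.le
    rw [e]
    have h4 : 0 < r * c := by positivity
    calc _ ≤ r * (3 * c) * (9 / 2 * (Real.exp (-π * (t * y)) * (1 / 20 * (1 / 20)))) := by gcongr
      _ = r * c * Real.exp (-π * (t * y)) * (27 / 800) := by ring
      _ < r * c * Real.exp (-π * (t * y)) * 1 := by gcongr; norm_num
      _ = _ := by ring

/-- The image sum of the odd kernel, from above the diagonal. -/
lemma oddKernel_ge_sub {v x : ℝ} (hv : 1 ≤ v) (hx : 0 ≤ x) (hx2 : x ≤ 1 / 2) :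
    x * Real.exp (-π * x ^ 2 * v) - (1 - x) * Real.exp (-π * (1 - x) ^ 2 * v) ≤
      HurwitzZeta.oddKernel (x : UnitAddCircle) v := by
  have hπ := Real.pi_gt_three
  have h := (HurwitzZeta.hasSum_int_oddKernel x (show 0 < v by linarith)).nat_add_neg_add_one
  -- Indices n and -n-1 are paired. Every pair with n ≥ 1 is nonnegative, because s exp(-πvs²)
  -- decreases for s ≥ 1; the pair n = 0 is kept.
  have h2 := le_hasSum h 0 (fun n hn => ?_)
  · norm_num at h2
    have e : (-1 + x) ^ 2 = (1 - x) ^ 2 := by ring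
    rw [e] at h2
    simp only [neg_mul]
    linarith
  · have hn1 : (1 : ℝ) ≤ n := by exact_mod_cast Nat.one_le_iff_ne_zero.2 hn
    push_cast
    set s : ℝ := n + x with hs
    set d : ℝ := 1 - 2 * x with hd
    have hs1 : 1 ≤ s := by linarith
    have hd0 : 0 ≤ d := by linarith
    have e1 : (-((n : ℝ) + 1) + x) = -(s + d) := by rw [hs, hd]; ring
    rw [e1]
    have e2 : -π * (-(s + d)) ^ 2 * v = -π * s ^ 2 * v + -(π * v * (2 * s + d) * d) := by ring
    rw [e2, Real.exp_add]
    have h3 : (s + d) * Real.exp (-(π * v * (2 * s + d) * d)) ≤ s := by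
      rw [Real.exp_neg, ← div_eq_mul_inv, div_le_iff₀ (Real.exp_pos _)]
      have h4 := Real.add_one_le_exp (π * v * (2 * s + d) * d)
      have h5 : 1 ≤ π * v := by nlinarith
      have h6 : 1 ≤ π * v * (2 * s + d) := by nlinarith
      have h7 : d ≤ π * v * (2 * s + d) * d := by nlinarith
      nlinarith
    have h8 := mul_le_mul_of_nonneg_left h3 (Real.exp_pos (-π * s ^ 2 * v)).le
    linarith

lemma oddKernel_ge_of_ge {v x : ℝ} (hv : 4 ≤ v) (hx : 1 / 4 ≤ x) (hx2 : x < 1 / 2) :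
    Real.exp (-π * v / 4) / 14 * Real.sin (2 * π * x) ≤
      HurwitzZeta.oddKernel (x : UnitAddCircle) v := by
  have hπ := Real.pi_gt_three
  have hπ4 := Real.pi_le_four
  refine le_trans ?_ (oddKernel_ge_sub (by linarith) (by linarith) hx2.le)
  set d := 1 - 2 * x with hd
  have hd0 : 0 < d := by linarith
  have hd1 : d ≤ 1 / 2 := by linarith
  have e : -π * (1 - x) ^ 2 * v = -π * x ^ 2 * v + -(π * v * d) := by rw [hd]; ring
  rw [e, Real.exp_add]
  have h1 : Real.exp (-(π * v * d)) ≤ 1 / (1 + 12 * d) := by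
    rw [Real.exp_neg, inv_le_comm₀ (Real.exp_pos _) (by positivity), one_div, inv_inv]
    have := Real.add_one_le_exp (π * v * d)
    have h12 : 12 ≤ π * v := by nlinarith
    nlinarith
  -- The exact lower bound is d(5 - 6d)/(1 + 12d), whose quotient by d is smallest at d = 1/2,
  -- namely 2/7. With sin 2πx ≤ 4d this produces the 14.
  have h2 : 2 * d / 7 ≤ x - (1 - x) * Real.exp (-(π * v * d)) := by
    have h3 := mul_le_mul_of_nonneg_left h1 (show 0 ≤ 1 - x by linarith)
    refine le_trans ?_ (sub_le_sub_left h3 x)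
    have ex : x = (1 - d) / 2 := by rw [hd]; ring
    rw [ex, mul_one_div, le_sub_iff_add_le, ← le_sub_iff_add_le', div_le_iff₀ (by positivity)]
    nlinarith
  have h4 : Real.exp (-π * v / 4) ≤ Real.exp (-π * x ^ 2 * v) := by
    apply Real.exp_le_exp.2
    have hx4 : x ^ 2 ≤ 1 / 4 := by nlinarith
    have : 0 ≤ π * v := by positivity
    nlinarith
  have h5 : Real.sin (2 * π * x) ≤ 4 * d := by
    have : 2 * π * x = π - π * d := by rw [hd]; ring
    rw [this, Real.sin_pi_sub]
    refine (Real.sin_le (by positivity)).trans ?_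
    gcongr
  have h6 := Real.exp_pos (-π * v / 4)
  calc _ ≤ Real.exp (-π * v / 4) / 14 * (4 * d) := by gcongr
    _ = Real.exp (-π * v / 4) * (2 * d / 7) := by ring
    _ ≤ Real.exp (-π * x ^ 2 * v) * (x - (1 - x) * Real.exp (-(π * v * d))) := by gcongr
    _ = _ := by ring

/-- For x ≤ 1/4 the term n = 0 dominates. The terms n and -n nearly cancel, leaving an error
proportional to x, as required near x = 0. -/
lemma oddKernel_ge_of_le {v x : ℝ} (hv : 4 ≤ v) (hx : 0 < x) (hx2 : x ≤ 1 / 4) :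
    Real.exp (-π * v / 4) / 14 * Real.sin (2 * π * x) ≤
      HurwitzZeta.oddKernel (x : UnitAddCircle) v := by
  have hπ := Real.pi_gt_three
  have hπ4 := Real.pi_lt_d2
  have hv0 : 0 < v := by linarith
  have hX : 1 / 4 ≤ 9 / 16 * v := by linarith
  obtain ⟨Q, hQ, hQle⟩ := sum_sq_exp_le hX
  -- Pairing n with -n counts the index 0 twice, on both sides. The error of pair n ≥ 1 is at most
  -- 4πvx n² exp(-πn² · 9v/16), since n - x ≥ 3n/4.
  have h := (HurwitzZeta.hasSum_int_oddKernel x hv0).nat_add_neg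
  have hmaj := hQ.mul_left (4 * π * v * x)
  have hdiff := h.add hmaj
  have h2 := le_hasSum hdiff 0 (fun n _ => ?_)
  · norm_num at h2
    -- Compare the two sides of the resulting inequality at the scale of the Gaussian at `1 / 4`.
    set g := Real.exp (-π * v / 16) with hg
    have hg0 : 0 < g := Real.exp_pos _
    have h3 : g ≤ Real.exp (-(π * x ^ 2 * v)) := by
      apply Real.exp_le_exp.2
      have hx4 : x ^ 2 ≤ 1 / 16 := by nlinarith
      have : 0 ≤ π * v := by positivity
      nlinarith
    have h4 : Real.exp (-π * (9 / 16 * v)) = g * Real.exp (-π * (v / 2)) := by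
      rw [hg, ← Real.exp_add]; congr 1; ring
    have h5 : Real.exp (-4 * π * (9 / 16 * v)) ≤ Real.exp (-π * (9 / 16 * v)) * (1 / 20) := by
      have e : -4 * π * (9 / 16 * v) = -π * (9 / 16 * v) + -π * (27 / 16 * v) := by ring
      rw [e, Real.exp_add]
      gcongr
      refine (Real.exp_le_exp.2 ?_).trans exp_neg_pi_le
      nlinarith
    have h6 : v * Real.exp (-π * (v / 2)) ≤ 1 / 97 := by
      have h7 : Real.exp (-π * (v / 2)) ≤ Real.exp (-(3 / 2 * v)) := by
        apply Real.exp_le_exp.2; nlinarith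
      have h8 : 97 * v ≤ Real.exp (3 / 2 * v) := by
        have e : Real.exp (3 / 2 * v) = Real.exp 1 ^ 6 * Real.exp (v / 4 - 1) ^ 6 := by
          rw [← Real.exp_nat_mul, ← Real.exp_nat_mul, ← Real.exp_add]; congr 1; push_cast; ring
        have e1 : (2.71 : ℝ) ^ 6 ≤ Real.exp 1 ^ 6 := by
          gcongr; linarith [Real.exp_one_gt_d9]
        have e2 : v / 4 ≤ Real.exp (v / 4 - 1) := by
          have := Real.add_one_le_exp (v / 4 - 1); linarith
        have e3 : v / 4 ≤ Real.exp (v / 4 - 1) ^ 6 :=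
          e2.trans (le_self_pow₀ (by linarith) (by norm_num))
        rw [e]
        calc 97 * v ≤ (2.71 : ℝ) ^ 6 * (v / 4) := by norm_num; nlinarith
          _ ≤ _ := by gcongr
      calc v * Real.exp (-π * (v / 2)) ≤ v * Real.exp (-(3 / 2 * v)) := by gcongr
        _ ≤ 1 / 97 := by
          rw [Real.exp_neg, ← div_eq_mul_inv, div_le_div_iff₀ (Real.exp_pos _) (by norm_num)]
          linarith
    have h7 : 4 * π * v * x * Q ≤ x * g * (1 / 2) := by
      have hq : Q ≤ 1.225 * (g * Real.exp (-π * (v / 2))) := by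
        rw [← h4]; linarith
      calc 4 * π * v * x * Q ≤ 4 * π * v * x * (1.225 * (g * Real.exp (-π * (v / 2)))) := by gcongr
        _ = 4.9 * π * x * g * (v * Real.exp (-π * (v / 2))) := by ring
        _ ≤ 4.9 * 3.15 * x * g * (1 / 97) := by gcongr
        _ ≤ _ := by nlinarith [mul_pos hx hg0]
    have h8 : Real.exp (-π * v / 4) ≤ g := by
      apply Real.exp_le_exp.2; nlinarith
    have h9 : Real.sin (2 * π * x) ≤ 7 * x := by
      refine (Real.sin_le (by positivity)).trans ?_
      nlinarith
    have h10 : x * g ≤ x * Real.exp (-(π * x ^ 2 * v)) := by gcongr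
    calc _ ≤ g / 14 * (7 * x) := by
          have : 0 ≤ Real.exp (-π * v / 4) / 14 := by positivity
          exact mul_le_mul (by linarith) h9 (Real.sin_nonneg_of_nonneg_of_le_pi (by positivity)
            (by nlinarith)) (by positivity)
      _ ≤ _ := by linarith
  · rcases Nat.eq_zero_or_pos n with rfl | hn
    · simp
      positivity
    have hn1 : (1 : ℝ) ≤ n := by exact_mod_cast hn
    push_cast
    set u := 2 * π * v * n * x with hu
    have hu0 : 0 ≤ u := by positivity
    have e1 : -π * ((n : ℝ) + x) ^ 2 * v = -π * (n ^ 2 + x ^ 2) * v + -u := by rw [hu]; ring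
    have e2 : -π * (-(n : ℝ) + x) ^ 2 * v = -π * (n ^ 2 + x ^ 2) * v + u := by rw [hu]; ring
    have h1 : Real.exp u - Real.exp (-u) ≤ 2 * u * Real.exp u := by
      have := Real.add_one_le_exp (-(2 * u))
      have e : Real.exp (-u) = Real.exp u * Real.exp (-(2 * u)) := by
        rw [← Real.exp_add]; congr 1; ring
      rw [e]
      nlinarith [Real.exp_pos u]
    have h3 : Real.exp (-π * (n ^ 2 + x ^ 2) * v) * Real.exp u ≤
        Real.exp (-π * (n : ℝ) ^ 2 * (9 / 16 * v)) := by
      rw [← Real.exp_add, ← e2]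
      apply Real.exp_le_exp.2
      have : 9 / 16 * (n : ℝ) ^ 2 ≤ (-(n : ℝ) + x) ^ 2 := by nlinarith
      have h4 : 0 ≤ π * v := by positivity
      nlinarith
    rw [e1, e2, Real.exp_add, Real.exp_add]
    set G := Real.exp (-π * ((n : ℝ) ^ 2 + x ^ 2) * v)
    have hG : 0 < G := Real.exp_pos _
    have h4 : (n : ℝ) * (Real.exp u - Real.exp (-u)) ≤ n * (2 * u * Real.exp u) := by gcongr
    have h5 : 0 ≤ x * (Real.exp u + Real.exp (-u)) := by positivity
    have h6 := mul_le_mul_of_nonneg_left h3 (show 0 ≤ 4 * π * v * x * (n : ℝ) ^ 2 by positivity)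
    have h7 : n * (2 * u * Real.exp u) = 4 * π * v * x * n ^ 2 * Real.exp u := by rw [hu]; ring
    rw [h7] at h4
    have h8 := mul_le_mul_of_nonneg_left h4 hG.le
    have h9 := mul_nonneg hG.le h5
    linarith

/-- Positivity of the theta series of `Im z²`, when the odd kernel is concentrated. -/
lemma thetaIm_pos_of_ge {x y t : ℝ} (hx : 0 < x) (hx2 : x < 1 / 2) (hy : 0.7 ≤ y) (ht : 0 < t)
    (hv4 : 4 ≤ t / y) : 0 < thetaIm x y t := by
  have hπ := Real.pi_gt_three
  have hy0 : 0 < y := by linarith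
  set v := t / y with hvdef
  have hv : 0 < v := by linarith
  have hty : t * y = v * y ^ 2 := by rw [hvdef]; field_simp
  have hW : 0.49 * v ≤ t * y := by
    rw [hty, mul_comm]
    gcongr
    nlinarith
  -- The lower constant is on the scale of the Gaussian at x = 1/2. As ty = vy² ≥ 0.49 v, the row
  -- gap exp(-3πty) still beats exp(πv/4), with room for the factor 63 v.
  refine thetaIm_pos_of_bounds (κ := Real.exp (-π * v / 4) / 14) (L := v) hx hx2 hy0 ht
    (by linarith) ?_ (abs_oddKernel_le (by linarith)) ?_
  · rcases le_total x (1 / 4) with h | h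
    · exact oddKernel_ge_of_le hv4 hx h
    · exact oddKernel_ge_of_ge hv4 h hx2
  · have e : Real.exp (-4 * π * (t * y)) = Real.exp (-π * v / 4) * Real.exp (-π * (t * y)) *
        Real.exp (-(3 * π * (t * y) - π * v / 4)) := by
      rw [← Real.exp_add, ← Real.exp_add]; congr 1; ring
    have h1 : Real.exp (-(3 * π * (t * y) - π * v / 4)) ≤ Real.exp (-(3 * v)) := by
      apply Real.exp_le_exp.2
      nlinarith
    have h2 : v * Real.exp (-(3 * v)) ≤ 1 / 121 := by
      rw [Real.exp_neg, ← div_eq_mul_inv, div_le_div_iff₀ (Real.exp_pos _) (by norm_num)]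
      have e2 : Real.exp (3 * v) = Real.exp (v / 2) ^ 6 := by
        rw [← Real.exp_nat_mul]; congr 1; push_cast; ring
      have h3 : v / 2 + 1 ≤ Real.exp (v / 2) := Real.add_one_le_exp _
      have h4 : (3 : ℝ) ≤ Real.exp (v / 2) := by linarith
      rw [e2]
      calc v * 121 = 121 * v := by ring
        _ ≤ 3 ^ 5 * (v / 2 + 1) := by norm_num; linarith
        _ ≤ Real.exp (v / 2) ^ 5 * Real.exp (v / 2) := by gcongr
        _ = 1 * Real.exp (v / 2) ^ 6 := by ring
    have p : 0 < Real.exp (-π * v / 4) * Real.exp (-π * (t * y)) := by positivity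
    rw [e]
    calc _ ≤ v * (9 / 2 * (Real.exp (-π * v / 4) * Real.exp (-π * (t * y)) *
          Real.exp (-(3 * v)))) := by gcongr
      _ = 9 / 2 * (Real.exp (-π * v / 4) * Real.exp (-π * (t * y))) * (v * Real.exp (-(3 * v))) := by
          ring
      _ ≤ 9 / 2 * (Real.exp (-π * v / 4) * Real.exp (-π * (t * y))) * (1 / 121) := by gcongr
      _ < _ := by linarith

lemma thetaIm_pos {x y t : ℝ} (hx : 0 < x) (hx2 : x < 1 / 2) (hy : 0.7 ≤ y) (ht : 1 ≤ t) :
    0 < thetaIm x y t := by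
  rcases le_total (t / y) 4 with h | h
  · exact thetaIm_pos_of_le hx hx2 (by linarith) (by linarith) (by nlinarith) h
  · exact thetaIm_pos_of_ge hx hx2 hy (by linarith) h

/-! ### From positivity to the vanishing of f -/

lemma IsModularFamily.realTheta_pos {ι : Type*} {q : ι → ℝ} {z : ι → ℂ} (h : IsModularFamily q z)
    (hpos : ∀ t, 1 ≤ t → 0 < realTheta q z t) {t : ℝ} (ht : 0 < t) : 0 < realTheta q z t := by
  rcases le_total 1 t with h1 | h1
  · exact hpos t h1
  · rw [← inv_inv t, h.inv t⁻¹ (inv_pos.2 ht)]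
    have := hpos t⁻¹ ((one_le_inv₀ ht).2 h1)
    have := inv_pos.2 ht
    positivity

/-- A modular family with a positive theta series determines the Laplace transform. -/
lemma IsModularFamily.integral_exp_eq_of_pos {ι : Type*} [Countable ι] {q : ι → ℝ} {z : ι → ℂ}
    (h : IsModularFamily q z) (hpos : ∀ t, 1 ≤ t → 0 < realTheta q z t) {μ ν : Measure ℝ}
    (hμ : IsLaplaceMeasure μ) (hν : IsLaplaceMeasure ν)
    (hfin : IsFiniteMeasure μ ∨ IsFiniteMeasure ν)
    {I : Set ℝ} (hI : IsOpen I) (hne : I.Nonempty) (hI0 : I ⊆ Ioi 0)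
    (hsum : ∀ A ∈ I, HasSum (fun i => q i * laplaceDeriv μ ν (A * ‖z i‖ ^ 2)) 0) (r : ℝ) :
    ∫ t, Real.exp (-r * t) ∂μ = ∫ t, Real.exp (-r * t) ∂ν := by
  have hπ := Real.pi_pos
  refine h.integral_exp_eq (fun t ht => (h.realTheta_pos hpos ht).le)
    ⟨1, one_pos, (hpos 1 le_rfl).ne'⟩ hμ hν hfin (fun A hA => ?_) r
  -- Theta series carry a factor π in the exponent, so the parameter interval is rescaled by π.
  refine h.realThetaTransform_eq_of_eqOn hμ hν (I := (fun A => π * A) ⁻¹' I)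
    (hI.preimage (by fun_prop)) ?_ (fun A hA => ?_) (fun A hA => ?_) hA
  · obtain ⟨a, ha⟩ := hne
    exact ⟨a / π, by simpa [mul_div_cancel₀ _ hπ.ne'] using ha⟩
  · have : 0 < π * A := hI0 hA
    exact pos_of_mul_pos_right this hπ.le
  · have hs := hsum _ hA
    have hA0 : 0 < π * A := hI0 hA
    exact h.realThetaTransform_eq hμ hν (pos_of_mul_pos_right hA0 hπ.le) hs.summable hs.tsum_eq

lemma momentSum_conj {ι : Type*} (z : ι → ℂ) (f' : ℝ → ℝ) (A : ℝ) :
    momentSum f' A (fun i => (starRingEnd ℂ) (z i)) = (starRingEnd ℂ) (momentSum f' A z) := by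
  rw [momentSum, momentSum, Complex.conj_tsum]
  refine tsum_congr fun i => ?_
  rw [Complex.norm_conj, map_mul, Complex.conj_ofReal, map_pow]

/-- Every lattice of area one is a rotated or reflected copy of a standard one. -/
lemma latPt_eq_unitPt {β τ : ℂ} (h : ‖β‖ ^ 2 * |τ.im| = 1) :
    ∃ u : ℂ, ‖u‖ = 1 ∧ ((∀ v, latPt β τ v = u * unitPt τ.re |τ.im| v) ∨
      ∀ v, latPt β τ v = u * (starRingEnd ℂ) (unitPt τ.re |τ.im| v)) := by
  have hy : 0 < |τ.im| := by
    refine (abs_nonneg _).lt_of_ne fun h0 => ?_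
    rw [← h0, mul_zero] at h; exact zero_ne_one h
  have hs := Real.sqrt_pos.2 hy
  have hs' : (Real.sqrt |τ.im| : ℂ) ≠ 0 := by exact_mod_cast hs.ne'
  refine ⟨β * Real.sqrt |τ.im|, ?_, ?_⟩
  · rw [norm_mul, Complex.norm_real, Real.norm_of_nonneg hs.le]
    have : (‖β‖ * Real.sqrt |τ.im|) ^ 2 = 1 := by rw [mul_pow, Real.sq_sqrt hy.le, h]
    exact (pow_eq_one_iff_of_nonneg (by positivity) two_ne_zero).1 this
  · rcases le_or_gt 0 τ.im with h0 | h0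
    · left
      intro v
      have e : (⟨τ.re, |τ.im|⟩ : ℂ) = τ := by rw [abs_of_nonneg h0]
      rw [unitPt, latPt, latPt, e, Complex.ofReal_inv]
      field_simp
    · right
      intro v
      have e : (starRingEnd ℂ) (⟨τ.re, |τ.im|⟩ : ℂ) = τ := by
        rw [abs_of_neg h0]; apply Complex.ext <;> simp
      rw [unitPt, latPt, latPt, map_mul, map_add, map_mul, e, Complex.conj_ofReal,
        Complex.ofReal_inv, map_intCast, map_intCast]
      field_simp

/-- A rotation by u multiplies the moment sum by u² and a reflection conjugates it, so vanishing is
invariant. -/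
lemma momentSum_unitPt_eq_zero {β τ : ℂ} (h : ‖β‖ ^ 2 * |τ.im| = 1) {f' : ℝ → ℝ} {A : ℝ}
    (h0 : momentSum f' A (fun v : NonzeroPair => latPt β τ v) = 0) :
    momentSum f' A (fun v : NonzeroPair => unitPt τ.re |τ.im| v) = 0 := by
  obtain ⟨u, hu, hv⟩ := latPt_eq_unitPt h
  have hu0 : u ≠ 0 := by rintro rfl; simp at hu
  have key : ∀ w : NonzeroPair → ℂ, momentSum f' A (fun v => u * w v) = u ^ 2 * momentSum f' A w := by
    intro w
    rw [momentSum, momentSum, ← tsum_mul_left]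
    refine tsum_congr fun v => ?_
    rw [norm_mul, hu, one_mul]
    ring
  rcases hv with hv | hv
  · simp only [hv, key] at h0
    exact (mul_eq_zero.1 h0).resolve_left (pow_ne_zero 2 hu0)
  · simp only [hv, key, momentSum_conj] at h0
    have := (mul_eq_zero.1 h0).resolve_left (pow_ne_zero 2 hu0)
    simpa using this

/-- A unit-area lattice with a definite harmonic theta series is not critical for all dilates. -/
lemma integral_exp_eq_of_definite {f : ℝ → ℝ} {μ ν : Measure ℝ} (hμ : IsLaplaceMeasure μ)
    (hν : IsLaplaceMeasure ν) (hfin : IsFiniteMeasure μ ∨ IsFiniteMeasure ν)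
    (hf : IsDecayPair f (laplaceDeriv μ ν))
    {I : Set ℝ} (hI : IsOpen I) (hne : I.Nonempty) (hI0 : I ⊆ Ioi 0)
    {β τ : ℂ} (h : ‖β‖ ^ 2 * |τ.im| = 1)
    (hdef : (∀ t, 1 ≤ t → 0 < thetaRe τ.re |τ.im| t) ∨ ∀ t, 1 ≤ t → 0 < thetaIm τ.re |τ.im| t)
    (h0 : ∀ A ∈ I, momentSum (laplaceDeriv μ ν) A (fun v : NonzeroPair => latPt β τ v) = 0)
    (r : ℝ) : ∫ t, Real.exp (-r * t) ∂μ = ∫ t, Real.exp (-r * t) ∂ν := by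
  have hy : 0 < |τ.im| := by
    refine (abs_nonneg _).lt_of_ne fun h0 => ?_
    rw [← h0, mul_zero] at h; exact zero_ne_one h
  have hs : ∀ A ∈ I, HasSum (fun v : NonzeroPair =>
      (laplaceDeriv μ ν (A * ‖unitPt τ.re |τ.im| v‖ ^ 2) : ℂ) * unitPt τ.re |τ.im| v ^ 2) 0 := by
    intro A hA
    rw [← momentSum_unitPt_eq_zero h (h0 A hA)]
    exact (summable_momentSum hf (isSparse_unitPt _ hy) (hI0 hA)).hasSum
  rcases hdef with hd | hd
  · refine (isModularFamily_re τ.re hy).integral_exp_eq_of_pos hd hμ hν hfin hI hne hI0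
      (fun A hA => ?_) r
    have := Complex.hasSum_re (hs A hA)
    simp only [Complex.re_ofReal_mul, Complex.zero_re] at this
    simpa only [mul_comm] using this
  · refine (isModularFamily_im τ.re hy).integral_exp_eq_of_pos hd hμ hν hfin hI hne hI0
      (fun A hA => ?_) r
    have := Complex.hasSum_im (hs A hA)
    simp only [Complex.im_ofReal_mul, Complex.zero_im] at this
    simpa only [mul_comm] using this

/-- Exchanging the two basis vectors replaces τ by 1/τ and leaves the lattice unchanged. -/
lemma momentSum_latPt_inv {β τ : ℂ} (hτ : τ ≠ 0) (f' : ℝ → ℝ) (A : ℝ) :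
    momentSum f' A (fun v : NonzeroPair => latPt (β * τ) τ⁻¹ v) =
      momentSum f' A (fun v : NonzeroPair => latPt β τ v) := by
  let e : NonzeroPair ≃ NonzeroPair := (Equiv.prodComm ℤ ℤ).subtypeEquiv fun v => by
    simp [Prod.ext_iff, and_comm]
  rw [momentSum, momentSum, ← e.tsum_eq]
  refine tsum_congr fun v => ?_
  have : latPt (β * τ) τ⁻¹ (e v) = latPt β τ v := by
    simp only [latPt, e, Equiv.subtypeEquiv_apply, Equiv.prodComm_apply, Prod.fst_swap,
      Prod.snd_swap]
    field_simp
    ring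
  rw [this]

/-- The trichotomy for reduced lattices. -/
lemma special_or_integral_exp_eq {f : ℝ → ℝ} {μ ν : Measure ℝ} (hμ : IsLaplaceMeasure μ)
    (hν : IsLaplaceMeasure ν) (hfin : IsFiniteMeasure μ ∨ IsFiniteMeasure ν)
    (hf : IsDecayPair f (laplaceDeriv μ ν))
    {I : Set ℝ} (hI : IsOpen I) (hne : I.Nonempty) (hI0 : I ⊆ Ioi 0)
    {β τ : ℂ} (h : ‖β‖ ^ 2 * |τ.im| = 1) (hx0 : 0 ≤ τ.re) (hx1 : τ.re ≤ 1 / 2) (hn : 1 ≤ ‖τ‖)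
    (h0 : ∀ A ∈ I, momentSum (laplaceDeriv μ ν) A (fun v : NonzeroPair => latPt β τ v) = 0) :
    (τ.re = 0 ∧ |τ.im| = 1) ∨ (τ.re = 1 / 2 ∧ |τ.im| = Real.sqrt 3 / 2) ∨
      ∀ r, ∫ t, Real.exp (-r * t) ∂μ = ∫ t, Real.exp (-r * t) ∂ν := by
  have main := fun β τ h hd h0 => integral_exp_eq_of_definite (β := β) (τ := τ) hμ hν hfin hf hI hne
    hI0 h hd h0
  have hnsq : ‖τ‖ ^ 2 = τ.re ^ 2 + |τ.im| ^ 2 := by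
    rw [sq_abs, ← Complex.normSq_eq_norm_sq, Complex.normSq_apply]; ring
  set y := |τ.im| with hy
  have hy0 : 0 ≤ y := abs_nonneg _
  have hsq : 1 ≤ τ.re ^ 2 + y ^ 2 := by rw [← hnsq]; nlinarith
  rcases le_or_gt 1.2 y with h12 | h12
  · exact Or.inr (Or.inr (main β τ h (Or.inl fun t ht => thetaRe_pos _ h12 ht) h0))
  rcases hx0.eq_or_lt with hx | hx
  · have hy1 : 1 ≤ y := by rw [← hx] at hsq; nlinarith
    rcases hy1.eq_or_lt with h1 | h1
    · exact Or.inl ⟨hx.symm, h1.symm⟩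
    · exact Or.inr (Or.inr (main β τ h (Or.inl fun t ht => by
        rw [← hx]; exact thetaRe_zero_pos h1 ht) h0))
  have hy7 : 0.7 ≤ y := by nlinarith
  rcases hx1.lt_or_eq with hx' | hx'
  · exact Or.inr (Or.inr (main β τ h (Or.inr fun t ht => thetaIm_pos hx hx' hy7 ht) h0))
  · have hs3 : Real.sqrt 3 / 2 ≤ y := by
      rw [div_le_iff₀ two_pos]
      apply Real.sqrt_le_iff.2
      constructor
      · linarith
      · rw [hx'] at hsq; nlinarith
    rcases hs3.eq_or_lt with h1 | h1
    · exact Or.inr (Or.inl ⟨hx', h1.symm⟩)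
    -- On the edge x = 1/2 the form Im z² in this basis is useless. The basis with 1/τ has real part
    -- 1/(2N) < 1/2 and height y/N, where N = 1/4 + y²; y/N ≥ 0.7 holds up to y ≈ 1.22, which fits
    -- the threshold 1.2 for the other form.
    have hτ : τ ≠ 0 := by rintro rfl; simp at hx
    have hy3 : 3 / 4 < y ^ 2 := by
      have : 0 ≤ Real.sqrt 3 / 2 := by positivity
      have h3 := Real.sq_sqrt (show (0 : ℝ) ≤ 3 by norm_num)
      nlinarith
    set N := τ.re ^ 2 + y ^ 2 with hN
    have hN1 : 1 < N := by rw [hN, hx']; linarith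
    have hNS : Complex.normSq τ = N := by rw [Complex.normSq_eq_norm_sq, hnsq]
    have hre : (τ⁻¹).re = 1 / 2 / N := by rw [Complex.inv_re, hNS, hx']
    have him : |(τ⁻¹).im| = y / N := by
      rw [Complex.inv_im, hNS, abs_div, abs_neg, abs_of_pos (by linarith : 0 < N)]
    refine Or.inr (Or.inr (main (β * τ) τ⁻¹ ?_ (Or.inr fun t ht => ?_) fun A hA => ?_))
    · rw [him, norm_mul, mul_pow, hnsq]
      have : N ≠ 0 := by linarith
      field_simp
      exact h
    · rw [hre, him]
      refine thetaIm_pos (by positivity) ?_ ?_ ht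
      · rw [div_lt_iff₀ (by linarith)]; linarith
      · rw [le_div_iff₀ (by linarith), hN, hx']; nlinarith
    · rw [momentSum_latPt_inv hτ]; exact h0 A hA

/-! ### Plane lattices, reduced bases and the energy -/

/-- The complex coordinate of the plane. -/
def toPlane : ℂ ≃ₗᵢ[ℝ] Plane := Complex.orthonormalBasisOneI.repr

lemma toPlane_apply (z : ℂ) : toPlane z = !₂[z.re, z.im] := by
  ext i; fin_cases i <;> simp [toPlane]

/-- The lattice with basis `β, β τ`. -/
def planeLattice (β τ : ℂ) : Submodule ℤ Plane :=
  Submodule.span ℤ {toPlane β, toPlane (β * τ)}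

lemma toPlane_latPt (β τ : ℂ) (v : ℤ × ℤ) :
    toPlane (latPt β τ v) = v.1 • toPlane β + v.2 • toPlane (β * τ) := by
  rw [← map_zsmul, ← map_zsmul, ← map_add, latPt]
  congr 1
  simp only [zsmul_eq_mul]
  ring

lemma mem_planeLattice {β τ : ℂ} {p : Plane} :
    p ∈ planeLattice β τ ↔ ∃ v : ℤ × ℤ, toPlane (latPt β τ v) = p := by
  simp only [planeLattice, Submodule.mem_span_pair, toPlane_latPt, Prod.exists]

lemma planeLattice_le {β τ β' τ' : ℂ} (v w : ℤ × ℤ) (h1 : latPt β τ v = β')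
    (h2 : latPt β τ w = β' * τ') : planeLattice β' τ' ≤ planeLattice β τ := by
  rw [planeLattice, Submodule.span_le, insert_subset_iff, singleton_subset_iff]
  exact ⟨mem_planeLattice.2 ⟨v, by rw [h1]⟩, mem_planeLattice.2 ⟨w, by rw [h2]⟩⟩

lemma planeLattice_neg (β τ : ℂ) : planeLattice β (-τ) = planeLattice β τ :=
  le_antisymm (planeLattice_le (1, 0) (0, -1) (by simp [latPt]) (by simp [latPt]))
    (planeLattice_le (1, 0) (0, -1) (by simp [latPt]) (by simp [latPt]))

lemma planeLattice_one_sub (β τ : ℂ) : planeLattice β (1 - τ) = planeLattice β τ :=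
  le_antisymm (planeLattice_le (1, 0) (1, -1) (by simp [latPt]) (by simp [latPt]; ring_nf; simp))
    (planeLattice_le (1, 0) (1, -1) (by simp [latPt]) (by simp [latPt]))

lemma exists_planeLattice_eq (L : Submodule ℤ Plane) [DiscreteTopology L] [IsZLattice ℝ L] :
    ∃ β τ : ℂ, L = planeLattice β τ ∧ ‖β‖ ^ 2 * |τ.im| = ZLattice.covolume L := by
  have hfree := ZLattice.module_free ℝ L
  have hfin := ZLattice.module_finite ℝ L
  have hrank : Module.finrank ℤ L = 2 := by
    rw [ZLattice.rank ℝ L, finrank_euclideanSpace_fin]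
  let b := Module.finBasisOfFinrankEq ℤ L hrank
  have hcov := ZLattice.covolume_eq_det_mul_measureReal L volume b
    (EuclideanSpace.basisFun (Fin 2) ℝ).toBasis
  have hvol : (volume : Measure Plane).real
      (ZSpan.fundamentalDomain (EuclideanSpace.basisFun (Fin 2) ℝ).toBasis) = 1 := by
    rw [measureReal_congr (ZSpan.fundamentalDomain_ae_parallelepiped _ _), measureReal_def,
      OrthonormalBasis.coe_toBasis, OrthonormalBasis.volume_parallelepiped, ENNReal.toReal_one]
  rw [hvol, mul_one] at hcov
  set w : Fin 2 → ℂ := fun i => toPlane.symm (b i) with hw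
  have hwb : ∀ i, toPlane (w i) = b i := fun i => toPlane.apply_symm_apply _
  have hdet : (EuclideanSpace.basisFun (Fin 2) ℝ).toBasis.det (Subtype.val ∘ b) =
      (w 0).re * (w 1).im - (w 0).im * (w 1).re := by
    rw [Module.Basis.det_apply, Matrix.det_fin_two]
    simp only [Module.Basis.toMatrix_apply, Function.comp_apply, ← hwb, toPlane_apply]
    simp
    ring
  have hpos := ZLattice.covolume_pos L (volume : Measure Plane)
  have hw0 : w 0 ≠ 0 := by
    intro h0
    rw [hdet, h0] at hcov
    simp at hcov
    linarith
  refine ⟨w 0, w 1 / w 0, ?_, ?_⟩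
  · rw [planeLattice, mul_div_cancel₀ _ hw0, hwb, hwb]
    have h1 := congrArg (Submodule.map L.subtype) b.span_eq
    rw [Submodule.map_span, Submodule.map_top, Submodule.range_subtype, ← range_comp] at h1
    refine h1.symm.trans ?_
    congr 1
    ext p
    simp [Fin.exists_fin_two, eq_comm]
  · rw [hcov, hdet, Complex.div_im, ← Complex.normSq_eq_norm_sq,
      ← abs_of_nonneg (Complex.normSq_nonneg (w 0)), ← abs_mul,
      abs_of_nonneg (Complex.normSq_nonneg (w 0))]
    congr 1
    have : Complex.normSq (w 0) ≠ 0 := by simpa using hw0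
    field_simp

/-- SL₂(ℤ) reduction gives |Re τ| ≤ 1/2 and |τ| ≥ 1. Changing τ to -τ keeps the lattice and makes Re
τ ≥ 0, at the price of the sign of Im τ; hence areas and heights are stated with |Im τ|. -/
lemma exists_reduced (β τ : ℂ) (hτ : τ.im ≠ 0) :
    ∃ β' τ' : ℂ, planeLattice β τ = planeLattice β' τ' ∧
      ‖β'‖ ^ 2 * |τ'.im| = ‖β‖ ^ 2 * |τ.im| ∧ 0 ≤ τ'.re ∧ τ'.re ≤ 1 / 2 ∧ 1 ≤ ‖τ'‖ := by
  wlog him : 0 < τ.im generalizing τ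
  · have := this (-τ) (by simpa using hτ) (by
      rw [Complex.neg_im]; rcases lt_or_gt_of_ne hτ with h | h
      · linarith
      · exact absurd h him)
    simpa only [planeLattice_neg, Complex.neg_im, abs_neg] using this
  obtain ⟨g, hg⟩ := ModularGroup.exists_smul_mem_fd ⟨τ, him⟩
  have hτ' := UpperHalfPlane.coe_specialLinearGroup_apply g ⟨τ, him⟩
  set τ₁ : ℂ := ((g • (⟨τ, him⟩ : UpperHalfPlane) : UpperHalfPlane) : ℂ) with hτ₁
  obtain ⟨hn, hre⟩ := hg
  rw [← hτ₁, Complex.normSq_eq_norm_sq] at hn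
  have hn' : 1 ≤ ‖τ₁‖ := (one_le_sq_iff₀ (norm_nonneg _)).1 hn
  change |τ₁.re| ≤ 1 / 2 at hre
  have hdet := g.det_coe
  rw [Matrix.det_fin_two] at hdet
  set a := g 0 0
  set b := g 0 1
  set c := g 1 0
  set d := g 1 1
  simp only [algebraMap_int_eq, eq_intCast, Complex.ofReal_intCast] at hτ'
  have hden : (c * τ + d : ℂ) ≠ 0 := by
    intro h0
    rw [h0, div_zero] at hτ'
    rw [hτ', norm_zero] at hn'
    linarith
  have hmul : (c * τ + d) * τ₁ = a * τ + b := by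
    rw [hτ']; field_simp
  have hdetC : (a * d - b * c : ℂ) = 1 := by exact_mod_cast hdet
  have hlat : planeLattice β τ = planeLattice (β * (c * τ + d)) τ₁ := by
    refine le_antisymm (planeLattice_le (a, -c) (-b, d) ?_ ?_)
      (planeLattice_le (d, c) (b, a) ?_ ?_) <;> simp only [latPt] <;> push_cast
    · linear_combination (-β * c) * hmul + β * hdetC
    · linear_combination β * d * hmul + β * τ * hdetC
    · ring
    · linear_combination -β * hmul
  have harea : ‖β * (c * τ + d)‖ ^ 2 * |τ₁.im| = ‖β‖ ^ 2 * |τ.im| := by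
    rw [norm_mul, mul_pow, mul_assoc]
    congr 1
    have hN : Complex.normSq (c * τ + d : ℂ) ≠ 0 := by simpa using hden
    have e : τ₁.im = τ.im / Complex.normSq (c * τ + d : ℂ) := by
      rw [hτ', Complex.div_im, div_sub_div_same]
      congr 1
      have : (a * d - b * c : ℝ) = 1 := by exact_mod_cast hdet
      simp
      linear_combination τ.im * this
    rw [e, abs_div, ← Complex.normSq_eq_norm_sq, abs_of_nonneg (Complex.normSq_nonneg _)]
    field_simp
  rw [abs_le] at hre
  rcases le_total 0 τ₁.re with h | h
  · exact ⟨_, τ₁, hlat, harea, h, hre.2, hn'⟩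
  · refine ⟨_, -τ₁, hlat.trans (planeLattice_neg _ _).symm, ?_, ?_, ?_, ?_⟩
    · rwa [Complex.neg_im, abs_neg]
    · simpa using h
    · rw [Complex.neg_re]; linarith
    · rwa [norm_neg]

lemma norm_deform_sq (q : ℝ × ℝ) (hq : 0 < q.2) (z : ℂ) :
    ‖deform q.1 q.2 (toPlane z)‖ ^ 2 = deformSq q z := by
  have h2 : (Real.sqrt q.2)⁻¹ * (Real.sqrt q.2)⁻¹ = q.2⁻¹ := by
    rw [← mul_inv, Real.mul_self_sqrt hq.le]
  rw [EuclideanSpace.norm_sq_eq, Fin.sum_univ_two, Real.norm_eq_abs, Real.norm_eq_abs, sq_abs,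
    sq_abs, deform, Matrix.toLpLin_apply, toPlane_apply]
  simp [Matrix.mulVec, dotProduct, Fin.sum_univ_two, deformSq]
  calc _ = ((Real.sqrt q.2)⁻¹ * (Real.sqrt q.2)⁻¹) *
        ((z.re + q.1 * z.im) ^ 2 + q.2 ^ 2 * z.im ^ 2) := by ring
    _ = _ := by rw [h2]; field_simp

lemma latPt_injective {β τ : ℂ} (hβ : β ≠ 0) (hτ : τ.im ≠ 0) : Function.Injective (latPt β τ) := by
  intro v w h
  have h1 := mul_left_cancel₀ hβ h
  have him := congrArg Complex.im h1
  simp at him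
  have h2 : v.2 = w.2 := by
    rcases him with h | h
    · exact h
    · exact absurd h hτ
  have hre := congrArg Complex.re h1
  simp [h2] at hre
  exact Prod.ext hre h2

lemma energy_smul_map_deform (f : ℝ → ℝ) {A : ℝ} (hA : 0 < A) {β τ : ℂ} (hβ : β ≠ 0)
    (hτ : τ.im ≠ 0) (q : ℝ × ℝ) (hq : 0 < q.2) :
    energy f (Real.sqrt A • (planeLattice β τ).map ((deform q.1 q.2).restrictScalars ℤ)) =
      ∑' v : NonzeroPair, f (A * deformSq q (latPt β τ v)) := by
  have hsA := Real.sqrt_pos.2 hA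
  let T : ℂ →ₗ[ℝ] Plane :=
    Real.sqrt A • (deform q.1 q.2 ∘ₗ (toPlane.toLinearEquiv : ℂ →ₗ[ℝ] Plane))
  have hT : ∀ z, T z = Real.sqrt A • deform q.1 q.2 (toPlane z) := fun z => rfl
  have hTn : ∀ z, ‖T z‖ ^ 2 = A * deformSq q z := fun z => by
    rw [hT, norm_smul, mul_pow, norm_deform_sq q hq, Real.norm_of_nonneg hsA.le, Real.sq_sqrt hA.le]
  have hTinj : Function.Injective T := by
    rw [injective_iff_map_eq_zero]
    intro z hz
    have h := hTn z
    rw [hz, norm_zero] at h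
    have h0 : deformSq q z = 0 := by
      rcases mul_eq_zero.1 (h.symm.trans (zero_pow two_ne_zero)) with h | h
      · exact absurd h hA.ne'
      · exact h
    rw [deformSq, div_eq_zero_iff] at h0
    replace h0 := h0.resolve_right hq.ne'
    have h1 : z.im = 0 := by
      have : (q.2 * z.im) ^ 2 = 0 := by nlinarith [sq_nonneg (z.re + q.1 * z.im), sq_nonneg (q.2 * z.im)]
      simpa [hq.ne'] using this
    rw [h1] at h0
    exact Complex.ext (by simpa using h0) h1
  have hmem : ∀ p, p ∈ Real.sqrt A • (planeLattice β τ).map ((deform q.1 q.2).restrictScalars ℤ) ↔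
      ∃ v, T (latPt β τ v) = p := by
    intro p
    rw [Submodule.mem_smul_pointwise_iff_exists]
    constructor
    · rintro ⟨_, ⟨p', hp', rfl⟩, rfl⟩
      obtain ⟨v, rfl⟩ := mem_planeLattice.1 hp'
      exact ⟨v, rfl⟩
    · rintro ⟨v, rfl⟩
      exact ⟨_, ⟨_, mem_planeLattice.2 ⟨v, rfl⟩, rfl⟩, rfl⟩
  have hinj := hTinj.comp (latPt_injective hβ hτ)
  have hT0 : T (latPt β τ 0) = 0 := by simp [latPt]
  let e : NonzeroPair ≃ {p : Plane // p ∈ Real.sqrt A • (planeLattice β τ).map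
      ((deform q.1 q.2).restrictScalars ℤ) ∧ p ≠ 0} :=
    Equiv.ofBijective (fun v => ⟨T (latPt β τ v), (hmem _).2 ⟨v, rfl⟩, fun h =>
      v.2 (hinj (h.trans hT0.symm))⟩) (by
      constructor
      · intro v w h
        exact Subtype.ext (hinj (congrArg Subtype.val h))
      · rintro ⟨p, hp, hp0⟩
        obtain ⟨v, rfl⟩ := (hmem p).1 hp
        exact ⟨⟨v, fun h => hp0 (by rw [h, hT0])⟩, rfl⟩)
  rw [energy, ← e.tsum_eq]
  exact tsum_congr fun v => congrArg f (hTn _)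

lemma isCriticalAt_planeLattice_iff {f f' : ℝ → ℝ} (hf : IsDecayPair f f') {A : ℝ} (hA : 0 < A)
    {β τ : ℂ} (hβ : β ≠ 0) (hτ : τ.im ≠ 0) :
    IsCriticalAt f A (planeLattice β τ) ↔
      momentSum f' A (fun v : NonzeroPair => latPt β τ v) = 0 := by
  rw [← momentSum_eq_zero_iff_hasFDerivAt hf (isSparse_latPt hβ hτ) hA, IsCriticalAt]
  refine Filter.EventuallyEq.hasFDerivAt_iff ?_
  have : ∀ᶠ q : ℝ × ℝ in 𝓝 (0, 1), 0 < q.2 :=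
    (isOpen_lt continuous_const continuous_snd).mem_nhds (by simp)
  filter_upwards [this] with q hq
  exact energy_smul_map_deform f hA hβ hτ q hq

/-! ### The square and triangular lattices -/

/-- The vertex of the triangular lattice, a primitive sixth root of unity. -/
def triangularPt : ℂ := ⟨1 / 2, Real.sqrt 3 / 2⟩

lemma squareLattice_eq : squareLattice = planeLattice 1 Complex.I := by
  rw [squareLattice, planeLattice, toPlane_apply, toPlane_apply]
  simp

lemma triangularLattice_eq :
    triangularLattice 1 = planeLattice (Real.sqrt (2 / Real.sqrt 3) : ℝ) triangularPt := by
  rw [triangularLattice, planeLattice, Submodule.smul_span, mul_one, Set.smul_set_insert,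
    Set.smul_set_singleton]
  congr 2
  · ext i; fin_cases i <;> simp [toPlane_apply]
  · congr 1
    ext i; fin_cases i <;> simp [toPlane_apply, triangularPt]

lemma map_planeLattice (g : ℂ ≃ₗᵢ[ℝ] ℂ) (R : Plane ≃ₗᵢ[ℝ] Plane)
    (hR : ∀ z, R (toPlane z) = toPlane (g z)) (β τ : ℂ) :
    (planeLattice β τ).map ((R.toLinearEquiv : Plane →ₗ[ℝ] Plane).restrictScalars ℤ) =
      Submodule.span ℤ {toPlane (g β), toPlane (g (β * τ))} := by
  rw [planeLattice, Submodule.map_span, image_pair, ← hR, ← hR]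
  rfl

lemma sameUpToIsometry_planeLattice {β β' : ℂ} (τ : ℂ) (h : ‖β‖ = ‖β'‖) (hβ : β' ≠ 0) :
    SameUpToIsometry (planeLattice β τ) (planeLattice β' τ) := by
  have hn : ‖β / β'‖ = 1 := by
    rw [norm_div, h, div_self (norm_ne_zero_iff.2 hβ)]
  let a : Circle := ⟨β / β', by simpa [Submonoid.unitSphere] using hn⟩
  refine ⟨(toPlane.symm.trans (rotation a)).trans toPlane, ?_⟩
  rw [map_planeLattice (rotation a) _ (fun z => by simp), planeLattice, rotation_apply,
    rotation_apply]
  have : (a : ℂ) = β / β' := rfl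
  rw [this, ← mul_assoc, div_mul_cancel₀ _ hβ]

/-- An isometry of ℂ is a rotation, possibly after conjugation; the latter conjugates τ. -/
lemma exists_planeLattice_of_sameUpToIsometry {L : Submodule ℤ Plane} {β τ : ℂ} (hβ : β ≠ 0)
    (h : SameUpToIsometry L (planeLattice β τ)) :
    ∃ β' τ', β' ≠ 0 ∧ (τ' = τ ∨ τ' = (starRingEnd ℂ) τ) ∧ L = planeLattice β' τ' := by
  obtain ⟨R, rfl⟩ := h
  let g := (toPlane.trans R).trans toPlane.symm
  have hg : ∀ z, R (toPlane z) = toPlane (g z) := fun z => by simp [g]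
  rw [map_planeLattice g R hg]
  obtain ⟨a, ha | ha⟩ := linear_isometry_complex g
  · refine ⟨a * β, τ, mul_ne_zero a.coe_ne_zero hβ, Or.inl rfl, ?_⟩
    rw [ha, rotation_apply, rotation_apply, planeLattice, mul_assoc]
  · refine ⟨a * (starRingEnd ℂ) β, (starRingEnd ℂ) τ, mul_ne_zero a.coe_ne_zero (by simpa using hβ),
      Or.inr rfl, ?_⟩
    rw [ha, planeLattice]
    simp [mul_assoc]

/-- A lattice with complex multiplication by a root of unity other than `±1` has no quadratic
moments. -/
lemma momentSum_eq_zero_of_sq {β τ : ℂ} (k : ℤ) (hτ : τ ^ 2 = k * τ - 1) (hn : ‖τ‖ = 1)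
    (h1 : τ ^ 2 ≠ 1) (f' : ℝ → ℝ) (A : ℝ) :
    momentSum f' A (fun v : NonzeroPair => latPt β τ v) = 0 := by
  -- Multiplication by τ in the basis β, βτ, read off from τ² = kτ - 1: k = 0 for the square
  -- lattice, k = 1 for the triangular one.
  let e₀ : ℤ × ℤ ≃ ℤ × ℤ :=
    ⟨fun v => (-v.2, v.1 + k * v.2), fun v => (v.2 + k * v.1, -v.1), fun v => by ext <;> simp,
      fun v => by ext <;> simp⟩
  let e : NonzeroPair ≃ NonzeroPair := e₀.subtypeEquiv fun v => by
    rw [not_iff_not, ← e₀.injective.eq_iff]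
    simp [e₀]
  have he : ∀ v : NonzeroPair, latPt β τ (e v) = τ * latPt β τ v := by
    intro v
    simp only [latPt, e, e₀, Equiv.subtypeEquiv_apply, Equiv.coe_fn_mk]
    push_cast
    linear_combination -β * v.1.2 * hτ
  have h : momentSum f' A (fun v : NonzeroPair => latPt β τ v) =
      τ ^ 2 * momentSum f' A (fun v : NonzeroPair => latPt β τ v) := by
    conv_lhs => rw [momentSum, ← e.tsum_eq]
    rw [momentSum, ← tsum_mul_left]
    refine tsum_congr fun v => ?_
    rw [he, norm_mul, hn, one_mul]
    ring
  have h2 : (1 - τ ^ 2) * momentSum f' A (fun v : NonzeroPair => latPt β τ v) = 0 := by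
    linear_combination h
  exact (mul_eq_zero.1 h2).resolve_left fun h3 => h1 (sub_eq_zero.1 h3).symm

lemma triangularPt_sq : triangularPt ^ 2 = triangularPt - 1 := by
  have h3 : Real.sqrt 3 * Real.sqrt 3 = 3 := Real.mul_self_sqrt (by norm_num)
  apply Complex.ext
  · simp [triangularPt, pow_two]; nlinarith
  · simp [triangularPt, pow_two]; ring

lemma norm_triangularPt : ‖triangularPt‖ = 1 := by
  have h3 : Real.sqrt 3 * Real.sqrt 3 = 3 := Real.mul_self_sqrt (by norm_num)
  rw [← pow_eq_one_iff_of_nonneg (norm_nonneg _) two_ne_zero, ← Complex.normSq_eq_norm_sq,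
    Complex.normSq_apply, triangularPt]
  nlinarith

lemma isCriticalAt_of_special {f f' : ℝ → ℝ} (hf : IsDecayPair f f') {L : Submodule ℤ Plane}
    (h : SameUpToIsometry L squareLattice ∨ SameUpToIsometry L (triangularLattice 1)) {A : ℝ}
    (hA : 0 < A) : IsCriticalAt f A L := by
  have main : ∀ (k : ℤ) (β τ₀ : ℂ), β ≠ 0 → τ₀ ^ 2 = k * τ₀ - 1 → ‖τ₀‖ = 1 → τ₀.im ≠ 0 →
      τ₀ ^ 2 ≠ 1 → SameUpToIsometry L (planeLattice β τ₀) → IsCriticalAt f A L := by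
    intro k β τ₀ hβ hτ hn him h1 hL
    obtain ⟨β', τ, hβ', hτ', rfl⟩ := exists_planeLattice_of_sameUpToIsometry hβ hL
    rcases hτ' with rfl | rfl
    · rw [isCriticalAt_planeLattice_iff hf hA hβ' him]
      exact momentSum_eq_zero_of_sq k hτ hn h1 f' A
    · rw [isCriticalAt_planeLattice_iff hf hA hβ' (by simpa using him)]
      refine momentSum_eq_zero_of_sq k ?_ (by simpa using hn) (fun h => h1 ?_) f' A
      · rw [← map_pow, hτ]; simp
      · rw [← map_pow] at h
        have := congrArg (starRingEnd ℂ) h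
        simpa using this
  have h3 : 0 < Real.sqrt 3 := Real.sqrt_pos.2 (by norm_num)
  rcases h with h | h
  · rw [squareLattice_eq] at h
    exact main 0 1 Complex.I one_ne_zero (by simp) (by simp) (by simp)
      (by rw [Complex.I_sq]; norm_num) h
  · rw [triangularLattice_eq] at h
    refine main 1 _ triangularPt ?_ ?_ norm_triangularPt ?_ ?_ h
    · exact_mod_cast (Real.sqrt_pos.2 (by positivity)).ne'
    · rw [triangularPt_sq]; simp
    · simp [triangularPt]
    · rw [triangularPt_sq]
      intro h
      have := congrArg Complex.im h
      simp [triangularPt] at this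

lemma special_of_reduced {β τ : ℂ} (h : ‖β‖ ^ 2 * |τ.im| = 1)
    (hτ : (τ.re = 0 ∧ |τ.im| = 1) ∨ (τ.re = 1 / 2 ∧ |τ.im| = Real.sqrt 3 / 2)) :
    SameUpToIsometry (planeLattice β τ) squareLattice ∨
      SameUpToIsometry (planeLattice β τ) (triangularLattice 1) := by
  have h3 : 0 < Real.sqrt 3 := Real.sqrt_pos.2 (by norm_num)
  rcases hτ with ⟨hre, him⟩ | ⟨hre, him⟩
  · left
    have e : planeLattice β τ = planeLattice β Complex.I := by
      rcases (abs_eq zero_le_one).1 him with h1 | h1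
      · congr 1; apply Complex.ext <;> simp [hre, h1]
      · rw [← planeLattice_neg]
        congr 1; apply Complex.ext <;> simp [hre, h1]
    rw [e, squareLattice_eq]
    refine sameUpToIsometry_planeLattice _ ?_ one_ne_zero
    rw [him, mul_one] at h
    rw [norm_one]
    exact (pow_eq_one_iff_of_nonneg (norm_nonneg _) two_ne_zero).1 h
  · right
    have e : planeLattice β τ = planeLattice β triangularPt := by
      rcases (abs_eq (by positivity)).1 him with h1 | h1
      · congr 1; apply Complex.ext <;> simp [hre, h1, triangularPt]
      · rw [← planeLattice_one_sub]
        congr 1; apply Complex.ext <;> simp [hre, h1, triangularPt]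
        norm_num
    rw [e, triangularLattice_eq]
    refine sameUpToIsometry_planeLattice _ ?_ ?_
    · rw [Complex.norm_real, Real.norm_of_nonneg (Real.sqrt_nonneg _), eq_comm,
        Real.sqrt_eq_iff_mul_self_eq (by positivity) (norm_nonneg _)]
      rw [him] at h
      field_simp
      linarith
    · exact_mod_cast (Real.sqrt_pos.2 (by positivity)).ne'

end VolumeStationary

end

/-! ### The main theorem -/

theorem theorem1p3
    (f : ℝ → ℝ)
    (hf_ne : ∃ r : ℝ, 0 < r ∧ f r ≠ 0)
    (hf_decay : ∃ η : ℝ, 0 < η ∧ f =O[atTop] fun r : ℝ => r ^ (-(2 : ℝ) / 2 - η))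
    (hf_laplace : VolumeStationary.IsLaplaceTransform f)
    (L₀ : Submodule ℤ VolumeStationary.Plane)
    [DiscreteTopology L₀] [IsZLattice ℝ L₀]
    (hL₀ : ZLattice.covolume L₀ = 1) :
    ((∃ I : Set ℝ, IsOpen I ∧ I.OrdConnected ∧ I.Nonempty ∧ I ⊆ Ioi 0 ∧
        ∀ A ∈ I, VolumeStationary.IsCriticalAt f A L₀) ↔
      (VolumeStationary.SameUpToIsometry L₀ VolumeStationary.squareLattice ∨
        VolumeStationary.SameUpToIsometry L₀ (VolumeStationary.triangularLattice 1))) ∧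
    ((VolumeStationary.SameUpToIsometry L₀ VolumeStationary.squareLattice ∨
        VolumeStationary.SameUpToIsometry L₀ (VolumeStationary.triangularLattice 1)) →
      ∀ A ∈ Ioi (0 : ℝ), VolumeStationary.IsCriticalAt f A L₀) := by
  obtain ⟨η, hη, hdecay⟩ := hf_decay
  obtain ⟨μ, ν, hμ0, hν0, hfin, hlap⟩ := hf_laplace
  have hμ : VolumeStationary.IsLaplaceMeasure μ := ⟨hμ0, fun r hr => (hlap r hr).1⟩
  have hν : VolumeStationary.IsLaplaceMeasure ν := ⟨hν0, fun r hr => (hlap r hr).2.1⟩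
  have hf := VolumeStationary.isDecayPair_of_laplace hμ hν hη (fun r hr => (hlap r hr).2.2) hdecay
  refine ⟨⟨?_, fun h => ⟨Ioi 0, isOpen_Ioi, ordConnected_Ioi, nonempty_Ioi, subset_rfl,
    fun A hA => VolumeStationary.isCriticalAt_of_special hf h hA⟩⟩,
    fun h A hA => VolumeStationary.isCriticalAt_of_special hf h hA⟩
  rintro ⟨I, hI, -, hne, hI0, hcrit⟩
  obtain ⟨β₀, τ₀, rfl, hcov⟩ := VolumeStationary.exists_planeLattice_eq L₀
  rw [hL₀] at hcov
  have hne0 : ∀ {β τ : ℂ}, ‖β‖ ^ 2 * |τ.im| = 1 → β ≠ 0 ∧ τ.im ≠ 0 := by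
    intro β τ h
    constructor
    · rintro rfl; simp at h
    · intro h0; simp [h0] at h
  obtain ⟨β, τ, hlat, harea, hx0, hx1, hn⟩ := VolumeStationary.exists_reduced β₀ τ₀ (hne0 hcov).2
  rw [hcov] at harea
  obtain ⟨hβ, hτ⟩ := hne0 harea
  rw [hlat] at hcrit ⊢
  have h0 := fun A hA => (VolumeStationary.isCriticalAt_planeLattice_iff hf (hI0 hA) hβ hτ).1
    (hcrit A hA)
  rcases VolumeStationary.special_or_integral_exp_eq hμ hν hfin hf hI hne hI0 harea hx0 hx1 hn h0
    with h | h | h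
  · exact VolumeStationary.special_of_reduced harea (Or.inl h)
  · exact VolumeStationary.special_of_reduced harea (Or.inr h)
  · obtain ⟨r, hr, hfr⟩ := hf_ne
    exact absurd (by rw [(hlap r hr).2.2, h r, sub_self]) hfr
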